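/- **Model.** Let $N$ be a set of $n$ agents and $M$ a set of $m$ items. A \emph{report} of agent $i$ is a pair $x_i=(D_i,S_i)$ of disjoint subsets of $M$ (the items he demands and the items he owns); his true pair is his \emph{type}. The trading graph $G(x)$ of a profile $x=(x_i)_{i\in N}$ is the directed bipartite graph on $N\cup M$ with edge set $E$ consisting of the demand edges $(i,j)$, $j\in D_i$, and the supply edges $(j,i)$, $j\in S_i$. Executing a (simple, directed) cycle $C=(i_1,j_1,\dots,i_k,j_k,i_1)$ of the current graph means that each $i_t$ receives $j_t$ and gives $j_{t-1}$ (indices modulo $k$); the edge set $E$ is then replaced by $(E\setminus C)\cup\{(j_t,i_t): 1\le t\le k\}$. An \emph{execution} is a finite sequence of cycles, each of them a cycle of the graph left by the previous ones; it is \emph{static} if each item is reallocated at most once. The utility $u_i(r)$ of agent $i$ is the number of items that he receives in $r$ if, in every cycle, he receives an item of his current (true) demand set and gives an item of his current (true) supply set, these sets being updated after each cycle; otherwise $u_i(r)=-nm$. The social welfare of $r$ is $\sum_{i} u_i(r)$. An \emph{optimal} static execution is one that maximizes the social welfare among static executions. **The algorithm $A_s$.** Let $\pi$ assign to the pairs in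 $N\times M$ distinct natural numbers in $\{1,\dots,nm\}$. For a trading graph $G$ with edge set $E$, let $H'(G)$ be the bipartite graph on $E\times\{0\}$ and $E\times\{1\}$ in which $(e,0)$ is joined to $(e,1)$ with weight $0$, for all $e\in E$, and $(e,0)$ is joined to $(e',1)$ with weight $1+2^{-\pi(i,j)}$ whenever $e=(u,v)$ and $e'=(v,z)$ are edges of $G$, where $i$ and $j$ are the agent and the item joined by $e$. On a report profile $x$, $A_s$ chooses a maximum-weight perfect matching of $H'(G(x))$ and outputs a sequence of simple cycles that together use exactly the edges $e$ for which $(e,0)$ is not matched to $(e,1)$, each of them once. **Theorem.** 1. For every order $\pi$, and however $A_s$ chooses among the maximum-weight perfect matchings and the corresponding sequences of cycles: (a) $A_s$ is strategyproof: for every agent $i$, every type $x_i=(D_i,S_i)$, every report $x'_i=(D'_i,S'_i)$ and all reports $x'_{-i}$ of the other agents, $u_i(A_s(x_i,x'_{-i}))\ge u_i(A_s(x'_i,x'_{-i}))$, where $u_i$ is the utility for the type $x_i$. In particular no agent gains by adding items to, or hiding items from, his demand or supply set. The reported supply sets of different agents may overlap. (b) On every profile $x$ the output is an execution of $G(x)$.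 If the supply sets in $x$ are pairwise disjoint (in particular, if they partition $M$), the output is an optimal static execution, and the social welfare of every (possibly dynamic) execution of $G(x)$ is at most $l$ times that of the output, where $l=\max_{i}|D_i|$. 2. $A_s$ can be implemented in polynomial time: a single program, given $n$, $m$, $\pi$ and a report profile, outputs an execution that $A_s$ may choose, in a number of steps that is polynomial in $n+m$. (Steps are those of a unit-cost random access machine with addition and truncated subtraction.) 3. Consequently there is a polynomial-time strategyproof algorithm, taking only $n$, $m$ and the reports as input, that computes an optimal static execution and provides an $l$-approximation to the social welfare of an optimal (possibly dynamic) execution. -/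

import Mathlib

namespace DurableGoods

/-! ## Trading graphs, executions, utilities -/

/-- The directed edges that a bipartite trading graph between agents `N` and items `M` can have:
a demand edge `(i, j)` from an agent to an item, or a supply edge `(j, i)` from an item to an
agent. -/
inductive Edge (N M : Type*) where
  | dem (i : N) (j : M) : Edge N M
  | sup (j : M) (i : N) : Edge N M
deriving DecidableEq

namespace Edge

variable {N M : Type*}

/-- The vertex from which an edge leaves. -/
def src : Edge N M → N ⊕ M
  | dem i _ => Sum.inl i
  | sup j _ => Sum.inr j

/-- The vertex at which an edge arrives. -/
def tgt : Edge N M → N ⊕ M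
  | dem _ j => Sum.inr j
  | sup _ i => Sum.inl i

/-- The agent and the item that an edge joins, regardless of its direction. -/
def pair : Edge N M → N × M
  | dem i j => (i, j)
  | sup j i => (i, j)

end Edge

/-- What an agent reports (or his true type): the items that he demands and the items that he owns.
No agent demands an item that he owns. -/
structure Report (M : Type*) where
  demand : Finset M
  supply : Finset M
  disj : Disjoint demand supply

/-- One report for every agent. Nothing prevents two agents from reporting the same item as
their own. -/
abbrev Profile (N M : Type*) := N → Report M

/-- A cycle `(i₁, j₁, i₂, j₂, …, iₖ, jₖ, i₁)` is recorded as the list of its exchanges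
`[(i₁, j₁), …, (iₖ, jₖ)]`: agent `iₜ` receives item `jₜ`, which is given by agent `iₜ₊₁`. -/
abbrev Cycle (N M : Type*) := List (N × M)

/-- A (candidate) execution is a sequence of cycles. -/
abbrev Execution (N M : Type*) := List (Cycle N M)

/-- A mechanism maps the agents' reports to a sequence of cycles. -/
abbrev Mechanism (N M : Type*) := Profile N M → Execution N M

section Model

variable {N M : Type*} [Fintype N] [DecidableEq N] [Fintype M] [DecidableEq M]

/-- The edge set of the trading graph of a profile. -/
def tradingGraph (x : Profile N M) : Finset (Edge N M) :=
  (Finset.univ.biUnion fun i => (x i).demand.image (Edge.dem i)) ∪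
    (Finset.univ.biUnion fun i => (x i).supply.image fun j => Edge.sup j i)

/-- No item is owned by two agents. (In an instance the supply sets partition the set of items;
items that nobody owns are allowed here.) -/
def SuppliesDisjoint (x : Profile N M) : Prop :=
  Pairwise fun i k => Disjoint (x i).supply (x k).supply

/-- The edges `(iₜ, jₜ)` and `(jₜ, iₜ₊₁)` (indices modulo `k`) of a cycle. -/
def cycleEdges (C : Cycle N M) : List (Edge N M) :=
  C.map (fun p => Edge.dem p.1 p.2) ++
    List.zipWith (fun p q => Edge.sup p.2 q.1) C (C.rotate 1)

/-- `C` is a (simple) directed cycle of the graph with edge set `E`. -/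
def IsCycle (E : Finset (Edge N M)) (C : Cycle N M) : Prop :=
  C ≠ [] ∧ (C.map Prod.fst).Nodup ∧ (C.map Prod.snd).Nodup ∧ ∀ e ∈ cycleEdges C, e ∈ E

/-- The edge set after the cycle step `C`: the edges of the cycle are removed and its demand edges
come back reversed, as supply edges. -/
def cycleStep (E : Finset (Edge N M)) (C : Cycle N M) : Finset (Edge N M) :=
  (E \ (cycleEdges C).toFinset) ∪ (C.map fun p => Edge.sup p.2 p.1).toFinset

/-- Every cycle of the sequence is a cycle of the graph that the previous cycle steps left. -/
def IsExecution : Finset (Edge N M) → Execution N M → Prop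
  | _, [] => True
  | E, C :: r => IsCycle E C ∧ IsExecution (cycleStep E C) r

/-- Each item is reallocated at most once. -/
def IsStatic (r : Execution N M) : Prop :=
  (r.flatten.map Prod.snd).Nodup

/-- The items that agent `i` receives in a cycle. -/
def received (i : N) (C : Cycle N M) : Finset M :=
  Finset.univ.filter fun j => Edge.dem i j ∈ cycleEdges C

/-- The items that agent `i` gives in a cycle. -/
def given (i : N) (C : Cycle N M) : Finset M :=
  Finset.univ.filter fun j => Edge.sup j i ∈ cycleEdges C

/-- The set `A_i(r)` of the items that agent `i` receives in `r`. -/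
def receivedItems (i : N) (r : Execution N M) : Finset M :=
  Finset.univ.filter fun j => ∃ C ∈ r, j ∈ received i C

/-- In every cycle of the sequence, what agent `i` receives is in his current demand set and what
he gives is in his current supply set, where his current sets are `D` and `S` at the start. -/
def Acceptable (i : N) : Finset M → Finset M → Execution N M → Prop
  | _, _, [] => True
  | D, S, C :: r => received i C ⊆ D ∧ given i C ⊆ S ∧
      Acceptable i (D \ received i C) ((S \ given i C) ∪ received i C) r

open Classical in
/-- The utility of agent `i` with true demand and supply sets `θ`. -/
noncomputable def utility (i : N) (θ : Report M) (r : Execution N M) : ℤ :=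
  if Acceptable i θ.demand θ.supply r then ((receivedItems i r).card : ℤ)
  else -((Fintype.card N : ℤ) * (Fintype.card M : ℤ))

/-- The social welfare of `r` when the true demand and supply sets are `x`. -/
noncomputable def socialWelfare (x : Profile N M) (r : Execution N M) : ℤ :=
  ∑ i, utility i (x i) r

/-- `l`, the maximal number of items that an agent demands. -/
def maxDemand (x : Profile N M) : ℕ :=
  Finset.univ.sup fun i => (x i).demand.card

/-- `r` is a static execution that maximizes the social welfare among static executions. -/
def IsOptimalStatic (x : Profile N M) (r : Execution N M) : Prop :=
  IsExecution (tradingGraph x) r ∧ IsStatic r ∧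
    ∀ r', IsExecution (tradingGraph x) r' → IsStatic r' → socialWelfare x r' ≤ socialWelfare x r

/-- The welfare of every (static or dynamic) execution is at most `l` times that of `r`. -/
def IsLApproximation (x : Profile N M) (r : Execution N M) : Prop :=
  ∀ r', IsExecution (tradingGraph x) r' →
    socialWelfare x r' ≤ (maxDemand x : ℤ) * socialWelfare x r

/-- Whatever the others report, no agent `i` with true type `x i` gains by any other report `y`. -/
def Strategyproof (A : Mechanism N M) : Prop :=
  ∀ (x : Profile N M) (i : N) (y : Report M),
    utility i (x i) (A (Function.update x i y)) ≤ utility i (x i) (A x)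

/-! ## The bipartite edge-copy graph and the mechanism `A_s` -/

/-- A complete order of the agent-item pairs: distinct numbers between `1` and `|N| * |M|`. -/
structure EdgeOrder (N M : Type*) [Fintype N] [Fintype M] where
  rank : N × M → ℕ
  injective : Function.Injective rank
  one_le : ∀ p, 1 ≤ rank p
  le_card : ∀ p, rank p ≤ Fintype.card N * Fintype.card M

/-- The edge set of the bipartite graph on the two copies `E × {0}` and `E × {1}` of `E`: the pair
`(e, e')` stands for the edge joining `(e, 0)` and `(e', 1)`. Each edge is joined to its own copy
and to the copies of the edges that start where it ends. -/
def copyGraph (E : Finset (Edge N M)) : Finset (Edge N M × Edge N M) :=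
  (E ×ˢ E).filter fun p => p.1 = p.2 ∨ p.1.tgt = p.2.src

/-- The perturbed weights: `0` between the two copies of an edge, and `1 + 2 ^ (-π(i, j))` on an
edge of the copy graph that leaves `(e, 0)`, where `e` joins agent `i` and item `j` in either
direction. -/
def weight (π : EdgeOrder N M) (p : Edge N M × Edge N M) : ℚ :=
  if p.1 = p.2 then 0 else 1 + ((2 : ℚ) ^ π.rank p.1.pair)⁻¹

/-- A set of edges of the copy graph that covers each of its vertices exactly once. -/
def IsPerfectMatching (E : Finset (Edge N M)) (μ : Finset (Edge N M × Edge N M)) : Prop :=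
  μ ⊆ copyGraph E ∧ (∀ e ∈ E, ∃! e', (e, e') ∈ μ) ∧ (∀ e' ∈ E, ∃! e, (e, e') ∈ μ)

/-- `μ` is a perfect matching of maximum total perturbed weight. -/
def IsMaxWeightPerfectMatching (π : EdgeOrder N M) (E : Finset (Edge N M))
    (μ : Finset (Edge N M × Edge N M)) : Prop :=
  IsPerfectMatching E μ ∧
    ∀ μ', IsPerfectMatching E μ' → ∑ p ∈ μ', weight π p ≤ ∑ p ∈ μ, weight π p

/-- The edges `e` of the trading graph whose copy `(e, 0)` is not matched to `(e, 1)`. -/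
def usedEdges (μ : Finset (Edge N M × Edge N M)) : Finset (Edge N M) :=
  (μ.filter fun p => p.1 ≠ p.2).image Prod.fst

/-- The sequence `r` of cycles corresponds to the matching `μ`: its simple cycles use exactly
the edges not matched to their own copies, each of them once. -/
def Corresponds (μ : Finset (Edge N M × Edge N M)) (r : Execution N M) : Prop :=
  (∀ C ∈ r, IsCycle (usedEdges μ) C) ∧ (r.flatMap cycleEdges).Nodup ∧
    ∀ e ∈ usedEdges μ, e ∈ r.flatMap cycleEdges

/-- `A` is a version of the mechanism `A_s` with tie-breaking order `π`: on every profile it chooses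
some maximum-weight perfect matching and returns some execution that corresponds to it. -/
def IsAs (π : EdgeOrder N M) (A : Mechanism N M) : Prop :=
  ∀ x, ∃ μ, IsMaxWeightPerfectMatching π (tradingGraph x) μ ∧ Corresponds μ (A x)

end Model

/-! ## Running time: a random access machine with structured programs

The memory consists of two-dimensional arrays of natural numbers; array `a` is a constant of the
program, its two indices are computed. The only arithmetic is addition and truncated subtraction,
and each elementary operation takes one step, so that polynomial time is the usual one (numbers have
at most linearly many more bits than there were steps; there is no multiplication). -/

/-- The contents of cell `(u, v)` of array `a` is `s a u v`. -/
abbrev Store := ℕ → ℕ → ℕ → ℕ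

/-- Arithmetic expressions: constants, array cells, sums and truncated differences. -/
inductive Expr where
  | lit (c : ℕ) : Expr
  | get (a : ℕ) (u v : Expr) : Expr
  | add (e f : Expr) : Expr
  | sub (e f : Expr) : Expr

/-- The value of an expression. -/
def Expr.eval (s : Store) : Expr → ℕ
  | .lit c => c
  | .get a u v => s a (u.eval s) (v.eval s)
  | .add e f => e.eval s + f.eval s
  | .sub e f => e.eval s - f.eval s

/-- The number of steps that the evaluation of an expression takes. -/
def Expr.cost : Expr → ℕ
  | .lit _ => 1
  | .get _ u v => u.cost + v.cost + 1
  | .add e f => e.cost + f.cost + 1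
  | .sub e f => e.cost + f.cost + 1

/-- Programs. A test succeeds when the value of its expression is not `0`. -/
inductive Program where
  | skip : Program
  | set (a : ℕ) (u v e : Expr) : Program
  | seq (P Q : Program) : Program
  | ite (b : Expr) (P Q : Program) : Program
  | loop (b : Expr) (P : Program) : Program

/-- The store after cell `(u, v)` of array `a` has received the value `w`. -/
def Store.write (s : Store) (a u v w : ℕ) : Store :=
  fun a' u' v' => if a' = a ∧ u' = u ∧ v' = v then w else s a' u' v'

/-- `Runs P s s' t`: started in the store `s`, the program `P` halts in the store `s'` after exactly
`t` steps. -/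
inductive Runs : Program → Store → Store → ℕ → Prop where
  | skip (s : Store) : Runs .skip s s 1
  | set (s : Store) (a : ℕ) (u v e : Expr) :
      Runs (.set a u v e) s (s.write a (u.eval s) (v.eval s) (e.eval s))
        (u.cost + v.cost + e.cost + 1)
  | seq {P Q : Program} {s s' s'' : Store} {t t' : ℕ} :
      Runs P s s' t → Runs Q s' s'' t' → Runs (.seq P Q) s s'' (t + t')
  | ite_true {b : Expr} {P Q : Program} {s s' : Store} {t : ℕ} :
      b.eval s ≠ 0 → Runs P s s' t → Runs (.ite b P Q) s s' (b.cost + 1 + t)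
  | ite_false {b : Expr} {P Q : Program} {s s' : Store} {t : ℕ} :
      b.eval s = 0 → Runs Q s s' t → Runs (.ite b P Q) s s' (b.cost + 1 + t)
  | loop_done {b : Expr} {P : Program} {s : Store} :
      b.eval s = 0 → Runs (.loop b P) s s (b.cost + 1)
  | loop_step {b : Expr} {P : Program} {s s' s'' : Store} {t t' : ℕ} :
      b.eval s ≠ 0 → Runs P s s' t → Runs (.loop b P) s' s'' t' →
        Runs (.loop b P) s s'' (b.cost + 1 + t + t')

/-- An `n × m` matrix as the contents of an array that is `0` elsewhere. -/
def matrixArray {n m : ℕ} (f : Fin n → Fin m → ℕ) (u v : ℕ) : ℕ :=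
  if h : u < n ∧ v < m then f ⟨u, h.1⟩ ⟨v, h.2⟩ else 0

/-- The input: the numbers of agents and of items in arrays `0` and `1`, the `0`-`1` matrices
of the reported demands and supplies in arrays `2` and `3`, a matrix `f` of further data in
array `4`, and `0` everywhere else. -/
def inputStore {n m : ℕ} (x : Profile (Fin n) (Fin m)) (f : Fin n → Fin m → ℕ) : Store
  | 0, u, v => if u = 0 ∧ v = 0 then n else 0
  | 1, u, v => if u = 0 ∧ v = 0 then m else 0
  | 2, u, v => matrixArray (fun i j => if j ∈ (x i).demand then 1 else 0) u v
  | 3, u, v => matrixArray (fun i j => if j ∈ (x i).supply then 1 else 0) u v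
  | 4, u, v => matrixArray f u v
  | _, _, _ => 0

/-- The output: cell `(0, 0)` of array `5` holds the number of cycles, cell `(k + 1, 0)` of array
`5` the number of exchanges in cycle `k`, and cells `(k, t)` of arrays `6` and `7` the agent and the
item of exchange `t` of cycle `k` (counting from `0`). -/
def Outputs {n m : ℕ} (s : Store) (r : Execution (Fin n) (Fin m)) : Prop :=
  s 5 0 0 = r.length ∧
    ∀ (k : ℕ) (hk : k < r.length), s 5 (k + 1) 0 = (r[k]).length ∧
      ∀ (t : ℕ) (ht : t < (r[k]).length),
        s 6 k t = ((r[k])[t].1 : ℕ) ∧ s 7 k t = ((r[k])[t].2 : ℕ)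

/-- One program computes all the mechanisms of the family from the reports alone, in a number of
steps that is polynomial in the number of agents and items. -/
def IsPolyTime (A : ∀ n m : ℕ, Mechanism (Fin n) (Fin m)) : Prop :=
  ∃ (P : Program) (p : Polynomial ℕ), ∀ (n m : ℕ) (x : Profile (Fin n) (Fin m)),
    ∃ (s : Store) (t : ℕ), Runs P (inputStore x fun _ _ => 0) s t ∧ t ≤ p.eval (n + m) ∧
      Outputs s (A n m x)

/-- The same for mechanisms that depend on an order of the agent-item pairs, which is then a part of
the input. -/
def IsPolyTimeWithOrder
    (A : ∀ n m : ℕ, EdgeOrder (Fin n) (Fin m) → Mechanism (Fin n) (Fin m)) : Prop :=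
  ∃ (P : Program) (p : Polynomial ℕ), ∀ (n m : ℕ) (π : EdgeOrder (Fin n) (Fin m))
    (x : Profile (Fin n) (Fin m)),
    ∃ (s : Store) (t : ℕ), Runs P (inputStore x fun i j => π.rank (i, j)) s t ∧
      t ≤ p.eval (n + m) ∧ Outputs s (A n m π x)

end DurableGoods

namespace DurableGoods

/-! ## Balanced edge sets -/

section Circulations

variable {ε V : Type*} [DecidableEq ε] [DecidableEq V]

/-! A perfect matching of the copy graph is a permutation of the edge set that sends each edge to
itself or to an edge starting where it ends. The edges it moves form a balanced set, and every
balanced set arises this way, so the mechanism selects a balanced set of maximum weight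
(`isMaxWeightPerfectMatching_iff`). Scaled by `2 ^ (nm)`, each edge weighs `2 ^ (nm)` plus a power
of two belonging to its agent-item pair. No pair is joined in both directions, so the weight of a
set encodes its cardinality in the high digits and the set itself in the low ones. The optimum is
therefore unique and has as many edges as possible, half of them demand edges.

Strategyproofness. An unacceptable outcome is worth `-nm`. If the outcome of a misreport is
acceptable, its edge set `F'` lies in the intersection of the true and the reported graph, is
optimal there, and the intersection differs from the true graph only in edges at the agent `i`. Let
`F` be the optimum of the true graph (`outdegree_le_of_subgraph`). The symmetric difference of `F`
and `F'`, with the edges outside `F` reversed, splits into pieces that pass through each vertex at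
most once. A piece on which `F'` has more edges out of `i` than `F` uses no edge of `F` at `i`; it
can then be exchanged in both optima, so its two halves have equal weight and hence coincide, which
is absurd. So `i` receives at least as much when telling the truth.

Welfare. The net effect of an execution, with each item going straight from its first to its last
owner, is a balanced set of edges of the original graph (`netEdges_balanced`), so it has no more
demand edges than the optimum. A static execution has one net demand edge per received item, which
gives optimality. In a dynamic execution an agent who takes part gives away an item that can never
come back, as nobody demands what he owns; this is at least one net edge against at most `l`
received items.

Computation. Maximum-weight circulations are computed by inserting the edges one at a time while
keeping potentials that satisfy complementary slackness (`insertEdge_spec`). For a new edge from `u`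
to `v`, a primal-dual search raises potentials until a tight residual path from `v` to `u` appears,
along which the circulation is augmented, or until the new edge may stay unused. Slackness implies
optimality (`sum_le_of_slack`). The circulation is then cut into cycles by following pointers
(`decompose_spec`). All loops have length `n + m`, so the running time is polynomial by the shape of
the program (`runs_exec`). -/

/-- As many edges of `R` leave each vertex as arrive there. -/
def Balanced (s t : ε → V) (R : Finset ε) : Prop :=
  ∀ v, (R.filter fun e => s e = v).card = (R.filter fun e => t e = v).card

theorem Balanced.of_bijOn {s t : ε → V} {R : Finset ε} (f : ε → ε)
    (hf : Set.BijOn f R R) (hst : ∀ e ∈ R, s (f e) = t e) : Balanced s t R := by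
  intro v
  symm
  refine Finset.card_bij (fun e _ => f e) ?_ ?_ ?_
  · intro e he
    rw [Finset.mem_filter] at he ⊢
    exact ⟨hf.mapsTo he.1, (hst e he.1).trans he.2⟩
  · intro a ha b hb hab
    exact hf.injOn (Finset.mem_filter.1 ha).1 (Finset.mem_filter.1 hb).1 hab
  · intro b hb
    rw [Finset.mem_filter] at hb
    obtain ⟨a, ha, rfl⟩ := hf.surjOn hb.1
    exact ⟨a, Finset.mem_filter.2 ⟨ha, (hst a ha).symm.trans hb.2⟩, rfl⟩

theorem Balanced.sdiff {s t : ε → V} {R C : Finset ε} (hR : Balanced s t R)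
    (hC : Balanced s t C) (h : C ⊆ R) : Balanced s t (R \ C) := by
  intro v
  have key : ∀ g : ε → V, ((R \ C).filter fun e => g e = v).card
      + (C.filter fun e => g e = v).card = (R.filter fun e => g e = v).card := by
    intro g
    rw [← Finset.card_union_of_disjoint, ← Finset.filter_union, Finset.sdiff_union_of_subset h]
    exact Finset.disjoint_filter_filter Finset.sdiff_disjoint
  have h1 := key s
  have h2 := key t
  have h3 := hR v
  have h4 := hC v
  omega

/-- A nonempty balanced set contains a nonempty balanced set that leaves each vertex at most
once. -/
theorem Balanced.exists_simple {s t : ε → V} {R : Finset ε} (h : Balanced s t R)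
    (hne : R.Nonempty) : ∃ C ⊆ R, C.Nonempty ∧ Balanced s t C ∧
      ∀ v, (C.filter fun e => s e = v).card ≤ 1 := by
  classical
  obtain ⟨e₀, he₀⟩ := hne
  have hout : ∀ v, ∃ e', (∃ e ∈ R, t e = v) → e' ∈ R ∧ s e' = v := by
    intro v
    by_cases hv : ∃ e ∈ R, t e = v
    · obtain ⟨e, he, hev⟩ := hv
      have hpos : 0 < (R.filter fun e => s e = v).card := by
        rw [h v]
        exact Finset.card_pos.2 ⟨e, Finset.mem_filter.2 ⟨he, hev⟩⟩
      obtain ⟨e', he'⟩ := Finset.card_pos.1 hpos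
      exact ⟨e', fun _ => Finset.mem_filter.1 he'⟩
    · exact ⟨e₀, fun h => absurd h hv⟩
  choose out hout using hout
  -- One outgoing edge is fixed at every vertex where an edge of `R` arrives, so `f` walks along `R`
  -- deterministically. Its periodic edges form vertex-disjoint cycles; `C` below is their union and
  -- need not be a single cycle.
  set f : ε → ε := fun e => out (t e) with hf
  have hfR : ∀ e ∈ R, f e ∈ R := fun e he => (hout (t e) ⟨e, he, rfl⟩).1
  have hfs : ∀ e ∈ R, s (f e) = t e := fun e he => (hout (t e) ⟨e, he, rfl⟩).2
  have hiter : ∀ k e, e ∈ R → f^[k] e ∈ R := by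
    intro k
    induction k with
    | zero => exact fun e he => he
    | succ k ih => exact fun e he => by rw [Function.iterate_succ_apply]; exact ih _ (hfR e he)
  set C := R.filter (fun e => e ∈ Function.periodicPts f) with hC
  have hpred : ∀ e ∈ C, ∃ e' ∈ C, f e' = e := by
    intro e he
    obtain ⟨heR, k, hk, hper⟩ := Finset.mem_filter.1 he
    refine ⟨f^[k - 1] e, Finset.mem_filter.2 ⟨hiter _ _ heR, k, hk, ?_⟩, ?_⟩
    · exact hper.apply_iterate _
    · rw [← Function.iterate_succ_apply' f, Nat.succ_eq_add_one, Nat.sub_add_cancel hk]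
      exact hper
  have hCR : C ⊆ R := Finset.filter_subset _ _
  refine ⟨C, hCR, ?_, ?_, ?_⟩
  · have : ¬ Set.InjOn (fun k => f^[k] e₀) (Set.univ : Set ℕ) := by
      intro hinj
      have := Set.infinite_of_injOn_mapsTo hinj (t := (R : Set ε))
        (fun k _ => hiter k e₀ he₀) Set.infinite_univ
      exact this R.finite_toSet
    obtain ⟨a, b, hab, hlt⟩ : ∃ a b, f^[a] e₀ = f^[b] e₀ ∧ a < b := by
      by_contra hcon
      push Not at hcon
      refine this fun a _ b _ hab => le_antisymm ?_ ?_
      · exact hcon b a hab.symm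
      · exact hcon a b hab
    refine ⟨f^[a] e₀, Finset.mem_filter.2 ⟨hiter _ _ he₀, b - a, by omega, ?_⟩⟩
    show f^[b - a] (f^[a] e₀) = f^[a] e₀
    rw [← Function.iterate_add_apply, Nat.sub_add_cancel hlt.le, hab]
  · refine Balanced.of_bijOn f ⟨?_, ?_, ?_⟩ fun e he => hfs e (hCR he)
    · intro e he
      obtain ⟨heR, k, hk, hper⟩ := Finset.mem_filter.1 he
      exact Finset.mem_filter.2 ⟨hfR e heR, k, hk, hper.apply⟩
    · intro a ha b hb hab
      exact (Function.bijOn_periodicPts f).injOn (Finset.mem_filter.1 ha).2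
        (Finset.mem_filter.1 hb).2 hab
    · intro e he
      obtain ⟨e', he', rfl⟩ := hpred e he
      exact ⟨e', he', rfl⟩
  · intro v
    refine Finset.card_le_one.2 fun a ha b hb => ?_
    have key : ∀ e ∈ C, e = out (s e) := by
      intro e he
      obtain ⟨e', he', rfl⟩ := hpred e he
      rw [hfs e' (hCR he')]
    rw [Finset.mem_filter] at ha hb
    rw [key a ha.1, key b hb.1, ha.2, hb.2]

/-! ### Exchanges in the residual graph -/

/-- Exchanging a set `C` that is balanced in the residual graph of `F`. -/
theorem Balanced.exchange {s t : ε → V} {F C : Finset ε} (hF : Balanced s t F)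
    (hC : Balanced (fun e => if e ∈ F then s e else t e) (fun e => if e ∈ F then t e else s e) C) :
    Balanced s t ((F \ C) ∪ (C \ F)) := by
  intro v
  have h1 := hF v
  have h2 := hC v
  have hd : Disjoint (F \ C) (C \ F) := disjoint_sdiff_sdiff
  -- Edges of `F` keep their direction and the others are reversed, so the balance of `C` says that
  -- `F ∩ C` and `C \ F` have the same net outflow at `v`.
  have split : ∀ g h : ε → V, (C.filter fun e => (if e ∈ F then g e else h e) = v).card
      = ((F ∩ C).filter fun e => g e = v).card + ((C \ F).filter fun e => h e = v).card := by
    intro g h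
    rw [← Finset.card_union_of_disjoint]
    · congr 1
      ext e
      by_cases he : e ∈ F <;> simp [he]
    · refine Finset.disjoint_left.2 fun e he he' => ?_
      simp only [Finset.mem_filter, Finset.mem_inter, Finset.mem_sdiff] at he he'
      exact he'.1.2 he.1.1
  have splitF : ∀ g : ε → V, (F.filter fun e => g e = v).card
      = ((F ∩ C).filter fun e => g e = v).card + ((F \ C).filter fun e => g e = v).card := by
    intro g
    rw [← Finset.card_union_of_disjoint, ← Finset.filter_union, Finset.union_comm,
      Finset.sdiff_union_inter]
    exact Finset.disjoint_filter_filter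
      (Finset.disjoint_left.2 fun e he he' =>
        (Finset.mem_sdiff.1 he').2 (Finset.mem_inter.1 he).2)
  rw [split, split] at h2
  rw [splitF, splitF] at h1
  rw [Finset.filter_union, Finset.filter_union,
    Finset.card_union_of_disjoint (Finset.disjoint_filter_filter hd),
    Finset.card_union_of_disjoint (Finset.disjoint_filter_filter hd)]
  omega

/-- The symmetric difference of two balanced sets is balanced when the edges of the second are
reversed. -/
theorem Balanced.residual {s t : ε → V} {F F' : Finset ε} (hF : Balanced s t F)
    (hF' : Balanced s t F') :
    Balanced (fun e => if e ∈ F then s e else t e) (fun e => if e ∈ F then t e else s e)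
      ((F \ F') ∪ (F' \ F)) := by
  intro v
  have h1 := hF v
  have h2 := hF' v
  have split : ∀ g h : ε → V,
      (((F \ F') ∪ (F' \ F)).filter fun e => (if e ∈ F then g e else h e) = v).card
      = ((F \ F').filter fun e => g e = v).card + ((F' \ F).filter fun e => h e = v).card := by
    intro g h
    rw [← Finset.card_union_of_disjoint]
    · congr 1
      ext e
      by_cases he : e ∈ F <;> simp [he]
    · exact Finset.disjoint_filter_filter disjoint_sdiff_sdiff
  have splitF : ∀ (A B : Finset ε) (g : ε → V), (A.filter fun e => g e = v).card
      = ((A ∩ B).filter fun e => g e = v).card + ((A \ B).filter fun e => g e = v).card := by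
    intro A B g
    rw [← Finset.card_union_of_disjoint, ← Finset.filter_union, Finset.union_comm,
      Finset.sdiff_union_inter]
    exact Finset.disjoint_filter_filter
      (Finset.disjoint_left.2 fun e he he' =>
        (Finset.mem_sdiff.1 he').2 (Finset.mem_inter.1 he).2)
  rw [splitF F F', splitF F F'] at h1
  rw [splitF F' F, splitF F' F, Finset.inter_comm] at h2
  rw [split, split]
  omega

/-- Removing edges at a vertex `i` from the graph does not increase the number of edges that leave
`i` in the heaviest balanced set, if different sets of edges have different weights. -/
theorem outdegree_le_of_subgraph {s t : ε → V} {w : ε → ℕ} {E E' F F' : Finset ε} {i : V}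
    (hFE : F ⊆ E) (hFE' : F' ⊆ E') (hE : E' ⊆ E) (hi : ∀ e ∈ E, e ∉ E' → s e = i ∨ t e = i)
    (hF : Balanced s t F) (hF' : Balanced s t F')
    (hopt : ∀ G ⊆ E, Balanced s t G → ∑ e ∈ G, w e ≤ ∑ e ∈ F, w e)
    (hopt' : ∀ G ⊆ E', Balanced s t G → ∑ e ∈ G, w e ≤ ∑ e ∈ F', w e)
    (hw : ∀ A ⊆ E, ∀ B ⊆ E, ∑ e ∈ A, w e = ∑ e ∈ B, w e → A = B) :
    (F'.filter fun e => s e = i).card ≤ (F.filter fun e => s e = i).card := by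
  set s' : ε → V := fun e => if e ∈ F then s e else t e with hs'
  set t' : ε → V := fun e => if e ∈ F then t e else s e with ht'
  -- The claim for a piece that passes through each vertex at most once. If it failed, some `e ∈ C \
  -- F` would leave `i`; reversed, `e` is the only residual edge of `C` that enters `i`.
  have step : ∀ C ⊆ (F \ F') ∪ (F' \ F), C.Nonempty → Balanced s' t' C →
      (∀ v, (C.filter fun e => s' e = v).card ≤ 1) →
      ((C \ F).filter fun e => s e = i).card ≤ ((C ∩ F).filter fun e => s e = i).card := by
    intro C hC hne hbal hone
    by_contra hcon
    push Not at hcon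
    obtain ⟨e, he⟩ := Finset.card_pos.1 (lt_of_le_of_lt (Nat.zero_le _) hcon)
    simp only [Finset.mem_filter, Finset.mem_sdiff] at he
    obtain ⟨⟨heC, heF⟩, hei⟩ := he
    have hone' : ∀ a ∈ C, ∀ b ∈ C, t' a = i → t' b = i → a = b := by
      intro a ha b hb hai hbi
      exact Finset.card_le_one.1 ((hbal i).symm.le.trans (hone i)) a
        (Finset.mem_filter.2 ⟨ha, hai⟩) b (Finset.mem_filter.2 ⟨hb, hbi⟩)
    have hle : ((C \ F).filter fun e => s e = i).card ≤ 1 := by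
      refine Finset.card_le_one.2 fun a ha b hb => ?_
      simp only [Finset.mem_filter, Finset.mem_sdiff] at ha hb
      exact hone' a ha.1.1 b hb.1.1 (by simp [ht', ha.1.2, ha.2]) (by simp [ht', hb.1.2, hb.2])
    have hempty : ((C ∩ F).filter fun e => s e = i).card = 0 := by omega
    rw [Finset.card_eq_zero] at hempty
    -- An edge of `C ∩ F` leaving `i` is excluded by `hempty`, and one arriving at `i` would be a
    -- second residual edge entering `i`. So `C ∩ F` avoids `i` and survives in `E'`.
    have hCF : C ∩ F ⊆ E' := by
      intro a ha
      by_contra haE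
      rcases hi a (hFE (Finset.mem_inter.1 ha).2) haE with h | h
      · have : a ∈ (C ∩ F).filter fun e => s e = i := Finset.mem_filter.2 ⟨ha, h⟩
        rw [hempty] at this
        exact Finset.notMem_empty _ this
      · rw [Finset.mem_inter] at ha
        have := hone' a ha.1 e heC (by simp [ht', ha.2, h]) (by simp [ht', heF, hei])
        exact heF (this ▸ ha.2)
    have hmem : ∀ a ∈ C, (a ∈ F' ↔ a ∉ F) := by
      intro a ha
      have := hC ha
      simp only [Finset.mem_union, Finset.mem_sdiff] at this
      tauto
    have hCF' : C \ F ⊆ F' := fun a ha =>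
      (hmem a (Finset.mem_sdiff.1 ha).1).2 (Finset.mem_sdiff.1 ha).2
    have hCdiff : C \ F' = C ∩ F := by
      ext a
      simp only [Finset.mem_sdiff, Finset.mem_inter]
      constructor
      · rintro ⟨h1, h2⟩
        exact ⟨h1, by by_contra h; exact h2 ((hmem a h1).2 h)⟩
      · rintro ⟨h1, h2⟩
        exact ⟨h1, fun h => (hmem a h1).1 h h2⟩
    have hcap : F' ∩ C = C \ F := by
      ext a
      simp only [Finset.mem_sdiff, Finset.mem_inter]
      constructor
      · rintro ⟨h1, h2⟩
        exact ⟨h2, (hmem a h2).1 h1⟩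
      · rintro ⟨h1, h2⟩
        exact ⟨(hmem a h1).2 h2, h1⟩
    have b1 := hopt _ (Finset.union_subset (Finset.sdiff_subset.trans hFE)
      ((hCF'.trans hFE').trans hE)) (hF.exchange hbal)
    -- Relative to `F'` all residual directions in `C` are opposite, so `C` can be exchanged in `F'`
    -- as well.
    have hbal' : Balanced (fun e => if e ∈ F' then s e else t e)
        (fun e => if e ∈ F' then t e else s e) C := by
      intro v
      have := hbal v
      have e1 : (C.filter fun e => (if e ∈ F' then s e else t e) = v)
          = C.filter fun e => t' e = v := by
        refine Finset.filter_congr fun a ha => ?_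
        by_cases h : a ∈ F <;> simp [ht', h, hmem a ha]
      have e2 : (C.filter fun e => (if e ∈ F' then t e else s e) = v)
          = C.filter fun e => s' e = v := by
        refine Finset.filter_congr fun a ha => ?_
        by_cases h : a ∈ F <;> simp [hs', h, hmem a ha]
      rw [e1, e2, this]
    have b2 := hopt' _ (Finset.union_subset (Finset.sdiff_subset.trans hFE')
      (hCdiff ▸ hCF)) (hF'.exchange hbal')
    rw [Finset.sum_union disjoint_sdiff_sdiff] at b1 b2
    have c1 := Finset.sum_inter_add_sum_sdiff F C w
    have c2 := Finset.sum_inter_add_sum_sdiff F' C w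
    rw [hcap] at c2
    rw [hCdiff] at b2
    rw [Finset.inter_comm] at c1
    -- Optimality of `F` gives one inequality and optimality of `F'` in `E'` the other. By `hw` the
    -- disjoint sets `C ∩ F` and `C \ F` are then equal, although their union `C` is nonempty.
    have heq : ∑ e ∈ C ∩ F, w e = ∑ e ∈ C \ F, w e := by omega
    have := hw _ (Finset.inter_subset_right.trans hFE) _ ((hCF'.trans hFE').trans hE) heq
    obtain ⟨a, ha⟩ := hne
    have h := Finset.ext_iff.1 this a
    simp only [Finset.mem_inter, Finset.mem_sdiff, ha, true_and] at h
    tauto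
  -- Summation over the pieces, by splitting off one simple balanced piece at a time.
  have main : ∀ k, ∀ R ⊆ (F \ F') ∪ (F' \ F), R.card = k → Balanced s' t' R →
      ((R \ F).filter fun e => s e = i).card ≤ ((R ∩ F).filter fun e => s e = i).card := by
    intro k
    induction k using Nat.strong_induction_on with
    | _ k ih =>
      intro R hR hk hbal
      rcases R.eq_empty_or_nonempty with rfl | hne
      · simp
      obtain ⟨C, hCR, hCne, hCbal, hCone⟩ := hbal.exists_simple hne
      have h1 := step C (hCR.trans hR) hCne hCbal hCone
      have h2 := ih (R \ C).card (by
        rw [← hk]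
        exact Finset.card_lt_card (Finset.sdiff_ssubset hCR hCne)) (R \ C)
        (Finset.sdiff_subset.trans hR) rfl (hbal.sdiff hCbal hCR)
      have e1 : ((R \ F).filter fun e => s e = i).card
          = ((C \ F).filter fun e => s e = i).card
            + (((R \ C) \ F).filter fun e => s e = i).card := by
        rw [← Finset.card_union_of_disjoint, ← Finset.filter_union]
        · congr 2
          ext a
          have := @hCR a
          simp only [Finset.mem_sdiff, Finset.mem_union]
          tauto
        · refine Finset.disjoint_filter_filter (Finset.disjoint_left.2 fun a ha hb => ?_)
          simp only [Finset.mem_sdiff] at ha hb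
          tauto
      have e2 : ((R ∩ F).filter fun e => s e = i).card
          = ((C ∩ F).filter fun e => s e = i).card
            + (((R \ C) ∩ F).filter fun e => s e = i).card := by
        rw [← Finset.card_union_of_disjoint, ← Finset.filter_union]
        · congr 2
          ext a
          have := @hCR a
          simp only [Finset.mem_sdiff, Finset.mem_union, Finset.mem_inter]
          tauto
        · refine Finset.disjoint_filter_filter (Finset.disjoint_left.2 fun a ha hb => ?_)
          simp only [Finset.mem_sdiff, Finset.mem_inter] at ha hb
          tauto
      omega
  have fin := main _ _ subset_rfl rfl (hF.residual hF')
  have e1 : ((F \ F') ∪ (F' \ F)) \ F = F' \ F := by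
    ext a; simp only [Finset.mem_sdiff, Finset.mem_union]; tauto
  have e2 : ((F \ F') ∪ (F' \ F)) ∩ F = F \ F' := by
    ext a; simp only [Finset.mem_sdiff, Finset.mem_union, Finset.mem_inter]; tauto
  rw [e1, e2] at fin
  have splitF : ∀ (A B : Finset ε), (A.filter fun e => s e = i).card
      = ((A ∩ B).filter fun e => s e = i).card + ((A \ B).filter fun e => s e = i).card := by
    intro A B
    rw [← Finset.card_union_of_disjoint, ← Finset.filter_union, Finset.union_comm,
      Finset.sdiff_union_inter]
    exact Finset.disjoint_filter_filter
      (Finset.disjoint_left.2 fun e he he' =>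
        (Finset.mem_sdiff.1 he').2 (Finset.mem_inter.1 he).2)
  have f1 := splitF F F'
  have f2 := splitF F' F
  rw [Finset.inter_comm] at f2
  omega

end Circulations

end DurableGoods

namespace DurableGoods

/-! ## Matchings of the copy graph and balanced edge sets -/

section Matchings

variable {N M : Type*} [DecidableEq N] [DecidableEq M]

theorem Edge.src_ne_tgt (e : Edge N M) : e.src ≠ e.tgt := by
  cases e <;> simp [Edge.src, Edge.tgt]

theorem mem_usedEdges {μ : Finset (Edge N M × Edge N M)} {e : Edge N M} :
    e ∈ usedEdges μ ↔ ∃ e', (e, e') ∈ μ ∧ e ≠ e' := by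
  simp only [usedEdges, Finset.mem_image, Finset.mem_filter]
  constructor
  · rintro ⟨⟨a, b⟩, ⟨h1, h2⟩, rfl⟩
    exact ⟨b, h1, h2⟩
  · rintro ⟨e', h1, h2⟩
    exact ⟨(e, e'), ⟨h1, h2⟩, rfl⟩

theorem mem_copyGraph {E : Finset (Edge N M)} {e e' : Edge N M} :
    (e, e') ∈ copyGraph E ↔ (e ∈ E ∧ e' ∈ E) ∧ (e = e' ∨ e.tgt = e'.src) := by
  simp [copyGraph, Finset.mem_filter, Finset.mem_product]

theorem IsPerfectMatching.usedEdges_subset {E : Finset (Edge N M)}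
    {μ : Finset (Edge N M × Edge N M)} (h : IsPerfectMatching E μ) : usedEdges μ ⊆ E := by
  intro e he
  obtain ⟨e', h1, -⟩ := mem_usedEdges.1 he
  exact (mem_copyGraph.1 (h.1 h1)).1.1

/-- The matching is a permutation of `E` that also permutes the edges it does not fix, and a moved
edge ends where its image starts. -/
theorem IsPerfectMatching.balanced {E : Finset (Edge N M)}
    {μ : Finset (Edge N M × Edge N M)} (h : IsPerfectMatching E μ) :
    Balanced Edge.src Edge.tgt (usedEdges μ) := by
  have hex : ∀ e, ∃ e', e ∈ E → (e, e') ∈ μ := by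
    intro e
    by_cases he : e ∈ E
    · obtain ⟨e', he', -⟩ := h.2.1 e he
      exact ⟨e', fun _ => he'⟩
    · exact ⟨e, fun h => absurd h he⟩
  choose f hf using hex
  have hmem : ∀ {e e'}, (e, e') ∈ μ → e ∈ E ∧ e' ∈ E := fun h' => (mem_copyGraph.1 (h.1 h')).1
  have huniq : ∀ {e e'}, (e, e') ∈ μ → e' = f e := fun {e e'} h' =>
    (h.2.1 e (hmem h').1).unique h' (hf e (hmem h').1)
  have huniq' : ∀ {a b e}, (a, e) ∈ μ → (b, e) ∈ μ → a = b := fun {a b e} h1 h2 =>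
    (h.2.2 e (hmem h1).2).unique h1 h2
  have hused : ∀ e, e ∈ usedEdges μ ↔ e ∈ E ∧ e ≠ f e := by
    intro e
    rw [mem_usedEdges]
    constructor
    · rintro ⟨e', h1, h2⟩
      exact ⟨(hmem h1).1, huniq h1 ▸ h2⟩
    · rintro ⟨h1, h2⟩
      exact ⟨f e, hf e h1, h2⟩
  refine Balanced.of_bijOn f ⟨?_, ?_, ?_⟩ ?_
  · intro e he
    have he := (hused e).1 he
    have h1 := hf e he.1
    refine (hused _).2 ⟨(hmem h1).2, fun h2 => he.2 ?_⟩
    have h3 := hf (f e) (hmem h1).2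
    rw [← h2] at h3
    exact huniq' h1 h3
  · intro a ha b hb hab
    have h1 := hf a ((hused a).1 ha).1
    have h2 := hf b ((hused b).1 hb).1
    rw [← hab] at h2
    exact huniq' h1 h2
  · intro e he
    have he := (hused e).1 he
    obtain ⟨a, ha, -⟩ := h.2.2 e he.1
    have hae := huniq ha
    refine ⟨a, (hused a).2 ⟨(hmem ha).1, ?_⟩, hae.symm⟩
    intro hcon
    rw [← hae] at hcon
    subst hcon
    exact he.2 hae
  · intro e he
    have he := (hused e).1 he
    have := (mem_copyGraph.1 (h.1 (hf e he.1))).2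
    rcases this with h1 | h1
    · exact absurd h1 he.2
    · exact h1.symm

/-- Every balanced set of edges is the set of edges used by a perfect matching. -/
theorem Balanced.exists_matching {E F : Finset (Edge N M)} (hFE : F ⊆ E)
    (hF : Balanced Edge.src Edge.tgt F) :
    ∃ μ, IsPerfectMatching E μ ∧ usedEdges μ = F := by
  classical
  have heq : ∀ v, Nonempty ((F.filter fun e => e.tgt = v) ≃ (F.filter fun e => e.src = v)) :=
    fun v => ⟨Finset.equivOfCardEq (hF v).symm⟩
  -- At each vertex, the arriving edges of `F` are paired with the leaving ones; edges outside `F`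
  -- will be matched to their own copies.
  let φ := fun v => Classical.choice (heq v)
  have hg : ∀ e, ∃ e', e ∈ F → e' ∈ F ∧ e'.src = e.tgt ∧
      ∀ v (hv : e ∈ F.filter fun e => e.tgt = v), e' = φ v ⟨e, hv⟩ := by
    intro e
    by_cases he : e ∈ F
    · refine ⟨φ e.tgt ⟨e, Finset.mem_filter.2 ⟨he, rfl⟩⟩, fun _ => ?_⟩
      have := Finset.mem_filter.1 (φ e.tgt ⟨e, Finset.mem_filter.2 ⟨he, rfl⟩⟩).2
      refine ⟨this.1, this.2, fun v hv => ?_⟩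
      obtain rfl := (Finset.mem_filter.1 hv).2
      rfl
    · exact ⟨e, fun h => absurd h he⟩
  choose g hg using hg
  have ginj : ∀ a ∈ F, ∀ b ∈ F, g a = g b → a = b := by
    intro a ha b hb hab
    have htgt : b.tgt = a.tgt := by rw [← (hg a ha).2.1, ← (hg b hb).2.1, hab]
    have h1 := (hg a ha).2.2 _ (Finset.mem_filter.2 ⟨ha, rfl⟩)
    have h2 := (hg b hb).2.2 _ (Finset.mem_filter.2 ⟨hb, htgt⟩)
    have h3 := (φ a.tgt).injective (Subtype.ext (h1.symm.trans (hab.trans h2)))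
    exact congrArg Subtype.val h3
  have gsurj : ∀ e ∈ F, ∃ a ∈ F, g a = e := by
    have := Finset.surj_on_of_inj_on_of_card_le (s := F) (t := F) (fun a _ => g a)
      (fun a ha => (hg a ha).1) (fun a b ha hb => ginj a ha b hb) le_rfl
    intro e he
    obtain ⟨a, ha, h⟩ := this e he
    exact ⟨a, ha, h.symm⟩
  -- Without loops at vertices no edge of `F` is its own successor, so the used edges are all of
  -- `F`.
  have gne : ∀ e ∈ F, e ≠ g e := by
    intro e he h
    have := (hg e he).2.1
    rw [← h] at this
    exact e.src_ne_tgt this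
  set f : Edge N M → Edge N M := fun e => if e ∈ F then g e else e with hf
  have fF : ∀ e, e ∈ F → f e = g e := fun e he => by simp [hf, he]
  have fF' : ∀ e, e ∉ F → f e = e := fun e he => by simp [hf, he]
  have hmem : ∀ e e', (e, e') ∈ E.image (fun e => (e, f e)) ↔ e ∈ E ∧ e' = f e := by
    intro e e'
    simp only [Finset.mem_image, Prod.mk.injEq]
    constructor
    · rintro ⟨a, ha, rfl, rfl⟩
      exact ⟨ha, rfl⟩
    · rintro ⟨ha, rfl⟩
      exact ⟨e, ha, rfl, rfl⟩
  refine ⟨E.image fun e => (e, f e), ⟨?_, ?_, ?_⟩, ?_⟩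
  · rintro ⟨e, e'⟩ h
    obtain ⟨he, rfl⟩ := (hmem e e').1 h
    rw [mem_copyGraph]
    by_cases heF : e ∈ F
    · rw [fF e heF]
      exact ⟨⟨he, hFE (hg e heF).1⟩, Or.inr (hg e heF).2.1.symm⟩
    · rw [fF' e heF]
      exact ⟨⟨he, he⟩, Or.inl rfl⟩
  · intro e he
    exact ⟨f e, (hmem _ _).2 ⟨he, rfl⟩, fun e' h => ((hmem _ _).1 h).2⟩
  · intro e' he'
    by_cases heF : e' ∈ F
    · obtain ⟨a, ha, rfl⟩ := gsurj e' heF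
      refine ⟨a, (hmem _ _).2 ⟨hFE ha, (fF a ha).symm⟩, fun b hb => ?_⟩
      have hb := ((hmem _ _).1 hb).2
      by_cases hbF : b ∈ F
      · rw [fF b hbF] at hb
        exact ginj b hbF a ha hb.symm
      · rw [fF' b hbF] at hb
        exact absurd (hb ▸ heF) hbF
    · refine ⟨e', (hmem _ _).2 ⟨he', (fF' e' heF).symm⟩, fun b hb => ?_⟩
      have hb := ((hmem _ _).1 hb).2
      by_cases hbF : b ∈ F
      · rw [fF b hbF] at hb
        exact absurd (hb ▸ (hg b hbF).1) heF
      · rw [fF' b hbF] at hb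
        exact hb.symm
  · ext e
    rw [mem_usedEdges]
    constructor
    · rintro ⟨e', h1, h2⟩
      obtain ⟨he, rfl⟩ := (hmem _ _).1 h1
      by_contra heF
      exact h2 (fF' e heF).symm
    · intro heF
      exact ⟨g e, (hmem _ _).2 ⟨hFE heF, (fF e heF).symm⟩, gne e heF⟩

end Matchings

/-! ## Integral weights -/

section Weights

variable {N M : Type*} [Fintype N] [DecidableEq N] [Fintype M] [DecidableEq M]

/-- The perturbed weight of an edge, scaled to an integer. -/
def edgeWeight (π : EdgeOrder N M) (e : Edge N M) : ℕ :=
  2 ^ (Fintype.card N * Fintype.card M) + 2 ^ (Fintype.card N * Fintype.card M - π.rank e.pair)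

/-- Passes from rational matching weights to natural edge weights, so that binary digits can be
used. -/
theorem sum_weight_eq (π : EdgeOrder N M) {E : Finset (Edge N M)}
    {μ : Finset (Edge N M × Edge N M)} (h : IsPerfectMatching E μ) :
    ∑ p ∈ μ, weight π p =
      ((∑ e ∈ usedEdges μ, edgeWeight π e : ℕ) : ℚ) / 2 ^ (Fintype.card N * Fintype.card M) := by
  have h1 : ∑ p ∈ μ, weight π p = ∑ p ∈ μ.filter (fun p => p.1 ≠ p.2), weight π p := by
    rw [Finset.sum_filter]
    refine Finset.sum_congr rfl fun p _ => ?_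
    by_cases hp : p.1 = p.2 <;> simp [weight, hp]
  have hinj : Set.InjOn Prod.fst
      ((μ.filter fun p => p.1 ≠ p.2 : Finset (Edge N M × Edge N M)) :
        Set (Edge N M × Edge N M)) := by
    rintro ⟨a, b⟩ ha ⟨a', c⟩ hb hab
    simp only at hab
    subst hab
    have ha := (Finset.mem_filter.1 ha).1
    have hb := (Finset.mem_filter.1 hb).1
    have := (h.2.1 a (mem_copyGraph.1 (h.1 ha)).1.1).unique ha hb
    rw [this]
  rw [h1, usedEdges, Finset.sum_image hinj, Nat.cast_sum, Finset.sum_div]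
  refine Finset.sum_congr rfl fun p hp => ?_
  have hp := (Finset.mem_filter.1 hp).2
  have hr := π.le_card p.1.pair
  rw [weight, if_neg hp, edgeWeight]
  push_cast
  rw [add_div, div_self (by positivity), pow_sub₀ _ (by norm_num) hr]
  field_simp

/-- A graph that joins no agent and item in both directions. -/
def PairInjective (E : Finset (Edge N M)) : Prop :=
  Set.InjOn Edge.pair (E : Set (Edge N M))

/-- The ranks lie between `1` and `nm` and are distinct on a pair-injective set, so the
perturbations are distinct powers of two below `2 ^ (nm)`: the binary digits of the low part. -/
theorem sum_edgeWeight (π : EdgeOrder N M) {E A : Finset (Edge N M)} (hE : PairInjective E)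
    (hA : A ⊆ E) : ∃ T : Finset ℕ, (∀ k ∈ T, k < Fintype.card N * Fintype.card M) ∧
      T = A.image (fun e => Fintype.card N * Fintype.card M - π.rank e.pair) ∧
      ∑ e ∈ A, edgeWeight π e
        = A.card * 2 ^ (Fintype.card N * Fintype.card M) + ∑ k ∈ T, 2 ^ k := by
  refine ⟨_, ?_, rfl, ?_⟩
  · intro k hk
    obtain ⟨e, -, rfl⟩ := Finset.mem_image.1 hk
    have h1 := π.one_le e.pair
    have h2 := π.le_card e.pair
    omega
  · rw [Finset.sum_image]
    · simp only [edgeWeight, Finset.sum_add_distrib, Finset.sum_const, smul_eq_mul]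
    · intro a ha b hb hab
      refine hE (hA ha) (hA hb) (π.injective ?_)
      have h1 := π.le_card a.pair
      have h2 := π.le_card b.pair
      simp only at hab
      omega

/-- Modulo `2 ^ (nm)` only the low part remains, whose binary digits are the ranks of the edges. -/
theorem eq_of_sum_edgeWeight_eq (π : EdgeOrder N M) {E : Finset (Edge N M)}
    (hE : PairInjective E) : ∀ A ⊆ E, ∀ B ⊆ E,
      ∑ e ∈ A, edgeWeight π e = ∑ e ∈ B, edgeWeight π e → A = B := by
  intro A hA B hB h
  obtain ⟨S, hS, hSA, hS'⟩ := sum_edgeWeight π hE hA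
  obtain ⟨T, hT, hTB, hT'⟩ := sum_edgeWeight π hE hB
  have s1 := Nat.geomSum_lt le_rfl hS
  have t1 := Nat.geomSum_lt le_rfl hT
  rw [hS', hT'] at h
  have hmod := congrArg (· % 2 ^ (Fintype.card N * Fintype.card M)) h
  simp only [Nat.mul_add_mod_self_right, Nat.mod_eq_of_lt s1, Nat.mod_eq_of_lt t1] at hmod
  have hST : S = T := Finset.geomSum_injective le_rfl hmod
  have key : ∀ {A B : Finset (Edge N M)}, A ⊆ E → B ⊆ E →
      A.image (fun e => Fintype.card N * Fintype.card M - π.rank e.pair)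
        = B.image (fun e => Fintype.card N * Fintype.card M - π.rank e.pair) → A ⊆ B := by
    intro A B hA hB hAB a ha
    have : Fintype.card N * Fintype.card M - π.rank a.pair ∈
        B.image (fun e => Fintype.card N * Fintype.card M - π.rank e.pair) := by
      rw [← hAB]
      exact Finset.mem_image_of_mem (fun e : Edge N M =>
        Fintype.card N * Fintype.card M - π.rank e.pair) ha
    obtain ⟨b, hb, hab⟩ := Finset.mem_image.1 this
    have h1 := π.le_card a.pair
    have h2 := π.le_card b.pair
    have : b = a := hE (hB hb) (hA ha) (π.injective (by omega))
    exact this ▸ hb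
  rw [hSA, hTB] at hST
  exact (key hA hB hST).antisymm (key hB hA hST.symm)

/-- The low part stays below `2 ^ (nm)`, so the perturbation can never make up for one missing edge.
-/
theorem card_le_of_sum_edgeWeight_le (π : EdgeOrder N M) {E A B : Finset (Edge N M)}
    (hE : PairInjective E) (hA : A ⊆ E) (hB : B ⊆ E)
    (h : ∑ e ∈ A, edgeWeight π e ≤ ∑ e ∈ B, edgeWeight π e) : A.card ≤ B.card := by
  obtain ⟨S, hS, -, hS'⟩ := sum_edgeWeight π hE hA
  obtain ⟨T, hT, -, hT'⟩ := sum_edgeWeight π hE hB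
  have t1 := Nat.geomSum_lt le_rfl hT
  rw [hS', hT'] at h
  by_contra hcon
  push Not at hcon
  have := Nat.mul_le_mul_right (2 ^ (Fintype.card N * Fintype.card M)) hcon
  rw [Nat.succ_mul] at this
  omega

/-- `F` is a balanced set of edges of maximum weight. -/
def IsMaxBalanced (π : EdgeOrder N M) (E F : Finset (Edge N M)) : Prop :=
  F ⊆ E ∧ Balanced Edge.src Edge.tgt F ∧ ∀ G ⊆ E, Balanced Edge.src Edge.tgt G →
    ∑ e ∈ G, edgeWeight π e ≤ ∑ e ∈ F, edgeWeight π e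

/-- Weights of matchings depend only on the used edges, and these range over all balanced sets.
Matchings disappear from the argument here. -/
theorem isMaxWeightPerfectMatching_iff {π : EdgeOrder N M} {E : Finset (Edge N M)}
    {μ : Finset (Edge N M × Edge N M)} (hμ : IsPerfectMatching E μ) :
    IsMaxWeightPerfectMatching π E μ ↔ IsMaxBalanced π E (usedEdges μ) := by
  have hle : ∀ {μ'}, IsPerfectMatching E μ' → (∑ p ∈ μ', weight π p ≤ ∑ p ∈ μ, weight π p ↔
      ∑ e ∈ usedEdges μ', edgeWeight π e ≤ ∑ e ∈ usedEdges μ, edgeWeight π e) := by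
    intro μ' hμ'
    rw [sum_weight_eq π hμ, sum_weight_eq π hμ',
      div_le_div_iff_of_pos_right (by positivity), Nat.cast_le]
  constructor
  · rintro ⟨-, h⟩
    refine ⟨hμ.usedEdges_subset, hμ.balanced, fun G hG hbal => ?_⟩
    obtain ⟨μ', hμ', rfl⟩ := hbal.exists_matching hG
    exact (hle hμ').1 (h μ' hμ')
  · rintro ⟨-, -, h⟩
    exact ⟨hμ, fun μ' hμ' => (hle hμ').2 (h _ hμ'.usedEdges_subset hμ'.balanced)⟩

theorem IsMaxBalanced.exists_matching {π : EdgeOrder N M} {E F : Finset (Edge N M)}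
    (h : IsMaxBalanced π E F) :
    ∃ μ, IsMaxWeightPerfectMatching π E μ ∧ usedEdges μ = F := by
  obtain ⟨μ, hμ, rfl⟩ := h.2.1.exists_matching h.1
  exact ⟨μ, (isMaxWeightPerfectMatching_iff hμ).2 h, rfl⟩

theorem mem_tradingGraph_dem {x : Profile N M} {i : N} {j : M} :
    Edge.dem i j ∈ tradingGraph x ↔ j ∈ (x i).demand := by
  simp [tradingGraph]

theorem mem_tradingGraph_sup {x : Profile N M} {i : N} {j : M} :
    Edge.sup j i ∈ tradingGraph x ↔ j ∈ (x i).supply := by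
  simp [tradingGraph]

/-- The rank ignores directions, so disjointness of each agent's demand and supply is what makes the
perturbations of different edges different, even when supplies of different agents overlap. -/
theorem pairInjective_tradingGraph (x : Profile N M) : PairInjective (tradingGraph x) := by
  have key : ∀ i j, Edge.dem i j ∈ tradingGraph x → Edge.sup j i ∈ tradingGraph x → False := by
    intro i j h1 h2
    exact Finset.disjoint_left.1 (x i).disj (mem_tradingGraph_dem.1 h1) (mem_tradingGraph_sup.1 h2)
  rintro (⟨i, j⟩ | ⟨j, i⟩) ha (⟨i', j'⟩ | ⟨j', i'⟩) hb hab <;>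
    simp only [Edge.pair, Prod.mk.injEq] at hab <;> obtain ⟨rfl, rfl⟩ := hab
  · rfl
  · exact (key _ _ ha hb).elim
  · exact (key _ _ hb ha).elim
  · rfl

end Weights

end DurableGoods

namespace DurableGoods

/-! ## Cycles and executions -/

section Executions

variable {N M : Type*} [DecidableEq N] [DecidableEq M]

/-- The supply edges of a cycle. -/
def supplyEdges (C : Cycle N M) : List (Edge N M) :=
  List.zipWith (fun p q => Edge.sup p.2 q.1) C (C.rotate 1)

/-- The supply edges that replace the demand edges of a cycle. -/
def newSupplyEdges (C : Cycle N M) : List (Edge N M) :=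
  C.map fun p => Edge.sup p.2 p.1

theorem supplyEdges_map_src (C : Cycle N M) :
    (supplyEdges C).map Edge.src = (C.map Prod.snd).map Sum.inr := by
  apply List.ext_getElem
  · simp [supplyEdges]
  · intro k h1 h2
    simp [supplyEdges, Edge.src]

theorem supplyEdges_map_tgt (C : Cycle N M) :
    (supplyEdges C).map Edge.tgt = ((C.rotate 1).map Prod.fst).map Sum.inl := by
  apply List.ext_getElem
  · simp [supplyEdges]
  · intro k h1 h2
    simp [supplyEdges, Edge.tgt]

theorem newSupplyEdges_map_src (C : Cycle N M) :
    (newSupplyEdges C).map Edge.src = (C.map Prod.snd).map Sum.inr := by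
  simp [newSupplyEdges, Edge.src]

theorem newSupplyEdges_map_tgt (C : Cycle N M) :
    (newSupplyEdges C).map Edge.tgt = (C.map Prod.fst).map Sum.inl := by
  simp [newSupplyEdges, Edge.tgt]

theorem dem_notMem_supplyEdges {C : Cycle N M} {i : N} {j : M} :
    Edge.dem i j ∉ supplyEdges C := by
  intro h
  have := List.mem_map_of_mem (f := Edge.src) h
  rw [supplyEdges_map_src] at this
  simp [Edge.src] at this

theorem dem_mem_cycleEdges {C : Cycle N M} {i : N} {j : M} :
    Edge.dem i j ∈ cycleEdges C ↔ (i, j) ∈ C := by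
  have := dem_notMem_supplyEdges (C := C) (i := i) (j := j)
  unfold supplyEdges at this
  simp [cycleEdges, this]

theorem sup_mem_cycleEdges {C : Cycle N M} {i : N} {j : M} :
    Edge.sup j i ∈ cycleEdges C ↔ Edge.sup j i ∈ supplyEdges C := by
  simp [cycleEdges, supplyEdges]

theorem sup_mem_newSupplyEdges {C : Cycle N M} {i : N} {j : M} :
    Edge.sup j i ∈ newSupplyEdges C ↔ (i, j) ∈ C := by
  simp [newSupplyEdges]

theorem item_mem_of_sup_mem {C : Cycle N M} {i : N} {j : M} (h : Edge.sup j i ∈ supplyEdges C) :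
    j ∈ C.map Prod.snd := by
  have := List.mem_map_of_mem (f := Edge.src) h
  rw [supplyEdges_map_src] at this
  simpa [Edge.src] using this

theorem exists_sup_mem_of_mem {C : Cycle N M} {p : N × M} (h : p ∈ C) :
    ∃ j, Edge.sup j p.1 ∈ supplyEdges C := by
  have : Sum.inl p.1 ∈ (supplyEdges C).map Edge.tgt := by
    rw [supplyEdges_map_tgt]
    exact List.mem_map_of_mem (List.mem_map_of_mem (List.mem_rotate.2 h))
  obtain ⟨e, he, hp⟩ := List.mem_map.1 this
  cases e with
  | dem i j => exact absurd he dem_notMem_supplyEdges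
  | sup j i =>
    simp only [Edge.tgt, Sum.inl.injEq] at hp
    exact ⟨j, hp ▸ he⟩

theorem dem_mem_cycleStep {E : Finset (Edge N M)} {C : Cycle N M} {i : N} {j : M} :
    Edge.dem i j ∈ cycleStep E C ↔ Edge.dem i j ∈ E ∧ Edge.dem i j ∉ cycleEdges C := by
  simp [cycleStep]

theorem sup_mem_cycleStep {E : Finset (Edge N M)} {C : Cycle N M} {i : N} {j : M} :
    Edge.sup j i ∈ cycleStep E C ↔
      Edge.sup j i ∈ E ∧ Edge.sup j i ∉ supplyEdges C ∨ (i, j) ∈ C := by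
  simp [cycleStep, sup_mem_cycleEdges]

/-- The graph that is left by an execution. -/
def endGraph (E : Finset (Edge N M)) (r : Execution N M) : Finset (Edge N M) :=
  r.foldl cycleStep E

/-- No agent demands an item that he owns. -/
def NoOwnDemand (E : Finset (Edge N M)) : Prop :=
  ∀ i j, Edge.dem i j ∈ E → Edge.sup j i ∉ E

theorem IsCycle.dem_mem {E : Finset (Edge N M)} {C : Cycle N M} (h : IsCycle E C) {i : N} {j : M}
    (hij : (i, j) ∈ C) : Edge.dem i j ∈ E :=
  h.2.2.2 _ (dem_mem_cycleEdges.2 hij)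

theorem IsCycle.sup_mem {E : Finset (Edge N M)} {C : Cycle N M} (h : IsCycle E C) {i : N} {j : M}
    (hij : Edge.sup j i ∈ supplyEdges C) : Edge.sup j i ∈ E :=
  h.2.2.2 _ (sup_mem_cycleEdges.2 hij)

theorem NoOwnDemand.cycleStep {E : Finset (Edge N M)} {C : Cycle N M} (hE : NoOwnDemand E) :
    NoOwnDemand (cycleStep E C) := by
  intro i j hd hs
  rw [dem_mem_cycleStep, dem_mem_cycleEdges] at hd
  rcases sup_mem_cycleStep.1 hs with h | h
  · exact hE i j hd.1 h.1
  · exact hd.2 h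

theorem dem_mem_of_mem_execution {E : Finset (Edge N M)} {r : Execution N M}
    (h : IsExecution E r) {i : N} {j : M} {C : Cycle N M} (hC : C ∈ r) (hij : (i, j) ∈ C) :
    Edge.dem i j ∈ E := by
  induction r generalizing E with
  | nil => simp at hC
  | cons C' r ih =>
    rcases List.mem_cons.1 hC with rfl | hC
    · exact h.1.dem_mem hij
    · exact (dem_mem_cycleStep.1 (ih h.2 hC)).1

/-- Demand edges are never created, and supply edges only by reversing demand edges. -/
theorem sup_mem_endGraph {E : Finset (Edge N M)} {r : Execution N M}
    (h : IsExecution E r) {i : N} {j : M} (hs : Edge.sup j i ∈ endGraph E r) :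
    Edge.sup j i ∈ E ∨ Edge.dem i j ∈ E := by
  induction r generalizing E with
  | nil => exact Or.inl hs
  | cons C r ih =>
    rcases ih h.2 hs with h' | h'
    · rcases sup_mem_cycleStep.1 h' with h' | h'
      · exact Or.inl h'.1
      · exact Or.inr (h.1.dem_mem h')
    · exact Or.inr (dem_mem_cycleStep.1 h').1

/-- An agent who takes part in an execution loses an item for good. -/
theorem exists_lost_supply {E : Finset (Edge N M)} {r : Execution N M}
    (h : IsExecution E r) (hE : NoOwnDemand E) {i : N} {j : M} {C : Cycle N M} (hC : C ∈ r)
    (hij : (i, j) ∈ C) : ∃ j', Edge.sup j' i ∈ E ∧ Edge.sup j' i ∉ endGraph E r := by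
  induction r generalizing E with
  | nil => simp at hC
  | cons C' r ih =>
    by_cases hi : ∃ j₁, (i, j₁) ∈ C'
    · obtain ⟨j₁, hj₁⟩ := hi
      obtain ⟨j', hj'⟩ := exists_sup_mem_of_mem hj₁
      have hs := h.1.sup_mem hj'
      -- The item `j'` given away was owned at that moment, hence not demanded, and since demand
      -- edges never appear later it cannot return.
      refine ⟨j', hs, fun hend => ?_⟩
      rcases sup_mem_endGraph h.2 hend with h' | h'
      · rcases sup_mem_cycleStep.1 h' with h' | h'
        · exact h'.2 hj'
        · exact hE _ _ (h.1.dem_mem h') hs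
      · exact hE _ _ (dem_mem_cycleStep.1 h').1 hs
    · have hC : C ∈ r := by
        rcases List.mem_cons.1 hC with rfl | hC
        · exact absurd ⟨j, hij⟩ hi
        · exact hC
      obtain ⟨j', h1, h2⟩ := ih h.2 hE.cycleStep hC
      refine ⟨j', ?_, h2⟩
      rcases sup_mem_cycleStep.1 h1 with h' | h'
      · exact h'.1
      · exact absurd ⟨j', h'⟩ hi

theorem sup_mem_endGraph_of_untouched {E : Finset (Edge N M)} {r : Execution N M} {i : N} {j : M}
    (hs : Edge.sup j i ∈ E) (hj : j ∉ r.flatten.map Prod.snd) : Edge.sup j i ∈ endGraph E r := by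
  induction r generalizing E with
  | nil => exact hs
  | cons C r ih =>
    rw [List.flatten_cons, List.map_append, List.mem_append, not_or] at hj
    exact ih (sup_mem_cycleStep.2 (Or.inl ⟨hs, fun h => hj.1 (item_mem_of_sup_mem h)⟩)) hj.2

/-- In a static execution, everybody keeps what he receives. -/
theorem sup_mem_endGraph_of_static {E : Finset (Edge N M)} {r : Execution N M}
    (hr : IsStatic r) {i : N} {j : M} {C : Cycle N M} (hC : C ∈ r) (hij : (i, j) ∈ C) :
    Edge.sup j i ∈ endGraph E r := by
  induction r generalizing E with
  | nil => simp at hC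
  | cons C' r ih =>
    rw [IsStatic, List.flatten_cons, List.map_append, List.nodup_append] at hr
    rcases List.mem_cons.1 hC with rfl | hC
    · refine sup_mem_endGraph_of_untouched (E := cycleStep E C)
        (sup_mem_cycleStep.2 (Or.inr hij)) fun hj => ?_
      exact hr.2.2 j (List.mem_map_of_mem hij) j hj rfl
    · exact ih (E := cycleStep E C') hr.2.1 hC

/-- The supply edges of a graph. -/
def supplyPart (E : Finset (Edge N M)) : Finset (Edge N M) :=
  E.filter fun e => e.src.isRight

theorem sup_mem_supplyPart {E : Finset (Edge N M)} {i : N} {j : M} :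
    Edge.sup j i ∈ supplyPart E ↔ Edge.sup j i ∈ E := by
  rw [supplyPart, Finset.mem_filter]
  simp [Edge.src]

theorem dem_notMem_supplyPart {E : Finset (Edge N M)} {i : N} {j : M} :
    Edge.dem i j ∉ supplyPart E := by
  rw [supplyPart, Finset.mem_filter]
  simp [Edge.src]

theorem card_filter_toFinset {α β : Type*} [DecidableEq α] [DecidableEq β] {l : List α}
    (hl : l.Nodup) (g : α → β) (v : β) :
    (l.toFinset.filter fun e => g e = v).card = (l.map g).countP fun u => decide (u = v) := by
  have h : (l.toFinset.filter fun e => g e = v)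
      = (l.filter fun e => decide (g e = v)).toFinset := by
    ext e
    simp
  rw [h, List.toFinset_card_of_nodup (hl.filter _), List.countP_map,
    List.countP_eq_length_filter]
  rfl

theorem supplyPart_cycleStep (E : Finset (Edge N M)) (C : Cycle N M) :
    supplyPart (cycleStep E C) =
      (supplyPart E \ (supplyEdges C).toFinset) ∪ (newSupplyEdges C).toFinset := by
  ext e
  cases e with
  | dem i j =>
    simp [dem_notMem_supplyPart, newSupplyEdges]
  | sup j i =>
    simp [sup_mem_supplyPart, sup_mem_cycleStep, sup_mem_newSupplyEdges]

theorem IsCycle.nodup_supplyEdges {E : Finset (Edge N M)} {C : Cycle N M} (h : IsCycle E C) :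
    (supplyEdges C).Nodup := by
  refine List.Nodup.of_map Edge.src ?_
  rw [supplyEdges_map_src]
  exact h.2.2.1.map Sum.inr_injective

theorem IsCycle.nodup_newSupplyEdges {E : Finset (Edge N M)} {C : Cycle N M} (h : IsCycle E C) :
    (newSupplyEdges C).Nodup := by
  refine List.Nodup.of_map Edge.src ?_
  rw [newSupplyEdges_map_src]
  exact h.2.2.1.map Sum.inr_injective

/-- An execution preserves the number of items that each agent owns and the number of owners of
each item. -/
theorem card_supplyPart_endGraph {E : Finset (Edge N M)} {r : Execution N M}
    (h : IsExecution E r) (hE : NoOwnDemand E) (v : N ⊕ M) :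
    ((supplyPart (endGraph E r)).filter fun e => e.src = v).card
        = ((supplyPart E).filter fun e => e.src = v).card ∧
      ((supplyPart (endGraph E r)).filter fun e => e.tgt = v).card
        = ((supplyPart E).filter fun e => e.tgt = v).card := by
  induction r generalizing E with
  | nil => exact ⟨rfl, rfl⟩
  | cons C r ih =>
    -- A cycle replaces its supply edges by new ones with the same items and with the same agents up
    -- to rotation. The new edges were absent before because their agents demanded these items.
    have key : ∀ g : Edge N M → N ⊕ M,
        ((supplyEdges C).map g).Perm ((newSupplyEdges C).map g) →
        ((supplyPart (cycleStep E C)).filter fun e => g e = v).card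
          = ((supplyPart E).filter fun e => g e = v).card := by
      intro g hg
      have hsub : (supplyEdges C).toFinset ⊆ supplyPart E := by
        intro e he
        rw [List.mem_toFinset] at he
        cases e with
        | dem i j => exact absurd he dem_notMem_supplyEdges
        | sup j i => exact sup_mem_supplyPart.2 (h.1.sup_mem he)
      have hdisj : Disjoint (supplyPart E) (newSupplyEdges C).toFinset := by
        refine Finset.disjoint_left.2 fun e he he' => ?_
        rw [List.mem_toFinset] at he'
        cases e with
        | dem i j => exact dem_notMem_supplyPart he
        | sup j i =>
          exact hE i j (h.1.dem_mem (sup_mem_newSupplyEdges.1 he')) (sup_mem_supplyPart.1 he)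
      rw [supplyPart_cycleStep, Finset.filter_union, Finset.card_union_of_disjoint
        (Finset.disjoint_filter_filter (hdisj.mono_left Finset.sdiff_subset)),
        card_filter_toFinset h.1.nodup_newSupplyEdges, ← hg.countP_eq,
        ← card_filter_toFinset h.1.nodup_supplyEdges, ← Finset.card_union_of_disjoint
        (Finset.disjoint_filter_filter Finset.sdiff_disjoint), ← Finset.filter_union,
        Finset.sdiff_union_of_subset hsub]
    obtain ⟨h1, h2⟩ := ih h.2 hE.cycleStep
    refine ⟨h1.trans (key _ ?_), h2.trans (key _ ?_)⟩
    · rw [supplyEdges_map_src, newSupplyEdges_map_src]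
    · rw [supplyEdges_map_tgt, newSupplyEdges_map_tgt]
      exact ((List.rotate_perm C 1).map _).map _

/-! ### The net effect of an execution -/

/-- The edge joining the same vertices in the other direction. -/
def Edge.flip : Edge N M → Edge N M
  | .dem i j => .sup j i
  | .sup j i => .dem i j

theorem Edge.flip_flip (e : Edge N M) : e.flip.flip = e := by
  cases e <;> rfl

theorem Edge.src_flip (e : Edge N M) : e.flip.src = e.tgt := by
  cases e <;> rfl

theorem Edge.tgt_flip (e : Edge N M) : e.flip.tgt = e.src := by
  cases e <;> rfl

theorem Edge.flip_injective : Function.Injective (Edge.flip : Edge N M → Edge N M) :=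
  Function.LeftInverse.injective Edge.flip_flip

/-- The edges of a static execution that moves each item directly to its final owner. -/
def netEdges (E : Finset (Edge N M)) (r : Execution N M) : Finset (Edge N M) :=
  (supplyPart E \ supplyPart (endGraph E r)) ∪
    (supplyPart (endGraph E r) \ supplyPart E).image Edge.flip

/-- A supply edge present only at the end comes from a demand edge of `E`, which is what flipping it
restores. -/
theorem netEdges_subset {E : Finset (Edge N M)} {r : Execution N M} (h : IsExecution E r) :
    netEdges E r ⊆ E := by
  refine Finset.union_subset (Finset.sdiff_subset.trans (Finset.filter_subset _ _)) ?_
  intro e he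
  obtain ⟨a, ha, rfl⟩ := Finset.mem_image.1 he
  rw [Finset.mem_sdiff] at ha
  cases a with
  | dem i j => exact absurd ha.1 dem_notMem_supplyPart
  | sup j i =>
    rw [sup_mem_supplyPart, sup_mem_supplyPart] at ha
    exact (sup_mem_endGraph h ha.1).resolve_left ha.2

/-- Every vertex has equally many supply edges before and after, hence equally many lost as gained
ones on each side; flipping the gained edges turns this into balance. -/
theorem netEdges_balanced {E : Finset (Edge N M)} {r : Execution N M} (h : IsExecution E r)
    (hE : NoOwnDemand E) : Balanced Edge.src Edge.tgt (netEdges E r) := by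
  intro v
  have hdisj : Disjoint (supplyPart E \ supplyPart (endGraph E r))
      ((supplyPart (endGraph E r) \ supplyPart E).image Edge.flip) := by
    refine Finset.disjoint_left.2 fun e he he' => ?_
    obtain ⟨a, ha, rfl⟩ := Finset.mem_image.1 he'
    rw [Finset.mem_sdiff] at ha he
    cases a with
    | dem i j => exact absurd ha.1 dem_notMem_supplyPart
    | sup j i => exact dem_notMem_supplyPart he.1
  have himage : ∀ (A : Finset (Edge N M)) (g g' : Edge N M → N ⊕ M),
      (∀ e, g (Edge.flip e) = g' e) →
      ((A.image Edge.flip).filter fun e => g e = v).card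
        = (A.filter fun e => g' e = v).card := by
    intro A g g' hg
    rw [Finset.filter_image, Finset.card_image_of_injective _ Edge.flip_injective]
    simp only [hg]
  have hdiff : ∀ (A B : Finset (Edge N M)) (g : Edge N M → N ⊕ M),
      (A.filter fun e => g e = v).card = (B.filter fun e => g e = v).card →
      ((A \ B).filter fun e => g e = v).card = ((B \ A).filter fun e => g e = v).card := by
    intro A B g hAB
    have hf : ∀ A B : Finset (Edge N M), ((A \ B).filter fun e => g e = v)
        = (A.filter fun e => g e = v) \ (B.filter fun e => g e = v) := by
      intro A B
      ext e
      simp only [Finset.mem_filter, Finset.mem_sdiff]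
      tauto
    rw [hf, hf]
    exact Finset.card_sdiff_comm hAB
  obtain ⟨h1, h2⟩ := card_supplyPart_endGraph h hE v
  rw [netEdges, Finset.filter_union, Finset.filter_union,
    Finset.card_union_of_disjoint (Finset.disjoint_filter_filter hdisj),
    Finset.card_union_of_disjoint (Finset.disjoint_filter_filter hdisj),
    himage _ _ _ Edge.src_flip, himage _ _ _ Edge.tgt_flip,
    hdiff _ _ _ h1, hdiff _ _ _ h2, add_comm]

/-- Executing edge-disjoint cycles of a subgraph. -/
theorem isExecution_of_nodup {E F : Finset (Edge N M)} {r : Execution N M}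
    (hr : ∀ C ∈ r, IsCycle F C) (hnd : (r.flatMap cycleEdges).Nodup)
    (hE : ∀ e ∈ r.flatMap cycleEdges, e ∈ E) : IsExecution E r := by
  induction r generalizing E with
  | nil => trivial
  | cons C r ih =>
    rw [List.flatMap_cons, List.nodup_append] at hnd
    rw [List.flatMap_cons] at hE
    have hC := hr C List.mem_cons_self
    refine ⟨⟨hC.1, hC.2.1, hC.2.2.1, fun e he => hE e (List.mem_append_left _ he)⟩,
      ih (fun C' hC' => hr C' (List.mem_cons_of_mem _ hC')) hnd.2.1 fun e he => ?_⟩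
    -- A cycle step deletes only the edges of its own cycle, and the later cycles are edge-disjoint
    -- from it.
    refine Finset.mem_union_left _ (Finset.mem_sdiff.2 ⟨hE e (List.mem_append_right _ he), ?_⟩)
    rw [List.mem_toFinset]
    exact fun he' => hnd.2.2 e he' e he rfl

end Executions

/-! ### Utilities of executions -/

section Utilities

variable {N M : Type*} [Fintype N] [DecidableEq N] [Fintype M] [DecidableEq M]

theorem mem_received {i : N} {j : M} {C : Cycle N M} : j ∈ received i C ↔ (i, j) ∈ C := by
  simp [received, dem_mem_cycleEdges]

theorem mem_given {i : N} {j : M} {C : Cycle N M} :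
    j ∈ given i C ↔ Edge.sup j i ∈ supplyEdges C := by
  simp [given, sup_mem_cycleEdges]

theorem mem_receivedItems {i : N} {j : M} {r : Execution N M} :
    j ∈ receivedItems i r ↔ ∃ C ∈ r, (i, j) ∈ C := by
  simp [receivedItems, mem_received]

/-- The agent's current sets evolve exactly like his edges in the current graph. So truthful agents
never suffer the penalty, and utility counts received items. -/
theorem acceptable_of_isExecution {E : Finset (Edge N M)} {r : Execution N M}
    (h : IsExecution E r) {i : N} {D S : Finset M} (hD : ∀ j, j ∈ D ↔ Edge.dem i j ∈ E)
    (hS : ∀ j, j ∈ S ↔ Edge.sup j i ∈ E) : Acceptable i D S r := by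
  induction r generalizing E D S with
  | nil => trivial
  | cons C r ih =>
    refine ⟨fun j hj => (hD j).2 (h.1.dem_mem (mem_received.1 hj)),
      fun j hj => (hS j).2 (h.1.sup_mem (mem_given.1 hj)), ih h.2 ?_ ?_⟩
    · intro j
      rw [Finset.mem_sdiff, hD, mem_received, dem_mem_cycleStep, dem_mem_cycleEdges]
    · intro j
      rw [Finset.mem_union, Finset.mem_sdiff, hS, mem_received, mem_given, sup_mem_cycleStep]

theorem utility_of_isExecution {x : Profile N M} {r : Execution N M}
    (h : IsExecution (tradingGraph x) r) (i : N) :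
    utility i (x i) r = (receivedItems i r).card :=
  if_pos (acceptable_of_isExecution h (fun _ => mem_tradingGraph_dem.symm)
    fun _ => mem_tradingGraph_sup.symm)

/-- Translates acceptability back to the initial sets: whatever is given was owned at the start or
has been received on the way. -/
theorem Acceptable.mem {i : N} {D S : Finset M} {r : Execution N M} (h : Acceptable i D S r)
    {j : M} {C : Cycle N M} (hC : C ∈ r) : ((i, j) ∈ C → j ∈ D) ∧
      (Edge.sup j i ∈ supplyEdges C → j ∈ S ∨ ∃ C' ∈ r, (i, j) ∈ C') := by
  induction r generalizing D S with
  | nil => simp at hC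
  | cons C' r ih =>
    obtain ⟨h1, h2, h3⟩ := h
    rcases List.mem_cons.1 hC with rfl | hC
    · exact ⟨fun h => h1 (mem_received.2 h), fun h => Or.inl (h2 (mem_given.2 h))⟩
    · obtain ⟨i1, i2⟩ := ih h3 hC
      refine ⟨fun h => (Finset.mem_sdiff.1 (i1 h)).1, fun h => ?_⟩
      rcases i2 h with h | ⟨C'', h, h'⟩
      · rcases Finset.mem_union.1 h with h | h
        · exact Or.inl (Finset.mem_sdiff.1 h).1
        · exact Or.inr ⟨C', List.mem_cons_self, mem_received.1 h⟩
      · exact Or.inr ⟨C'', List.mem_cons_of_mem _ h, h'⟩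

theorem noOwnDemand_tradingGraph (x : Profile N M) : NoOwnDemand (tradingGraph x) :=
  fun i _ h1 h2 => Finset.disjoint_left.1 (x i).disj (mem_tradingGraph_dem.1 h1)
    (mem_tradingGraph_sup.1 h2)

/-- The number of demand edges of a balanced set is half of the number of its edges. -/
theorem Balanced.card_eq {F : Finset (Edge N M)} (hF : Balanced Edge.src Edge.tgt F) :
    F.card = 2 * ∑ i : N, (F.filter fun e => e.src = Sum.inl i).card := by
  have h1 : F.card = ∑ i : N, ((F.filter fun e => e.src = Sum.inl i).card
      + (F.filter fun e => e.tgt = Sum.inl i).card) := by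
    simp only [Finset.card_filter, ← Finset.sum_add_distrib]
    rw [Finset.sum_comm, Finset.card_eq_sum_ones]
    refine Finset.sum_congr rfl fun e _ => ?_
    cases e with
    | dem i j => simp [Edge.src, Edge.tgt]
    | sup j i => simp [Edge.src, Edge.tgt]
  rw [h1, Finset.mul_sum]
  refine Finset.sum_congr rfl fun i _ => ?_
  rw [← hF, two_mul]

theorem Corresponds.mem_iff {μ : Finset (Edge N M × Edge N M)} {r : Execution N M}
    (h : Corresponds μ r) (e : Edge N M) : e ∈ usedEdges μ ↔ e ∈ r.flatMap cycleEdges := by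
  refine ⟨h.2.2 e, fun he => ?_⟩
  obtain ⟨C, hC, he⟩ := List.mem_flatMap.1 he
  exact (h.1 C hC).2.2.2 e he

theorem Corresponds.card_receivedItems {μ : Finset (Edge N M × Edge N M)} {r : Execution N M}
    (h : Corresponds μ r) (i : N) :
    (receivedItems i r).card = ((usedEdges μ).filter fun e => e.src = Sum.inl i).card := by
  refine Finset.card_bij (fun j _ => Edge.dem i j) ?_ ?_ ?_
  · intro j hj
    obtain ⟨C, hC, hij⟩ := mem_receivedItems.1 hj
    exact Finset.mem_filter.2 ⟨(h.mem_iff _).2 (List.mem_flatMap.2 ⟨C, hC,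
      dem_mem_cycleEdges.2 hij⟩), rfl⟩
  · intro a _ b _ hab
    simpa using hab
  · intro e he
    obtain ⟨heF, hi⟩ := Finset.mem_filter.1 he
    cases e with
    | sup j i => simp [Edge.src] at hi
    | dem i' j =>
      simp only [Edge.src, Sum.inl.injEq] at hi
      subst hi
      obtain ⟨C, hC, hij⟩ := List.mem_flatMap.1 ((h.mem_iff _).1 heF)
      exact ⟨j, mem_receivedItems.2 ⟨C, hC, dem_mem_cycleEdges.1 hij⟩, rfl⟩

theorem Corresponds.isExecution {μ : Finset (Edge N M × Edge N M)} {r : Execution N M}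
    {E : Finset (Edge N M)} (h : Corresponds μ r) (hE : usedEdges μ ⊆ E) : IsExecution E r :=
  isExecution_of_nodup h.1 h.2.1 fun e he => hE ((h.mem_iff e).2 he)

/-! ## The properties of the mechanism -/

variable {π : EdgeOrder N M} {A : Mechanism N M}

theorem IsAs.isExecution (hA : IsAs π A) (x : Profile N M) :
    IsExecution (tradingGraph x) (A x) := by
  obtain ⟨μ, hμ, hr⟩ := hA x
  exact hr.isExecution hμ.1.usedEdges_subset

theorem IsAs.strategyproof (hA : IsAs π A) : Strategyproof A := by
  intro x i y
  rw [utility_of_isExecution (hA.isExecution x)]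
  rw [utility]
  split_ifs with hacc
  -- An unacceptable outcome is worth at most `0`, while truth yields a cardinality.
  swap
  · have : (0 : ℤ) ≤ (Fintype.card N : ℤ) * (Fintype.card M : ℤ) := by positivity
    have := Int.natCast_nonneg (receivedItems i (A x)).card
    omega
  obtain ⟨μ, hμ, hr⟩ := hA x
  obtain ⟨μ', hμ', hr'⟩ := hA (Function.update x i y)
  rw [hr.card_receivedItems, hr'.card_receivedItems, Nat.cast_le]
  have hmax := (isMaxWeightPerfectMatching_iff hμ.1).1 hμ
  have hmax' := (isMaxWeightPerfectMatching_iff hμ'.1).1 hμ'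
  set x' := Function.update x i y with hx'
  have hne : ∀ k, k ≠ i → x' k = x k := fun k hk => Function.update_of_ne hk _ _
  -- An acceptable outcome of a false report uses only true edges, so the additions to the report
  -- were harmless.
  have hsub : usedEdges μ' ⊆ tradingGraph x := by
    intro e he
    obtain ⟨C, hC, heC⟩ := List.mem_flatMap.1 ((hr'.mem_iff e).1 he)
    have heE := hmax'.1 he
    cases e with
    | dem k j =>
      by_cases hk : k = i
      · subst hk
        exact mem_tradingGraph_dem.2 ((hacc.mem hC).1 (dem_mem_cycleEdges.1 heC))
      · rw [mem_tradingGraph_dem] at heE ⊢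
        rwa [← hne k hk]
    | sup j k =>
      by_cases hk : k = i
      · subst hk
        refine mem_tradingGraph_sup.2 (((hacc.mem hC).2 (sup_mem_cycleEdges.1 heC)).resolve_right ?_)
        -- If `j` had been received, the reported graph would contain both the demand and the supply
        -- edge between `k` and `j`, against the disjointness of the report.
        rintro ⟨C', hC', hj⟩
        refine noOwnDemand_tradingGraph x' k j (hmax'.1 ((hr'.mem_iff _).2 ?_)) heE
        exact List.mem_flatMap.2 ⟨C', hC', dem_mem_cycleEdges.2 hj⟩
      · rw [mem_tradingGraph_sup] at heE ⊢
        rwa [← hne k hk]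
  -- The comparison graph is the intersection of both graphs: optimality for the report persists in
  -- it, and it differs from the true graph only at `i`.
  refine outdegree_le_of_subgraph (E := tradingGraph x) (E' := tradingGraph x ∩ tradingGraph x')
    (w := edgeWeight π) (t := Edge.tgt) hmax.1 (Finset.subset_inter hsub hmax'.1)
    Finset.inter_subset_left ?_ hmax.2.1 hmax'.2.1 hmax.2.2
    (fun G hG => hmax'.2.2 G (hG.trans Finset.inter_subset_right))
    (eq_of_sum_edgeWeight_eq π (pairInjective_tradingGraph x))
  intro e he hne'
  cases e with
  | dem k j =>
    by_cases hk : k = i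
    · exact Or.inl (by rw [hk]; rfl)
    · refine absurd (Finset.mem_inter.2 ⟨he, ?_⟩) hne'
      rw [mem_tradingGraph_dem] at he ⊢
      rwa [hne k hk]
  | sup j k =>
    by_cases hk : k = i
    · exact Or.inr (by rw [hk]; rfl)
    · refine absurd (Finset.mem_inter.2 ⟨he, ?_⟩) hne'
      rw [mem_tradingGraph_sup] at he ⊢
      rwa [hne k hk]

theorem socialWelfare_of_isExecution {x : Profile N M} {r : Execution N M}
    (h : IsExecution (tradingGraph x) r) :
    socialWelfare x r = ((∑ i, (receivedItems i r).card : ℕ) : ℤ) := by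
  rw [socialWelfare, Nat.cast_sum]
  exact Finset.sum_congr rfl fun i _ => utility_of_isExecution h i

/-- The welfare of the mechanism is at least the number of demand edges in the net effect of any
execution. -/
theorem IsAs.netEdges_le (hA : IsAs π A) {x : Profile N M} {r : Execution N M}
    (h : IsExecution (tradingGraph x) r) :
    ∑ i : N, ((netEdges (tradingGraph x) r).filter fun e => e.src = Sum.inl i).card
      ≤ ∑ i, (receivedItems i (A x)).card := by
  obtain ⟨μ, hμ, hr⟩ := hA x
  have hmax := (isMaxWeightPerfectMatching_iff hμ.1).1 hμ
  have hbal := netEdges_balanced h (noOwnDemand_tradingGraph x)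
  -- Maximum weight implies maximum cardinality, and a balanced set has exactly two edges per demand
  -- edge.
  have hcard := card_le_of_sum_edgeWeight_le π (pairInjective_tradingGraph x)
    (netEdges_subset h) hmax.1 (hmax.2.2 _ (netEdges_subset h) hbal)
  rw [hbal.card_eq, hmax.2.1.card_eq] at hcard
  simp only [hr.card_receivedItems]
  omega

theorem IsAs.isLApproximation (hA : IsAs π A) (x : Profile N M) : IsLApproximation x (A x) := by
  intro r h
  rw [socialWelfare_of_isExecution h, socialWelfare_of_isExecution (hA.isExecution x)]
  norm_cast
  refine le_trans ?_ (Nat.mul_le_mul_left _ (hA.netEdges_le h))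
  rw [Finset.mul_sum]
  refine Finset.sum_le_sum fun i _ => ?_
  rcases (receivedItems i r).eq_empty_or_nonempty with hemp | ⟨j, hj⟩
  · simp [hemp]
  obtain ⟨C, hC, hij⟩ := mem_receivedItems.1 hj
  obtain ⟨j', h1, h2⟩ := exists_lost_supply h (noOwnDemand_tradingGraph x) hC hij
  -- The item lost for good is a net edge arriving at `i`; by balance some net edge leaves `i`.
  have hpos : 1 ≤ ((netEdges (tradingGraph x) r).filter fun e => e.src = Sum.inl i).card := by
    rw [netEdges_balanced h (noOwnDemand_tradingGraph x)]
    refine Finset.card_pos.2 ⟨Edge.sup j' i, Finset.mem_filter.2 ⟨Finset.mem_union_left _ ?_, rfl⟩⟩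
    rw [Finset.mem_sdiff, sup_mem_supplyPart, sup_mem_supplyPart]
    exact ⟨h1, h2⟩
  have hle : (receivedItems i r).card ≤ (x i).demand.card := by
    refine Finset.card_le_card fun j hj => ?_
    obtain ⟨C, hC, hij⟩ := mem_receivedItems.1 hj
    exact mem_tradingGraph_dem.1 (dem_mem_of_mem_execution h hC hij)
  have hl : (x i).demand.card ≤ maxDemand x :=
    Finset.le_sup (f := fun i => (x i).demand.card) (Finset.mem_univ i)
  calc (receivedItems i r).card ≤ maxDemand x * 1 := by omega
    _ ≤ _ := Nat.mul_le_mul_left _ hpos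

theorem IsAs.isOptimalStatic (hA : IsAs π A) {x : Profile N M} (hx : SuppliesDisjoint x) :
    IsOptimalStatic x (A x) := by
  refine ⟨hA.isExecution x, ?_, ?_⟩
  · obtain ⟨μ, hμ, hr⟩ := hA x
    have hmax := (isMaxWeightPerfectMatching_iff hμ.1).1 hμ
    have hmem : ∀ p ∈ (A x).flatten, Edge.dem p.1 p.2 ∈ usedEdges μ := by
      intro p hp
      obtain ⟨C, hC, hpC⟩ := List.mem_flatten.1 hp
      exact (hr.mem_iff _).2 (List.mem_flatMap.2 ⟨C, hC, dem_mem_cycleEdges.2 hpC⟩)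
    -- An item with a single reported owner has at most one outgoing edge, so by balance at most one
    -- used demand edge arrives there. This makes the output static.
    have hone : ∀ j, ((usedEdges μ).filter fun e => e.tgt = Sum.inr j).card ≤ 1 := by
      intro j
      rw [← hmax.2.1]
      refine Finset.card_le_one.2 fun a ha b hb => ?_
      obtain ⟨haF, ha'⟩ := Finset.mem_filter.1 ha
      obtain ⟨hbF, hb'⟩ := Finset.mem_filter.1 hb
      cases a with
      | dem _ _ => simp [Edge.src] at ha'
      | sup j₁ k =>
      cases b with
      | dem _ _ => simp [Edge.src] at hb'
      | sup j₂ l =>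
        simp only [Edge.src, Sum.inr.injEq] at ha' hb'
        subst ha' hb'
        by_contra hkl
        have hkl : k ≠ l := fun h => hkl (by rw [h])
        exact Finset.disjoint_left.1 (hx hkl) (mem_tradingGraph_sup.1 (hmax.1 haF))
          (mem_tradingGraph_sup.1 (hmax.1 hbF))
    have hnd : (A x).flatten.Nodup := by
      refine List.nodup_flatten.2 ⟨fun C hC => (hr.1 C hC).2.1.of_map, ?_⟩
      refine (List.nodup_flatMap.1 hr.2.1).2.imp ?_
      intro C C' hCC' p hp hp'
      exact hCC' (dem_mem_cycleEdges.2 hp) (dem_mem_cycleEdges.2 hp')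
    refine hnd.map_on ?_
    rintro ⟨i, j⟩ hp ⟨k, j'⟩ hq hpq
    simp only at hpq
    subst hpq
    have := Finset.card_le_one.1 (hone j) _ (Finset.mem_filter.2 ⟨hmem _ hp, rfl⟩) _
      (Finset.mem_filter.2 ⟨hmem _ hq, rfl⟩)
    simpa using this
  · intro r h hst
    rw [socialWelfare_of_isExecution h, socialWelfare_of_isExecution (hA.isExecution x)]
    norm_cast
    refine le_trans (Finset.sum_le_sum fun i _ => ?_) (hA.netEdges_le h)
    -- In a static execution received items are kept, so each of them is a supply edge gained, hence
    -- a net demand edge.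
    refine Finset.card_le_card_of_injOn (fun j => Edge.dem i j) ?_ ?_
    · intro j hj
      obtain ⟨C, hC, hij⟩ := mem_receivedItems.1 hj
      refine Finset.mem_coe.2 (Finset.mem_filter.2 ⟨Finset.mem_union_right _
        (Finset.mem_image.2 ⟨Edge.sup j i, ?_, rfl⟩), rfl⟩)
      rw [Finset.mem_sdiff, sup_mem_supplyPart, sup_mem_supplyPart]
      exact ⟨sup_mem_endGraph_of_static hst hC hij,
        noOwnDemand_tradingGraph x i j (dem_mem_of_mem_execution h hC hij)⟩
    · intro a _ b _ hab
      simpa using hab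

end Utilities

end DurableGoods

namespace DurableGoods

/-! ## Programs with bounded loops -/

/-- Programs whose loops `for_ a P` execute `P` for the values `0, …, V - 1` of the counter in cell
`(0, 0)` of array `a`, where `V` is the content of cell `(0, 0)` of array `8`. -/
inductive LoopProgram where
  | skip : LoopProgram
  | set (a : ℕ) (u v e : Expr) : LoopProgram
  | seq (P Q : LoopProgram) : LoopProgram
  | ite (b : Expr) (P Q : LoopProgram) : LoopProgram
  | for_ (a : ℕ) (P : LoopProgram) : LoopProgram

/-- `k` rounds of a loop with counter `a` and body `f`. -/
def iterateFor (a : ℕ) (f : Store → Store) : ℕ → Store → Store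
  | 0, s => s
  | k + 1, s => f ((iterateFor a f k s).write a 0 0 k)

/-- `s` if `c ≠ 0`, and `t` otherwise. -/
def branch (c : ℕ) (s t : Store) : Store := if c = 0 then t else s

theorem branch_of_eq {c : ℕ} (h : c = 0) (s t : Store) : branch c s t = t := if_pos h

theorem branch_of_ne {c : ℕ} (h : c ≠ 0) (s t : Store) : branch c s t = s := if_neg h

namespace LoopProgram

/-- The effect of a program on the store. -/
def exec : LoopProgram → Store → Store
  | skip, s => s
  | set a u v e, s => s.write a (u.eval s) (v.eval s) (e.eval s)
  | seq P Q, s => Q.exec (P.exec s)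
  | ite b P Q, s => branch (b.eval s) (P.exec s) (Q.exec s)
  -- The final write records that the compiled loop leaves its counter equal to the loop length.
  | for_ a P, s => (iterateFor a P.exec (s 8 0 0) s).write a 0 0 (s 8 0 0)

/-- The arrays to which a program may write. -/
def writes : LoopProgram → List ℕ
  | skip => []
  | set a _ _ _ => [a]
  | seq P Q => P.writes ++ Q.writes
  | ite _ P Q => P.writes ++ Q.writes
  | for_ a P => a :: P.writes

/-- No loop changes its own counter. -/
def Ok : LoopProgram → Bool
  | skip => true
  | set _ _ _ _ => true
  | seq P Q => P.Ok && Q.Ok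
  | ite _ P Q => P.Ok && Q.Ok
  | for_ a P => P.Ok && !(P.writes.contains a)

/-- The translation to random access machine programs. -/
def toProgram : LoopProgram → Program
  | skip => .skip
  | set a u v e => .set a u v e
  | seq P Q => .seq P.toProgram Q.toProgram
  | ite b P Q => .ite b P.toProgram Q.toProgram
  | for_ a P => .seq (.set a (.lit 0) (.lit 0) (.lit 0))
      (.loop (.sub (.get 8 (.lit 0) (.lit 0)) (.get a (.lit 0) (.lit 0)))
        (.seq P.toProgram
          (.set a (.lit 0) (.lit 0) (.add (.get a (.lit 0) (.lit 0)) (.lit 1)))))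

/-- A bound on the number of steps, as a polynomial in the length of the loops. -/
noncomputable def costBound : LoopProgram → Polynomial ℕ
  | skip => 1
  | set _ u v e => Polynomial.C (u.cost + v.cost + e.cost + 1)
  | seq P Q => P.costBound + Q.costBound
  | ite b P Q => Polynomial.C (b.cost + 1) + P.costBound + Q.costBound
  -- Initializing the counter takes 4 steps, each test 8 and each increment 8: `12` covers the
  -- initialization and the last test, `16` the overhead of one round.
  | for_ _ P => Polynomial.C 12 + Polynomial.X * (Polynomial.C 16 + P.costBound)

theorem exec_frame (P : LoopProgram) (s : Store) {b : ℕ} (hb : b ∉ P.writes) :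
    P.exec s b = s b := by
  induction P generalizing s with
  | skip => rfl
  | set a u v e =>
    simp only [writes, List.mem_singleton] at hb
    funext u' v'
    simp [exec, Store.write, hb]
  | seq P Q ihP ihQ =>
    simp only [writes, List.mem_append, not_or] at hb
    rw [exec, ihQ _ hb.2, ihP _ hb.1]
  | ite c P Q ihP ihQ =>
    simp only [writes, List.mem_append, not_or] at hb
    rw [exec, branch]
    split_ifs
    · exact ihQ _ hb.2
    · exact ihP _ hb.1
  | for_ a P ih =>
    simp only [writes, List.mem_cons, not_or] at hb
    have hw : ∀ (s : Store) k, s.write a 0 0 k b = s b := by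
      intro s k
      funext u v
      simp [Store.write, hb.1]
    rw [exec, hw]
    generalize s 8 0 0 = V
    induction V with
    | zero => rfl
    | succ k ihk => rw [iterateFor, ih _ hb.2, hw, ihk]

theorem iterateFor_frame (P : LoopProgram) (s : Store) {a b : ℕ} (k : ℕ) (hb : b ∉ P.writes)
    (hab : b ≠ a) : iterateFor a P.exec k s b = s b := by
  induction k with
  | zero => rfl
  | succ k ih =>
    rw [iterateFor, P.exec_frame _ hb]
    funext u v
    simp [Store.write, hab, ih]

/-- A program with bounded loops halts after a number of steps that is polynomial in the length of
its loops. -/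
theorem runs_exec (P : LoopProgram) (hP : P.Ok = true) (h8 : 8 ∉ P.writes) (s : Store) :
    ∃ t, Runs P.toProgram s (P.exec s) t ∧ t ≤ P.costBound.eval (s 8 0 0) := by
  induction P generalizing s with
  | skip => exact ⟨1, Runs.skip s, by simp [costBound]⟩
  | set a u v e => exact ⟨_, Runs.set s a u v e, by simp [costBound]⟩
  | seq P Q ihP ihQ =>
    simp only [writes, List.mem_append, not_or] at h8
    simp only [Ok, Bool.and_eq_true] at hP
    obtain ⟨t, h1, h2⟩ := ihP hP.1 h8.1 s
    obtain ⟨t', h3, h4⟩ := ihQ hP.2 h8.2 (P.exec s)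
    rw [exec_frame P s h8.1] at h4
    refine ⟨t + t', Runs.seq h1 h3, ?_⟩
    rw [costBound, Polynomial.eval_add]
    omega
  | ite b P Q ihP ihQ =>
    simp only [writes, List.mem_append, not_or] at h8
    simp only [Ok, Bool.and_eq_true] at hP
    simp only [exec, branch, costBound, Polynomial.eval_add, Polynomial.eval_C, toProgram]
    split_ifs with hb
    · obtain ⟨t', h3, h4⟩ := ihQ hP.2 h8.2 s
      exact ⟨_, Runs.ite_false hb h3, by omega⟩
    · obtain ⟨t, h1, h2⟩ := ihP hP.1 h8.1 s
      exact ⟨_, Runs.ite_true hb h1, by omega⟩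
  | for_ a P ih =>
    simp only [writes, List.mem_cons, not_or] at h8
    simp only [Ok, Bool.and_eq_true, Bool.not_eq_true', List.contains_eq_mem,
      decide_eq_false_iff_not] at hP
    have ih := ih hP.1 h8.2
    set V := s 8 0 0 with hV
    -- `S k` is the store at test number `k` of the compiled loop, counting from `0`.
    set S := fun k => (iterateFor a P.exec k s).write a 0 0 k with hS
    have hS8 : ∀ k, S k 8 0 0 = V := by
      intro k
      simp only [hS, Store.write, h8.1, false_and, if_false]
      rw [iterateFor_frame P s k h8.2 h8.1]
    have hSa : ∀ k, S k a 0 0 = k := by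
      intro k
      simp [hS, Store.write]
    have hbody : ∀ k, (P.exec (S k)).write a 0 0 (P.exec (S k) a 0 0 + 1) = S (k + 1) := by
      intro k
      rw [P.exec_frame _ hP.2, hSa]
      rfl
    set b : Expr := .sub (.get 8 (.lit 0) (.lit 0)) (.get a (.lit 0) (.lit 0)) with hb
    have hbS : ∀ k, b.eval (S k) = V - k := by
      intro k
      simp only [hb, Expr.eval, hS8, hSa]
    have hloop : ∀ d k, k + d = V → ∃ t, Runs (.loop b (.seq P.toProgram
        (.set a (.lit 0) (.lit 0) (.add (.get a (.lit 0) (.lit 0)) (.lit 1))))) (S k) (S V) t ∧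
        t ≤ 8 + d * (16 + P.costBound.eval V) := by
      intro d
      induction d with
      | zero =>
        intro k hk
        have hk : k = V := hk
        subst hk
        exact ⟨_, Runs.loop_done (by rw [hbS]; omega), by simp [hb, Expr.cost]⟩
      | succ d ihd =>
        intro k hk
        obtain ⟨t, h1, h2⟩ := ih (S k)
        rw [hS8] at h2
        obtain ⟨t', h3, h4⟩ := ihd (k + 1) (by omega)
        have h5 := Runs.set (P.exec (S k)) a (.lit 0) (.lit 0)
          (.add (.get a (.lit 0) (.lit 0)) (.lit 1))
        simp only [Expr.eval, hbody] at h5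
        refine ⟨_, Runs.loop_step (by rw [hbS]; omega) (Runs.seq h1 h5) h3, ?_⟩
        simp only [hb, Expr.cost]
        rw [Nat.succ_mul]
        omega
    obtain ⟨t, h1, h2⟩ := hloop V 0 (Nat.zero_add V)
    refine ⟨_, Runs.seq (Runs.set s a (.lit 0) (.lit 0) (.lit 0)) h1, ?_⟩
    simp only [costBound, Polynomial.eval_add, Polynomial.eval_mul, Polynomial.eval_C,
      Polynomial.eval_X, Expr.cost]
    omega

/-- The invariant rule for loops. -/
theorem exec_for {a : ℕ} {P : LoopProgram} {s : Store} (Inv : ℕ → Store → Prop)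
    -- The invariant may not depend on the counter array, which is overwritten between rounds.
    (hInv : ∀ k s s', (∀ b, b ≠ a → s' b = s b) → Inv k s → Inv k s') (h0 : Inv 0 s)
    (hstep : ∀ k s', k < s 8 0 0 → (∀ b, b ∉ a :: P.writes → s' b = s b) → s' a 0 0 = k →
      Inv k s' → Inv (k + 1) (P.exec s')) : Inv (s 8 0 0) ((for_ a P).exec s) := by
  have hw : ∀ (s : Store) k b, b ≠ a → s.write a 0 0 k b = s b := by
    intro s k b hb
    funext u v
    simp [Store.write, hb]
  have key : ∀ k, k ≤ s 8 0 0 → Inv k (iterateFor a P.exec k s) := by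
    intro k
    induction k with
    | zero => exact fun _ => h0
    | succ k ih =>
      intro hk
      refine hstep k _ hk ?_ (by simp [Store.write]) (hInv k _ _ (hw _ k) (ih (by omega)))
      intro b hb
      rw [List.mem_cons, not_or] at hb
      rw [hw _ _ _ hb.1, iterateFor_frame P s k hb.2 hb.1]
  exact hInv _ _ _ (hw _ _) (key _ le_rfl)

/-- The invariant rule for a doubly nested loop whose body ignores the counters. -/
theorem exec_for_for {a a' : ℕ} {P : LoopProgram} {s : Store} (Inv : ℕ → Store → Prop)
    (ha8 : 8 ∉ a :: a' :: P.writes)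
    (hInv : ∀ k s s', (∀ b, b ≠ a → b ≠ a' → s' b = s b) → Inv k s → Inv k s') (h0 : Inv 0 s)
    (hstep : ∀ k s', k < s 8 0 0 * s 8 0 0 → (∀ b, b ∉ a :: a' :: P.writes → s' b = s b) →
      Inv k s' → Inv (k + 1) (P.exec s')) :
    Inv (s 8 0 0 * s 8 0 0) ((for_ a (for_ a' P)).exec s) := by
  refine exec_for (fun k s' => Inv (k * s 8 0 0) s')
    (fun k s₁ s₂ h => hInv _ _ _ fun b hb _ => h b hb) (by simpa using h0) ?_
  intro k s₁ hk hs₁ _ hI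
  have h8 : s₁ 8 = s 8 := hs₁ 8 ha8
  have := exec_for (a := a') (P := P) (s := s₁) (fun k' s' => Inv (k * s 8 0 0 + k') s')
    (fun k s₁ s₂ h => hInv _ _ _ fun b _ hb => h b hb) (by simpa using hI) (by
      intro k' s₂ hk' hs₂ _ hI'
      rw [h8] at hk'
      refine hstep _ s₂ ?_ ?_ hI'
      · calc k * s 8 0 0 + k' < (k + 1) * s 8 0 0 := by rw [Nat.succ_mul]; omega
          _ ≤ _ := Nat.mul_le_mul_right _ hk
      · intro b hb
        rw [hs₂ b (fun h => hb (List.mem_cons_of_mem _ h)), hs₁ b hb])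
  rw [h8] at this
  rw [Nat.succ_mul]
  exact this

end LoopProgram

end DurableGoods

namespace DurableGoods

/-! ## Maximum-weight circulations by inserting edges

Graphs on the vertices `0, …, V - 1` are given by the matrix `W` of their positive edge weights, and
sets of edges by `0`-`1` matrices `F`. Optimality is certified by potentials `p`. -/

/-- The matrix `f` with entry `(u, v)` replaced by `w`. -/
def cellUpdate (f : ℕ → ℕ → ℕ) (u v w : ℕ) : ℕ → ℕ → ℕ :=
  fun x y => if x = u ∧ y = v then w else f x y

theorem cellUpdate_self (f : ℕ → ℕ → ℕ) (u v w : ℕ) : cellUpdate f u v w u v = w := by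
  simp [cellUpdate]

theorem cellUpdate_of_ne (f : ℕ → ℕ → ℕ) {u v x y : ℕ} (w : ℕ) (h : x = u → y ≠ v) :
    cellUpdate f u v w x y = f x y := by
  simp only [cellUpdate, ite_eq_right_iff]
  exact fun hxy => absurd hxy.2 (h hxy.1)

/-- A graph on `V` vertices without antiparallel edges. -/
def IsGraph (V : ℕ) (W : ℕ → ℕ → ℕ) : Prop :=
  ∀ x y, W x y ≠ 0 → x < V ∧ y < V ∧ W y x = 0

/-- `F` is a set of edges, and the potentials `p` satisfy complementary slackness. -/
structure Slack (W F : ℕ → ℕ → ℕ) (p : ℕ → ℕ) : Prop where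
  used : ∀ x y, F x y ≠ 0 → F x y = 1 ∧ W x y ≠ 0 ∧ p y ≤ W x y + p x
  unused : ∀ x y, F x y = 0 → W x y ≠ 0 → W x y + p x ≤ p y

/-- The number of edges of `F` that leave `z`. -/
def outSum (V : ℕ) (F : ℕ → ℕ → ℕ) (z : ℕ) : ℕ := ∑ y ∈ Finset.range V, F z y

/-- The number of edges of `F` that arrive at `z`. -/
def inSum (V : ℕ) (F : ℕ → ℕ → ℕ) (z : ℕ) : ℕ := ∑ y ∈ Finset.range V, F y z

/-- `F` becomes a circulation when an edge from `z` to `u` is added. -/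
def OpenBalanced (V : ℕ) (F : ℕ → ℕ → ℕ) (z u : ℕ) : Prop :=
  ∀ c, outSum V F c + (if c = z then 1 else 0) = inSum V F c + (if c = u then 1 else 0)

theorem outSum_cellUpdate {V x y : ℕ} (F : ℕ → ℕ → ℕ) (hy : y < V) (w c : ℕ) :
    outSum V (cellUpdate F x y w) c + (if c = x then F x y else 0)
      = outSum V F c + (if c = x then w else 0) := by
  by_cases hc : c = x
  · subst hc
    have hy := Finset.mem_range.2 hy
    rw [if_pos rfl, if_pos rfl, outSum, outSum, ← Finset.add_sum_erase _ _ hy,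
      ← Finset.add_sum_erase _ _ hy, cellUpdate_self]
    have : ∑ z ∈ (Finset.range V).erase y, cellUpdate F c y w c z
        = ∑ z ∈ (Finset.range V).erase y, F c z :=
      Finset.sum_congr rfl fun z hz =>
        cellUpdate_of_ne F w fun _ => (Finset.mem_erase.1 hz).1
    omega
  · rw [if_neg hc, if_neg hc, outSum, outSum]
    congr 1
    exact Finset.sum_congr rfl fun z _ => cellUpdate_of_ne F w fun h => absurd h hc

theorem inSum_cellUpdate {V x y : ℕ} (F : ℕ → ℕ → ℕ) (hx : x < V) (w c : ℕ) :
    inSum V (cellUpdate F x y w) c + (if c = y then F x y else 0)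
      = inSum V F c + (if c = y then w else 0) := by
  by_cases hc : c = y
  · subst hc
    have hx := Finset.mem_range.2 hx
    rw [if_pos rfl, if_pos rfl, inSum, inSum, ← Finset.add_sum_erase _ _ hx,
      ← Finset.add_sum_erase _ _ hx, cellUpdate_self]
    have : ∑ z ∈ (Finset.range V).erase x, cellUpdate F x c w z c
        = ∑ z ∈ (Finset.range V).erase x, F z c :=
      Finset.sum_congr rfl fun z hz =>
        cellUpdate_of_ne F w fun h => absurd h (Finset.mem_erase.1 hz).1
    omega
  · rw [if_neg hc, if_neg hc, inSum, inSum]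
    congr 1
    exact Finset.sum_congr rfl fun z _ => cellUpdate_of_ne F w fun _ => hc

/-- The missing edge from `z` to `u` is replaced by the edge from `z` to `y` and a missing edge from
`y` to `u`: one step along the path. -/
theorem OpenBalanced.add {V : ℕ} {F : ℕ → ℕ → ℕ} {z u y : ℕ} (h : OpenBalanced V F z u)
    (hz : z < V) (hy : y < V) (hF : F z y = 0) : OpenBalanced V (cellUpdate F z y 1) y u := by
  intro c
  have h1 := outSum_cellUpdate (x := z) F hy 1 c
  have h2 := inSum_cellUpdate (y := y) F hz 1 c
  have h3 := h c
  simp only [hF, ite_self, add_zero] at h1 h2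
  omega

theorem OpenBalanced.remove {V : ℕ} {F : ℕ → ℕ → ℕ} {z u y : ℕ} (h : OpenBalanced V F z u)
    (hz : z < V) (hy : y < V) (hF : F y z = 1) : OpenBalanced V (cellUpdate F y z 0) y u := by
  intro c
  have h1 := outSum_cellUpdate (x := y) F hz 0 c
  have h2 := inSum_cellUpdate (y := z) F hy 0 c
  have h3 := h c
  simp only [hF, ite_self, add_zero] at h1 h2
  omega

theorem OpenBalanced.iff_of_eq {V : ℕ} {F : ℕ → ℕ → ℕ} {z : ℕ} :
    OpenBalanced V F z z ↔ ∀ c, outSum V F c = inSum V F c := by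
  simp [OpenBalanced]

/-- The residual graph of `F` contains an edge from `a` to `b` of reduced cost `0`. -/
def Tight (W F : ℕ → ℕ → ℕ) (p : ℕ → ℕ) (a b : ℕ) : Prop :=
  (F b a ≠ 0 ∧ p a = p b + W b a) ∨ (F a b = 0 ∧ W a b ≠ 0 ∧ p b = p a + W a b)

/-- The residual graph of `F` contains an edge of reduced cost `-e` from `a`, which has no label, to
`b`, which has one. -/
def Candidate (W F : ℕ → ℕ → ℕ) (p l : ℕ → ℕ) (a b e : ℕ) : Prop :=
  l a = 0 ∧ l b ≠ 0 ∧ ((W a b ≠ 0 ∧ F a b = 0 ∧ e = p b - (p a + W a b)) ∨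
    (F b a ≠ 0 ∧ e = p b + W b a - p a))

/-- The potentials after an increase by `d` at the vertices without label. -/
def raise (V : ℕ) (p l : ℕ → ℕ) (d : ℕ) : ℕ → ℕ :=
  fun a => if a < V ∧ l a = 0 then p a + d else p a

/-- Raising the unlabelled side tightens only constraints on edges between the two sides that give a
candidate, whose slack is at least `d`; every other constraint keeps or gains slack. -/
theorem Slack.raise {V : ℕ} {W F : ℕ → ℕ → ℕ} {p l : ℕ → ℕ} {d : ℕ} (h : Slack W F p)
    (hW : IsGraph V W) (hd : ∀ a b e, Candidate W F p l a b e → d ≤ e) :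
    Slack W F (raise V p l d) := by
  constructor
  · intro x y hF
    obtain ⟨h1, h2, h3⟩ := h.used x y hF
    obtain ⟨hx, hy, -⟩ := hW x y h2
    refine ⟨h1, h2, ?_⟩
    simp only [DurableGoods.raise, hx, hy, true_and]
    by_cases lx : l x = 0 <;> by_cases ly : l y = 0 <;> simp only [lx, ly, if_true, if_false]
    · omega
    · omega
    · have := hd y x _ ⟨ly, lx, Or.inr ⟨hF, rfl⟩⟩
      omega
    · exact h3
  · intro x y hF hw
    obtain ⟨hx, hy, -⟩ := hW x y hw
    have h3 := h.unused x y hF hw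
    simp only [DurableGoods.raise, hx, hy, true_and]
    by_cases lx : l x = 0 <;> by_cases ly : l y = 0 <;> simp only [lx, ly, if_true, if_false]
    · omega
    · have := hd x y _ ⟨lx, ly, Or.inl ⟨hw, hF, rfl⟩⟩
      omega
    · omega
    · exact h3

/-- The state of the search for a tight residual path from `v` to `u` after `k` rounds: `l` are the
labels of the vertices from which `u` is known to be reachable, `q` points to the next vertex on
the way, and `g ≠ 0` if the search has ended because the new edge from `u` to `v`, of weight `w`,
need not be used. -/
structure Search (V : ℕ) (W F : ℕ → ℕ → ℕ) (u v w : ℕ) (p l q : ℕ → ℕ) (g k : ℕ) : Prop where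
  slack : Slack W F p
  root : l u = 1
  bound : ∀ a < V, l a ≤ k + 1
  tree : ∀ a < V, l a ≠ 0 → a ≠ u → q a < V ∧ l (q a) ≠ 0 ∧ l (q a) < l a ∧ Tight W F p a (q a)
  card : g = 0 → l v = 0 → ((Finset.range V).filter fun a => l a ≠ 0).card = k + 1
  fail : g ≠ 0 → l v = 0 ∧ w + p u ≤ p v
  found : l v ≠ 0 → p v ≤ w + p u

theorem Search.start {V : ℕ} {W F : ℕ → ℕ → ℕ} {u v w : ℕ} {p l q : ℕ → ℕ} (h : Slack W F p)
    (hu : u < V) (hv : v < V) (huv : u ≠ v) (hl : ∀ a < V, l a = if a = u then 1 else 0) :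
    Search V W F u v w p l q 0 0 := by
  have hlu : l u = 1 := by simp [hl u hu]
  have hlv : l v = 0 := by simp [hl v hv, huv.symm]
  refine ⟨h, hlu, ?_, ?_, ?_, fun h => absurd rfl h, fun h => absurd hlv h⟩
  · intro a ha
    rw [hl a ha]
    split_ifs <;> omega
  · intro a ha hla hau
    rw [hl a ha, if_neg hau] at hla
    exact absurd rfl hla
  · intro _ _
    rw [Finset.card_eq_one]
    refine ⟨u, ?_⟩
    ext a
    simp only [Finset.mem_filter, Finset.mem_range, Finset.mem_singleton]
    constructor
    · rintro ⟨ha, h⟩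
      by_contra hau
      rw [hl a ha, if_neg hau] at h
      exact h rfl
    · rintro rfl
      exact ⟨hu, by omega⟩

theorem Search.idle {V : ℕ} {W F : ℕ → ℕ → ℕ} {u v w : ℕ} {p l q : ℕ → ℕ} {g k : ℕ}
    (h : Search V W F u v w p l q g k) (hd : l v ≠ 0 ∨ g ≠ 0) :
    Search V W F u v w p l q g (k + 1) :=
  ⟨h.slack, h.root, fun a ha => (h.bound a ha).trans (by omega), h.tree,
    fun hg hl => by rcases hd with hd | hd <;> contradiction, h.fail, h.found⟩

theorem Tight.raise {V : ℕ} {W F : ℕ → ℕ → ℕ} {p l : ℕ → ℕ} {a b : ℕ} (h : Tight W F p a b)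
    (d : ℕ) (ha : l a ≠ 0) (hb : l b ≠ 0) : Tight W F (raise V p l d) a b := by
  simpa [Tight, DurableGoods.raise, ha, hb] using h

/-- Raising `v` but not `u` by the truncated difference `w + p u - p v` makes the constraint for
leaving the new edge unused hold. -/
theorem Search.fail_step {V : ℕ} {W F : ℕ → ℕ → ℕ} {u v w : ℕ} {p l q : ℕ → ℕ} {k d g : ℕ}
    (h : Search V W F u v w p l q 0 k) (hW : IsGraph V W) (hv : v < V) (hlv : l v = 0)
    (hd : ∀ a b e, Candidate W F p l a b e → d ≤ e) (hdw : d = w + p u - p v) (hg : g ≠ 0) :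
    Search V W F u v w (raise V p l d) l q g (k + 1) := by
  refine ⟨h.slack.raise hW hd, h.root, fun a ha => (h.bound a ha).trans (by omega), ?_,
    fun hg' => absurd hg' hg, fun _ => ⟨hlv, ?_⟩, fun h => absurd hlv h⟩
  · intro a ha hla hau
    obtain ⟨h1, h2, h3, h4⟩ := h.tree a ha hla hau
    exact ⟨h1, h2, h3, h4.raise d hla h2⟩
  · have := h.root
    simp only [DurableGoods.raise, hv, hlv, this]
    simp
    omega

/-- The raise by `d` makes the minimal candidate tight, so `a` can be labelled and point to `b`. The
label `k + 2` exceeds all earlier ones, which makes labels decrease along pointers. As `d` is below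
`w + p u - p v`, the new edge still satisfies the constraint of a used edge. -/
theorem Search.grow_step {V : ℕ} {W F : ℕ → ℕ → ℕ} {u v w : ℕ} {p l q l' q' : ℕ → ℕ}
    {k d a b : ℕ} (h : Search V W F u v w p l q 0 k) (hW : IsGraph V W)
    (hv : v < V) (hlv : l v = 0)
    (hd : ∀ a b e, Candidate W F p l a b e → d ≤ e) (hdw : d < w + p u - p v)
    (hab : Candidate W F p l a b d)
    (hl' : ∀ x, l' x = if x = a then k + 2 else l x) (hq' : ∀ x, q' x = if x = a then b else q x) :
    Search V W F u v w (raise V p l d) l' q' 0 (k + 1) := by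
  obtain ⟨hla, hlb, hab⟩ := hab
  have hV : a < V ∧ b < V := by
    rcases hab with ⟨h1, -, -⟩ | ⟨h1, -⟩
    · exact ⟨(hW a b h1).1, (hW a b h1).2.1⟩
    · have := hW b a (h.slack.used b a h1).2.1
      exact ⟨this.2.1, this.1⟩
  have hba : b ≠ a := fun hba => hlb (hba ▸ hla)
  have hua : u ≠ a := by
    rintro rfl
    rw [h.root] at hla
    exact absurd hla one_ne_zero
  have hla' : l' a = k + 2 := by simp [hl']
  have hl'ne : ∀ x, x ≠ a → l' x = l x := fun x hx => by simp [hl', hx]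
  refine ⟨h.slack.raise hW hd, by rw [hl'ne u hua, h.root], ?_, ?_, ?_, fun h => absurd rfl h, ?_⟩
  · intro x hx
    have := h.bound x hx
    rw [hl']
    split_ifs <;> omega
  · intro x hx hlx hxu
    by_cases hxa : x = a
    · subst hxa
      have hqx : q' x = b := by simp [hq']
      have hb := h.bound b hV.2
      rw [hqx, hl'ne b hba, hla']
      refine ⟨hV.2, hlb, by omega, ?_⟩
      have pa : DurableGoods.raise V p l d x = p x + d := by
        simp [DurableGoods.raise, hx, hla]
      have pb : DurableGoods.raise V p l d b = p b := by
        simp [DurableGoods.raise, hlb]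
      rcases hab with ⟨h1, h2, h3⟩ | ⟨h1, h2⟩
      · have := h.slack.unused x b h2 h1
        refine Or.inr ⟨h2, h1, ?_⟩
        rw [pa, pb]
        omega
      · have := (h.slack.used b x h1).2.2
        refine Or.inl ⟨h1, ?_⟩
        rw [pa, pb]
        omega
    · rw [hl'ne x hxa] at hlx ⊢
      have hqx : q' x = q x := by simp [hq', hxa]
      obtain ⟨h1, h2, h3, h4⟩ := h.tree x hx hlx hxu
      have hqa : q x ≠ a := fun hqa => h2 (hqa ▸ hla)
      rw [hqx, hl'ne _ hqa]
      exact ⟨h1, h2, h3, h4.raise d hlx h2⟩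
  · intro _ hlv'
    have : (Finset.range V).filter (fun x => l' x ≠ 0)
        = insert a ((Finset.range V).filter fun x => l x ≠ 0) := by
      ext x
      simp only [Finset.mem_filter, Finset.mem_range, Finset.mem_insert]
      by_cases hxa : x = a
      · subst hxa
        simp [hla', hV.1]
      · simp [hl'ne x hxa, hxa]
    rw [this, Finset.card_insert_of_notMem (by simp [hla]), h.card rfl hlv]
  · intro hlv'
    have hva : v = a := by
      by_contra hva
      rw [hl'ne v hva] at hlv'
      exact hlv' hlv
    subst hva
    have := h.root
    simp only [DurableGoods.raise, hv, hlv, this]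
    simp
    omega

/-- Every unfinished round labels one more vertex, so `V` of them would require `V + 1` vertices. -/
theorem Search.reached {V : ℕ} {W F : ℕ → ℕ → ℕ} {u v w : ℕ} {p l q : ℕ → ℕ}
    (h : Search V W F u v w p l q 0 V) : l v ≠ 0 := by
  intro hlv
  have h1 := h.card rfl hlv
  have h2 := Finset.card_filter_le (Finset.range V) fun a => l a ≠ 0
  rw [Finset.card_range] at h2
  omega

/-- The state of the augmentation along the path found by the search, after `k` of its edges: the
rest of the path starts at `z`. -/
structure Augment (V : ℕ) (W F : ℕ → ℕ → ℕ) (u : ℕ) (p l q : ℕ → ℕ) (z k : ℕ) : Prop where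
  slack : Slack W F p
  balanced : OpenBalanced V F z u
  lt : z < V
  label : l z ≠ 0
  le : z = u ∨ l z + k ≤ V + 1
  tree : ∀ a < V, l a ≠ 0 → a ≠ u → l a ≤ l z →
    q a < V ∧ l (q a) ≠ 0 ∧ l (q a) < l a ∧ Tight W F p a (q a)

/-- With the new edge from `u` to `v` put into `F`, what is missing for balance is an edge from `v`
to `u`. Tight edges are unaffected because neither the new edge nor its use existed before. -/
theorem Search.augment {V : ℕ} {W F : ℕ → ℕ → ℕ} {u v w : ℕ} {p l q : ℕ → ℕ}
    (h : Search V W F u v w p l q 0 V) (hF : ∀ c, outSum V F c = inSum V F c) (hu : u < V)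
    (hv : v < V) (hw : w ≠ 0) (hWuv : W u v = 0) :
    Augment V (cellUpdate W u v w) (cellUpdate F u v 1) u p l q v 0 := by
  have hFuv : F u v = 0 := by
    by_contra hcon
    exact (h.slack.used u v hcon).2.1 hWuv
  refine ⟨⟨?_, ?_⟩, (OpenBalanced.iff_of_eq.2 hF).add hu hv hFuv, hv, h.reached,
    Or.inr (h.bound v hv), fun a ha hla hau _ => ?_⟩
  · intro x y hxy
    by_cases hc : x = u ∧ y = v
    · obtain ⟨rfl, rfl⟩ := hc
      rw [cellUpdate_self, cellUpdate_self]
      exact ⟨rfl, hw, h.found h.reached⟩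
    · rw [cellUpdate_of_ne _ _ (by tauto)] at hxy ⊢
      rw [cellUpdate_of_ne _ _ (by tauto)]
      exact h.slack.used x y hxy
  · intro x y hxy
    by_cases hc : x = u ∧ y = v
    · obtain ⟨rfl, rfl⟩ := hc
      rw [cellUpdate_self] at hxy
      exact absurd hxy one_ne_zero
    · rw [cellUpdate_of_ne _ _ (by tauto)] at hxy ⊢
      exact h.slack.unused x y hxy
  · obtain ⟨h1, h2, h3, h4⟩ := h.tree a ha hla hau
    refine ⟨h1, h2, h3, ?_⟩
    rcases h4 with ⟨h5, h6⟩ | ⟨h5, h6, h7⟩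
    · have : q a = u → a ≠ v := by
        rintro e1 rfl
        exact h5 (e1 ▸ hFuv)
      left
      rw [cellUpdate_of_ne _ _ this, cellUpdate_of_ne _ _ this]
      exact ⟨h5, h6⟩
    · have : a = u → q a ≠ v := by
        rintro rfl e1
        exact h6 (e1 ▸ hWuv)
      right
      rw [cellUpdate_of_ne _ _ this, cellUpdate_of_ne _ _ this]
      exact ⟨h5, h6, h7⟩

/-! ### Augmentation along the tight path -/

/-- The edge set after the exchange of the residual edge from `z` to `y`. -/
def toggle (F : ℕ → ℕ → ℕ) (z y : ℕ) : ℕ → ℕ → ℕ :=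
  if F y z ≠ 0 then cellUpdate F y z 0 else cellUpdate F z y 1

theorem toggle_of_ne {F : ℕ → ℕ → ℕ} {z y a b : ℕ} (ha : a ≠ z) (hb : b ≠ z) :
    toggle F z y a b = F a b := by
  unfold toggle
  split_ifs
  · exact cellUpdate_of_ne _ _ fun _ => hb
  · exact cellUpdate_of_ne _ _ fun h => absurd h ha

/-- A tight edge satisfies both slackness conditions with equality, so exchanging it preserves
slackness. The rest of the path has smaller labels and never returns to `z`, so its edges stay
tight. -/
theorem Augment.step {V : ℕ} {W F : ℕ → ℕ → ℕ} {u : ℕ} {p l q : ℕ → ℕ} {z k : ℕ}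
    (h : Augment V W F u p l q z k) (hW : IsGraph V W) (hz : z ≠ u) :
    Augment V W (toggle F z (q z)) u p l q (q z) (k + 1) := by
  obtain ⟨h1, h2, h3, h4⟩ := h.tree z h.lt h.label hz le_rfl
  have hle := h.le.resolve_left hz
  have htree : ∀ a < V, l a ≠ 0 → a ≠ u → l a ≤ l (q z) →
      q a < V ∧ l (q a) ≠ 0 ∧ l (q a) < l a ∧ Tight W (toggle F z (q z)) p a (q a) := by
    intro a ha hla hau hle
    obtain ⟨g1, g2, g3, g4⟩ := h.tree a ha hla hau (by omega)
    refine ⟨g1, g2, g3, ?_⟩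
    have e1 : a ≠ z := by rintro rfl; omega
    have e2 : q a ≠ z := by intro e; rw [e] at g3; omega
    rwa [Tight, toggle_of_ne e1 e2, toggle_of_ne e2 e1]
  refine ⟨?_, ?_, h1, h2, Or.inr (by omega), htree⟩
  · unfold toggle
    split_ifs with hF
    · have htight : p z = p (q z) + W (q z) z := by
        rcases h4 with h4 | h4
        · exact h4.2
        · exact absurd (hW _ _ (h.slack.used _ _ hF).2.1).2.2 h4.2.1
      refine ⟨fun x y hxy => ?_, fun x y hxy hw => ?_⟩
      · by_cases hc : x = q z ∧ y = z
        · rw [hc.1, hc.2, cellUpdate_self] at hxy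
          exact absurd rfl hxy
        · rw [cellUpdate_of_ne _ _ (by tauto)] at hxy ⊢
          exact h.slack.used x y hxy
      · by_cases hc : x = q z ∧ y = z
        · rw [hc.1, hc.2]
          omega
        · rw [cellUpdate_of_ne _ _ (by tauto)] at hxy
          exact h.slack.unused x y hxy hw
    · have htight := h4.resolve_left fun h => hF h.1
      refine ⟨fun x y hxy => ?_, fun x y hxy hw => ?_⟩
      · by_cases hc : x = z ∧ y = q z
        · rw [hc.1, hc.2, cellUpdate_self]
          exact ⟨rfl, htight.2.1, by omega⟩
        · rw [cellUpdate_of_ne _ _ (by tauto)] at hxy ⊢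
          exact h.slack.used x y hxy
      · by_cases hc : x = z ∧ y = q z
        · rw [hc.1, hc.2, cellUpdate_self] at hxy
          exact absurd hxy one_ne_zero
        · rw [cellUpdate_of_ne _ _ (by tauto)] at hxy
          exact h.slack.unused x y hxy hw
  · unfold toggle
    split_ifs with hF
    · exact h.balanced.remove h.lt h1 (h.slack.used _ _ hF).1
    · refine h.balanced.add h.lt h1 ?_
      exact (h4.resolve_left fun h => hF h.1).1

theorem Augment.idle {V : ℕ} {W F : ℕ → ℕ → ℕ} {u : ℕ} {p l q : ℕ → ℕ} {z k : ℕ}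
    (h : Augment V W F u p l q z k) (hz : z = u) : Augment V W F u p l q z (k + 1) :=
  ⟨h.slack, h.balanced, h.lt, h.label, Or.inl hz, h.tree⟩

/-- Off the root, the label has dropped to at most `1` after `V` steps, while the pointer would need
a smaller nonzero label. -/
theorem Augment.finish {V : ℕ} {W F : ℕ → ℕ → ℕ} {u : ℕ} {p l q : ℕ → ℕ} {z : ℕ}
    (h : Augment V W F u p l q z V) : ∀ c, outSum V F c = inSum V F c := by
  have hz : z = u := by
    by_contra hz
    obtain ⟨h1, h2, h3, -⟩ := h.tree z h.lt h.label hz le_rfl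
    have := h.le.resolve_left hz
    omega
  subst hz
  exact OpenBalanced.iff_of_eq.1 h.balanced

theorem Search.reject {V : ℕ} {W F : ℕ → ℕ → ℕ} {u v w : ℕ} {p l q : ℕ → ℕ} {g k : ℕ}
    (h : Search V W F u v w p l q g k) (hg : g ≠ 0) (hWuv : W u v = 0) :
    Slack (cellUpdate W u v w) F p := by
  refine ⟨fun x y hxy => ?_, fun x y hxy hw => ?_⟩
  · have := h.slack.used x y hxy
    rwa [cellUpdate_of_ne]
    rintro rfl rfl
    exact this.2.1 hWuv
  · by_cases hc : x = u ∧ y = v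
    · rw [hc.1, hc.2, cellUpdate_self]
      exact (h.fail hg).2
    · rw [cellUpdate_of_ne _ _ (by tauto)] at hw ⊢
      exact h.slack.unused x y hxy hw

end DurableGoods

namespace DurableGoods

/-! ## The program for the insertion of an edge

Arrays: `8` the number of vertices, `20` the matrix of all edge weights, `21` the weights of the
edges inserted so far, `22` the current circulation, `23` the potentials, `24` the labels and `25`
the pointers of the search, `26` its failure flag, `27`, `28`, `29` the reduced cost and the ends of
the best candidate, `30` the current vertex of the augmentation. The counters `10` and `11` hold the
ends of the edge that is inserted. -/

open LoopProgram

/-- The content of cell `(0, 0)` of array `a`. -/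
def scalar (a : ℕ) : Expr := .get a (.lit 0) (.lit 0)

/-- The content of cell `(u, 0)` of array `a`. -/
def vec (a : ℕ) (u : Expr) : Expr := .get a u (.lit 0)

/-- Assignment to cell `(0, 0)` of array `a`. -/
def setScalar (a : ℕ) (e : Expr) : LoopProgram := .set a (.lit 0) (.lit 0) e

/-- Assignment to cell `(u, 0)` of array `a`. -/
def setVec (a : ℕ) (u e : Expr) : LoopProgram := .set a u (.lit 0) e

theorem eval_scalar (s : Store) (a : ℕ) : (scalar a).eval s = s a 0 0 := rfl

theorem eval_vec (s : Store) (a : ℕ) (u : Expr) : (vec a u).eval s = s a (u.eval s) 0 := rfl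

theorem eval_get (s : Store) (a : ℕ) (u v : Expr) :
    (Expr.get a u v).eval s = s a (u.eval s) (v.eval s) := rfl

theorem exec_seq (P Q : LoopProgram) (s : Store) : (seq P Q).exec s = Q.exec (P.exec s) := rfl

theorem exec_ite (b : Expr) (P Q : LoopProgram) (s : Store) :
    (LoopProgram.ite b P Q).exec s = branch (b.eval s) (P.exec s) (Q.exec s) := rfl

theorem exec_skip (s : Store) : skip.exec s = s := rfl

theorem exec_setScalar (s : Store) (a : ℕ) (e : Expr) :
    (setScalar a e).exec s = s.write a 0 0 (e.eval s) := rfl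

theorem exec_setVec (s : Store) (a : ℕ) (u e : Expr) :
    (setVec a u e).exec s = s.write a (u.eval s) 0 (e.eval s) := rfl

theorem exec_set (s : Store) (a : ℕ) (u v e : Expr) :
    (LoopProgram.set a u v e).exec s = s.write a (u.eval s) (v.eval s) (e.eval s) := rfl

theorem write_self (s : Store) (a u v w : ℕ) : s.write a u v w a = cellUpdate (s a) u v w := by
  funext x y
  simp [Store.write, cellUpdate]

theorem write_of_ne (s : Store) {a b : ℕ} (u v w : ℕ) (h : b ≠ a) : s.write a u v w b = s b := by
  funext x y
  simp [Store.write, h]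

theorem cellUpdate_vec (f : ℕ → ℕ → ℕ) (u w : ℕ) :
    (fun a => cellUpdate f u 0 w a 0) = fun a => if a = u then w else f a 0 := by
  funext a
  simp [cellUpdate]

/-- Replace the best candidate by the one from counter `13` to counter `14` if its reduced cost `e`
is smaller. -/
def offer (e : Expr) : LoopProgram :=
  .ite (.sub (scalar 27) e)
    (.seq (setScalar 27 e) (.seq (setScalar 28 (scalar 13))
      (.seq (setScalar 29 (scalar 14)) (setScalar 26 (.lit 0))))) .skip

/-- Offer the residual edges from counter `13` to counter `14`. -/
def examine : LoopProgram :=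
  .ite (vec 24 (scalar 13)) .skip
    (.ite (vec 24 (scalar 14))
      (.seq
        (.ite (.get 21 (scalar 13) (scalar 14))
          (.ite (.get 22 (scalar 13) (scalar 14)) .skip
            (offer (.sub (vec 23 (scalar 14))
              (.add (vec 23 (scalar 13)) (.get 21 (scalar 13) (scalar 14)))))) .skip)
        (.ite (.get 22 (scalar 14) (scalar 13))
          (offer (.sub (.add (vec 23 (scalar 14)) (.get 21 (scalar 14) (scalar 13)))
            (vec 23 (scalar 13)))) .skip))
      .skip)

/-- Find the best candidate. -/
def scan : LoopProgram := .for_ 13 (.for_ 14 examine)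

/-- The state of a search for a minimum over the set `S` of candidates: `B` is the initial bound. -/
structure MinState (S : ℕ → ℕ → ℕ → Prop) (B best x y g : ℕ) : Prop where
  none : g ≠ 0 → best = B
  some : g = 0 → best < B ∧ S x y best
  le : ∀ a b e, S a b e → best ≤ e

theorem MinState.mono {S S' : ℕ → ℕ → ℕ → Prop} {B best x y g : ℕ}
    (h : MinState S B best x y g) (hS : ∀ a b e, S a b e ↔ S' a b e) :
    MinState S' B best x y g :=
  ⟨h.none, fun hg => ⟨(h.some hg).1, (hS _ _ _).1 (h.some hg).2⟩,
    fun a b e he => h.le a b e ((hS _ _ _).2 he)⟩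

theorem MinState.le_bound {S : ℕ → ℕ → ℕ → Prop} {B best x y g : ℕ}
    (h : MinState S B best x y g) : best ≤ B := by
  by_cases hg : g = 0
  · exact (h.some hg).1.le
  · exact (h.none hg).le

/-- The search state as stored in the arrays `26` to `29`. -/
def MinStore (S : ℕ → ℕ → ℕ → Prop) (B : ℕ) (s : Store) : Prop :=
  MinState S B (s 27 0 0) (s 28 0 0) (s 29 0 0) (s 26 0 0)

theorem offer_spec {S : ℕ → ℕ → ℕ → Prop} {B : ℕ} {s : Store} (e : Expr)
    (h : MinStore S B s) :
    MinStore (fun a b c => S a b c ∨ (a = s 13 0 0 ∧ b = s 14 0 0 ∧ c = e.eval s)) B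
      ((offer e).exec s) := by
  have hB := h.le_bound
  unfold MinStore at h ⊢
  simp only [offer, exec, Expr.eval, scalar, setScalar]
  unfold branch
  split_ifs with hlt
  · refine ⟨h.none, fun hg => ⟨(h.some hg).1, Or.inl (h.some hg).2⟩, ?_⟩
    rintro a b c (hc | ⟨-, -, rfl⟩)
    · exact h.le a b c hc
    · omega
  · simp (disch := decide) only [write_self, write_of_ne, cellUpdate_self]
    refine ⟨fun hg => absurd rfl hg, fun _ => ⟨by omega, Or.inr ⟨rfl, rfl, rfl⟩⟩, ?_⟩
    rintro a b c (hc | ⟨-, -, rfl⟩)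
    · have := h.le a b c hc
      omega
    · exact le_rfl

/-- An ordered pair of vertices yields at most two candidates, the reversal of a used edge and an
unused edge; they are offered one after the other. -/
theorem examine_spec {S : ℕ → ℕ → ℕ → Prop} {B : ℕ} {s : Store} (h : MinStore S B s) :
    MinStore (fun a b e => S a b e ∨ (a = s 13 0 0 ∧ b = s 14 0 0 ∧
      Candidate (s 21) (s 22) (fun x => s 23 x 0) (fun x => s 24 x 0) a b e)) B
      (examine.exec s) := by
  have h0 : ∀ {Q : ℕ → ℕ → ℕ → Prop}, (∀ e, ¬ Q (s 13 0 0) (s 14 0 0) e) →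
      MinStore (fun a b e => S a b e ∨ (a = s 13 0 0 ∧ b = s 14 0 0 ∧ Q a b e)) B s := by
    intro Q hQ
    refine h.mono fun a b e => ?_
    constructor
    · exact Or.inl
    · rintro (hS | ⟨rfl, rfl, hq⟩)
      · exact hS
      · exact absurd hq (hQ e)
  rw [examine, exec, exec, exec]
  simp only [Expr.eval, vec, scalar]
  unfold branch
  split_ifs with h1 h2
  · exact h0 fun e he => he.2.1 h2
  · set s' := LoopProgram.exec (LoopProgram.ite (.get 21 (scalar 13) (scalar 14))
          (.ite (.get 22 (scalar 13) (scalar 14)) .skip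
            (offer (.sub (vec 23 (scalar 14))
              (.add (vec 23 (scalar 13)) (.get 21 (scalar 13) (scalar 14)))))) .skip) s with hs'
    have hfr : ∀ b, b ∉ [27, 28, 29, 26] → s' b = s b := by
      intro b hb
      rw [hs']
      refine exec_frame _ _ ?_
      simpa [writes, offer, setScalar] using hb
    have step1 : MinStore (fun a b e => S a b e ∨ (a = s 13 0 0 ∧ b = s 14 0 0 ∧
        (s 21 a b ≠ 0 ∧ s 22 a b = 0 ∧ e = s 23 b 0 - (s 23 a 0 + s 21 a b)))) B s' := by
      simp only [hs', exec, Expr.eval, vec, scalar]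
      unfold branch
      split_ifs with h3 h4
      · exact h0 fun e he => he.1 h3
      · refine (offer_spec _ h).mono fun a b e => ?_
        simp only [Expr.eval]
        constructor
        · rintro (hS | ⟨rfl, rfl, rfl⟩)
          · exact Or.inl hS
          · exact Or.inr ⟨rfl, rfl, h3, h4, rfl⟩
        · rintro (hS | ⟨rfl, rfl, -, -, rfl⟩)
          · exact Or.inl hS
          · exact Or.inr ⟨rfl, rfl, rfl⟩
      · exact h0 fun e he => h4 he.2.1
    have e13 := hfr 13 (by decide)
    have e14 := hfr 14 (by decide)
    have e21 := hfr 21 (by decide)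
    have e22 := hfr 22 (by decide)
    have e23 := hfr 23 (by decide)
    change MinStore _ B (LoopProgram.exec _ s')
    rw [exec]
    simp only [Expr.eval, e13, e14, e22]
    unfold branch
    split_ifs with h3
    · refine step1.mono fun a b e => or_congr_right ?_
      refine and_congr_right fun ha => and_congr_right fun hb => ?_
      subst ha hb
      simp [Candidate, h1, h2, h3]
    · refine (offer_spec _ step1).mono fun a b e => ?_
      simp only [Expr.eval, e13, e14, e21, e23, or_assoc]
      refine or_congr_right ?_
      constructor
      · rintro (⟨rfl, rfl, hq⟩ | ⟨rfl, rfl, rfl⟩)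
        · exact ⟨rfl, rfl, h1, h2, Or.inl hq⟩
        · exact ⟨rfl, rfl, h1, h2, Or.inr ⟨h3, rfl⟩⟩
      · rintro ⟨rfl, rfl, -, -, hq | ⟨-, rfl⟩⟩
        · exact Or.inl ⟨rfl, rfl, hq⟩
        · exact Or.inr ⟨rfl, rfl, rfl⟩
  · exact h0 fun e he => h1 he.1

/-- The loops visit only vertices below the loop length; `hC` guarantees that no candidate is
missed. -/
theorem scan_spec {B : ℕ} {s : Store}
    (hC : ∀ a b e, Candidate (s 21) (s 22) (fun x => s 23 x 0) (fun x => s 24 x 0) a b e →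
      a < s 8 0 0 ∧ b < s 8 0 0) (h : MinStore (fun _ _ _ => False) B s) :
    MinStore (Candidate (s 21) (s 22) (fun x => s 23 x 0) (fun x => s 24 x 0)) B
      (scan.exec s) := by
  set Q := Candidate (s 21) (s 22) (fun x => s 23 x 0) (fun x => s 24 x 0) with hQ
  have main := exec_for (a := 13) (P := .for_ 14 examine) (s := s)
    (fun k s' => MinStore (fun a b e => a < k ∧ Q a b e) B s')
    (fun k s s' hs h => by simpa (disch := decide) only [MinStore, hs] using h)
    (h.mono (by simp)) (by
      intro k s₁ hk hs₁ hk₁ hI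
      have inner := exec_for (a := 14) (P := examine) (s := s₁)
        (fun k' s' => MinStore (fun a b e => (a < k ∧ Q a b e) ∨ (a = k ∧ b < k' ∧ Q a b e)) B s')
        (fun k s s' hs h => by simpa (disch := decide) only [MinStore, hs] using h)
        (hI.mono (by simp)) (by
          intro k' s₂ hk' hs₂ hk₂ hI₂
          have e13 : s₂ 13 0 0 = k := by rw [hs₂ 13 (by decide), hk₁]
          have e : ∀ b, b ∉ [13, 14, 27, 28, 29, 26] → s₂ b = s b := by
            intro b hb
            have hb' : b ∉ 14 :: examine.writes := by
              simp [writes, examine, offer, setScalar] at hb ⊢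
              tauto
            rw [hs₂ b hb', hs₁ b]
            simp only [writes, List.mem_cons] at hb hb' ⊢
            tauto
          refine (examine_spec hI₂).mono fun a b c => ?_
          rw [e13, hk₂, e 21 (by decide), e 22 (by decide), e 23 (by decide), e 24 (by decide),
            or_assoc]
          refine or_congr_right ?_
          rw [← hQ]
          constructor
          · rintro (⟨h1, h2, h3⟩ | ⟨rfl, rfl, h3⟩)
            · exact ⟨h1, by omega, h3⟩
            · exact ⟨rfl, by omega, h3⟩
          · rintro ⟨h1, h2, h3⟩
            rcases Nat.lt_succ_iff_lt_or_eq.1 h2 with h2 | h2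
            · exact Or.inl ⟨h1, h2, h3⟩
            · exact Or.inr ⟨h1, h2, h3⟩)
      have e8 : s₁ 8 = s 8 := hs₁ 8 (by decide)
      rw [e8] at inner
      refine inner.mono fun a b e => ?_
      constructor
      · rintro (⟨h1, h2⟩ | ⟨rfl, h1, h2⟩)
        · exact ⟨by omega, h2⟩
        · exact ⟨by omega, h2⟩
      · rintro ⟨h1, h2⟩
        rcases Nat.lt_succ_iff_lt_or_eq.1 h1 with h1 | h1
        · exact Or.inl ⟨h1, h2⟩
        · exact Or.inr ⟨h1, (hC _ _ _ h2).2, h2⟩)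
  refine main.mono fun a b e => ⟨fun h => h.2, fun h => ⟨(hC _ _ _ h).1, h⟩⟩

/-- Raise the potentials of the vertices without label. -/
def raiseAll : LoopProgram :=
  .for_ 13 (.ite (vec 24 (scalar 13)) .skip
    (setVec 23 (scalar 13) (.add (vec 23 (scalar 13)) (scalar 27))))

theorem raiseAll_spec (s : Store) : (fun a => raiseAll.exec s 23 a 0)
    = raise (s 8 0 0) (fun a => s 23 a 0) (fun a => s 24 a 0) (s 27 0 0) := by
  refine exec_for (fun k s' => (fun a => s' 23 a 0)
    = raise k (fun a => s 23 a 0) (fun a => s 24 a 0) (s 27 0 0))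
    (fun k s s' hs h => by simpa (disch := decide) only [hs] using h)
    (by funext a; simp [raise]) ?_
  intro k s₁ hk hs₁ hk₁ hI
  have hI' : ∀ a, s₁ 23 a 0 = _ := fun a => congrFun hI a
  have e24 : s₁ 24 = s 24 := hs₁ 24 (by decide)
  have e27 : s₁ 27 = s 27 := hs₁ 27 (by decide)
  simp only [exec, Expr.eval, vec, scalar, setVec, hk₁, e24, e27]
  unfold branch
  split_ifs with h1
  · rw [write_self, cellUpdate_vec]
    funext a
    by_cases ha : a = k
    · subst ha
      simp [hI', raise, h1]
    · have : a < k + 1 ↔ a < k := by omega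
      simp [hI', raise, ha, this]
  · funext a
    by_cases ha : a = k
    · subst ha
      simp [hI', raise, h1]
    · have : a < k + 1 ↔ a < k := by omega
      simp [hI', raise, this]

end DurableGoods

namespace DurableGoods

open LoopProgram

/-! ### Search, augmentation and insertion as programs -/

/-- Label the first vertex of the best candidate. -/
def recordCandidate : LoopProgram :=
  .seq (setVec 24 (scalar 28) (.add (scalar 12) (.lit 2))) (setVec 25 (scalar 28) (scalar 29))

theorem recordCandidate_exec (s : Store) : recordCandidate.exec s
    = (s.write 24 (s 28 0 0) 0 (s 12 0 0 + 2)).write 25 (s 28 0 0) 0 (s 29 0 0) := by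
  simp (disch := decide) only [recordCandidate, exec_seq, exec_setVec, eval_scalar, Expr.eval,
    write_of_ne]

/-- One round of the search; counter `12` holds the number of the round. -/
def searchRound : LoopProgram :=
  .ite (vec 24 (scalar 11)) .skip (.ite (scalar 26) .skip
    -- The initial bound of the minimum search is the raise at which the new edge may stay unused;
    -- the flag `1` set next means that no candidate has beaten it.
    (.seq (setScalar 27 (.sub (.add (.get 20 (scalar 10) (scalar 11)) (vec 23 (scalar 10)))
      (vec 23 (scalar 11))))
    (.seq (setScalar 26 (.lit 1))
    (.seq scan
    (.seq raiseAll
      (.ite (scalar 26) .skip recordCandidate))))))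

/-- The search state as stored in the arrays `21` to `26`. -/
def SearchStore (k : ℕ) (s : Store) : Prop :=
  Search (s 8 0 0) (s 21) (s 22) (s 10 0 0) (s 11 0 0) (s 20 (s 10 0 0) (s 11 0 0))
    (fun a => s 23 a 0) (fun a => s 24 a 0) (fun a => s 25 a 0) (s 26 0 0) k

/-- After the scan array `27` holds the smaller of the initial bound and the least reduced cost. The
flag tells which of `Search.fail_step` and `Search.grow_step` applies. -/
theorem searchRound_spec {s : Store} {k : ℕ} (hW : IsGraph (s 8 0 0) (s 21))
    (hv : s 11 0 0 < s 8 0 0) (hk : s 12 0 0 = k) (h : SearchStore k s) :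
    SearchStore (k + 1) (searchRound.exec s) := by
  simp only [searchRound, exec_seq, exec_ite, exec_skip, eval_scalar, eval_vec]
  by_cases h1 : s 24 (s 11 0 0) 0 = 0
  swap
  · rw [branch_of_ne h1]
    exact h.idle (Or.inl h1)
  by_cases h2 : s 26 0 0 = 0
  swap
  · rw [branch_of_eq h1, branch_of_ne h2]
    exact h.idle (Or.inr h2)
  rw [branch_of_eq h1, branch_of_eq h2]
  set s₁ := (setScalar 26 (.lit 1)).exec ((setScalar 27 (.sub (.add (.get 20 (scalar 10) (scalar 11))
      (vec 23 (scalar 10))) (vec 23 (scalar 11)))).exec s) with hs₁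
  set B := s 20 (s 10 0 0) (s 11 0 0) + s 23 (s 10 0 0) 0 - s 23 (s 11 0 0) 0 with hB
  have f₁ : ∀ b, b ≠ 26 → b ≠ 27 → s₁ b = s b := by
    intro b hb hb'
    simp only [hs₁, setScalar, exec]
    rw [write_of_ne _ _ _ _ hb, write_of_ne _ _ _ _ hb']
  have c₁ : s₁ 27 0 0 = B := by
    simp (disch := decide) only [hs₁, setScalar, exec, Expr.eval, scalar, vec, write_of_ne,
      write_self, cellUpdate_self, hB]
  have d₁ : s₁ 26 0 0 = 1 := by
    simp (disch := decide) only [hs₁, setScalar, exec, Expr.eval,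
      write_self, cellUpdate_self]
  change SearchStore (k + 1) (branch (raiseAll.exec (scan.exec s₁) 26 0 0) _ _)
  set s₂ := scan.exec s₁ with hs₂
  set s₃ := raiseAll.exec s₂ with hs₃
  have f₂ : ∀ b, b ∉ scan.writes → s₂ b = s₁ b := fun b hb => exec_frame _ _ hb
  have f₃ : ∀ b, b ∉ raiseAll.writes → s₃ b = s₂ b := fun b hb => exec_frame _ _ hb
  have hC : ∀ a b e, Candidate (s 21) (s 22) (fun x => s 23 x 0) (fun x => s 24 x 0) a b e →
      a < s 8 0 0 ∧ b < s 8 0 0 := by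
    rintro a b e ⟨-, -, ⟨hw, -, -⟩ | ⟨hF, -⟩⟩
    · exact ⟨(hW a b hw).1, (hW a b hw).2.1⟩
    · have := hW b a (h.slack.used b a hF).2.1
      exact ⟨this.2.1, this.1⟩
  have g₁ : ∀ b, b ∉ [26, 27] → s₁ b = s b := by
    intro b hb
    simp only [List.mem_cons, List.not_mem_nil, or_false, not_or] at hb
    exact f₁ b hb.1 hb.2
  have hmin : MinStore (Candidate (s 21) (s 22) (fun x => s 23 x 0) (fun x => s 24 x 0)) B s₂ := by
    have := scan_spec (s := s₁) (B := B)
    simp (disch := decide) only [g₁] at this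
    refine this hC ⟨fun _ => c₁, fun hg => ?_, fun _ _ _ h => h.elim⟩
    rw [d₁] at hg
    exact absurd hg one_ne_zero
  have hp : (fun a => s₃ 23 a 0)
      = raise (s 8 0 0) (fun a => s 23 a 0) (fun a => s 24 a 0) (s₂ 27 0 0) := by
    rw [hs₃, raiseAll_spec, f₂ 8 (by decide), f₂ 23 (by decide), f₂ 24 (by decide),
      g₁ 8 (by decide), g₁ 23 (by decide), g₁ 24 (by decide)]
  have e : ∀ b, b ∉ [13, 14, 23, 26, 27, 28, 29] → s₃ b = s b := by
    intro b hb
    rw [f₃ b, f₂ b, g₁ b]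
    all_goals
      simp [raiseAll, scan, examine, offer, setScalar, setVec, writes] at hb ⊢
      tauto
  have e' : ∀ b, b ∉ [13, 23] → s₃ b = s₂ b := by
    intro b hb
    apply f₃
    simp [raiseAll, setVec, writes] at hb ⊢
    tauto
  unfold SearchStore at h
  have hg : s 26 0 0 = 0 := h2
  rw [hg] at h
  unfold branch
  split_ifs with h3
  · obtain ⟨m1, m2⟩ := hmin.some (by rw [← e' 26 (by decide)]; exact h3)
    rw [recordCandidate_exec, e 12 (by decide), hk, e' 28 (by decide), e' 29 (by decide)]
    unfold SearchStore
    simp (disch := decide) only [write_of_ne, e, write_self, cellUpdate_vec, hp, h3]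
    exact h.grow_step hW hv h1 hmin.le m1 m2 (fun x => rfl) (fun x => rfl)
  · have m1 := hmin.none (by rw [← e' 26 (by decide)]; exact h3)
    unfold SearchStore
    simp (disch := decide) only [e, hp]
    exact h.fail_step hW hv h1 hmin.le m1 h3

/-- Search for a tight residual path, raising the potentials. -/
def search : LoopProgram :=
  .seq (.for_ 13 (setVec 24 (scalar 13) (.lit 0)))
  (.seq (setVec 24 (scalar 10) (.lit 1))
  (.seq (setScalar 26 (.lit 0)) (.for_ 12 searchRound)))

theorem search_spec {s : Store} (hW : IsGraph (s 8 0 0) (s 21)) (hu : s 10 0 0 < s 8 0 0)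
    (hv : s 11 0 0 < s 8 0 0) (huv : s 10 0 0 ≠ s 11 0 0)
    (h : Slack (s 21) (s 22) (fun a => s 23 a 0)) :
    SearchStore (s 8 0 0) (search.exec s) := by
  rw [search, exec, exec, exec]
  set s₁ := (for_ 13 (setVec 24 (scalar 13) (.lit 0))).exec s with hs₁
  have h₁ : ∀ a < s 8 0 0, s₁ 24 a 0 = 0 := by
    refine exec_for (fun k s' => ∀ a < k, s' 24 a 0 = 0)
      (fun k s s' hs h => by simpa (disch := decide) only [hs] using h)
      (fun a ha => absurd ha (Nat.not_lt_zero a)) ?_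
    intro k s' hk hs' hk' hI a ha
    simp only [setVec, exec, Expr.eval, scalar, hk', write_self, cellUpdate, and_true]
    split_ifs with hak
    · rfl
    · exact hI a (by omega)
  have e₁ : ∀ b, b ∉ [13, 24] → s₁ b = s b := fun b hb => exec_frame _ _ hb
  set s₂ := (setScalar 26 (.lit 0)).exec ((setVec 24 (scalar 10) (.lit 1)).exec s₁) with hs₂
  have e₂ : ∀ b, b ∉ [13, 24, 26] → s₂ b = s b := by
    intro b hb
    rw [hs₂, exec_frame, exec_frame, e₁]
    all_goals
      simp [writes, setScalar, setVec] at hb ⊢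
      tauto
  have h₂ : SearchStore 0 s₂ := by
    have g : s₂ 26 0 0 = 0 := by
      simp only [hs₂, setScalar, exec, write_self, Expr.eval, cellUpdate_self]
    unfold SearchStore
    simp (disch := decide) only [e₂, g]
    refine Search.start h hu hv huv fun a ha => ?_
    simp (disch := decide) only [hs₂, setVec, setScalar, exec, Expr.eval, scalar, write_of_ne,
      write_self, e₁, cellUpdate, and_true, h₁ a ha]
  have := exec_for (a := 12) (P := searchRound) (s := s₂) (fun k s' => SearchStore k s')
    (fun k s s' hs h => by simpa (disch := decide) only [SearchStore, hs] using h) h₂ (by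
      intro k s₃ hk hs₃ hk₃ hI
      have e₃ : ∀ b, b ∉ [12, 13, 14, 23, 24, 25, 26, 27, 28, 29] → s₃ b = s b := by
        intro b hb
        rw [hs₃, e₂]
        all_goals
          simp [searchRound, recordCandidate, raiseAll, scan, examine, offer, writes, setScalar, setVec] at hb ⊢
          tauto
      refine searchRound_spec ?_ ?_ hk₃ hI
      · simpa (disch := decide) only [e₃] using hW
      · simpa (disch := decide) only [e₃] using hv)
  rwa [e₂ 8 (by decide)] at this

/-- One step of the augmentation. -/
def augmentStep : LoopProgram :=
  -- With truncated subtraction, the sum of both differences vanishes exactly when the current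
  -- vertex is `u`.
  .ite (.add (.sub (scalar 30) (scalar 10)) (.sub (scalar 10) (scalar 30)))
    (.seq
      (.ite (.get 22 (vec 25 (scalar 30)) (scalar 30))
        (.set 22 (vec 25 (scalar 30)) (scalar 30) (.lit 0))
        (.set 22 (scalar 30) (vec 25 (scalar 30)) (.lit 1)))
      (setScalar 30 (vec 25 (scalar 30)))) .skip

/-- Insert the edge joining the counters `10` and `11`. -/
def insertEdge : LoopProgram :=
  .seq search
  (.seq (.set 21 (scalar 10) (scalar 11) (.get 20 (scalar 10) (scalar 11)))
    (.ite (scalar 26) .skip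
      (.seq (.set 22 (scalar 10) (scalar 11) (.lit 1))
      (.seq (setScalar 30 (scalar 11)) (.for_ 12 augmentStep)))))

/-- The state of the augmentation as stored in the arrays `21` to `25` and `30`. -/
def AugmentStore (k : ℕ) (s : Store) : Prop :=
  Augment (s 8 0 0) (s 21) (s 22) (s 10 0 0) (fun a => s 23 a 0) (fun a => s 24 a 0)
    (fun a => s 25 a 0) (s 30 0 0) k

theorem augmentStep_spec {s : Store} {k : ℕ} (hW : IsGraph (s 8 0 0) (s 21))
    (h : AugmentStore k s) : AugmentStore (k + 1) (augmentStep.exec s) := by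
  rw [augmentStep, exec, exec, exec, exec]
  simp only [Expr.eval, scalar, vec]
  unfold branch
  split_ifs with h1 h2
  · exact h.idle (by omega)
  all_goals
    have := h.step hW (by omega)
    unfold toggle at this
    simp only [h2, ne_eq, not_true_eq_false, not_false_eq_true, if_true, if_false] at this
    unfold AugmentStore
    simpa (disch := decide) only [setScalar, exec, Expr.eval, write_of_ne, write_self,
      cellUpdate_self] using this

/-- The edges inserted so far, the current circulation and the potentials. -/
structure CirculationStore (s : Store) : Prop where
  slack : Slack (s 21) (s 22) (fun a => s 23 a 0)
  balanced : ∀ c, outSum (s 8 0 0) (s 22) c = inSum (s 8 0 0) (s 22) c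

/-- Either the search fails and the potentials certify the old circulation for the larger graph
(`Search.reject`), or the circulation is augmented through the new edge (`Augment.finish`). -/
theorem insertEdge_spec {s : Store} (hW : IsGraph (s 8 0 0) (s 20)) (hsub : ∀ x y, s 21 x y ≠ 0 →
      s 21 x y = s 20 x y) (hw : s 20 (s 10 0 0) (s 11 0 0) ≠ 0)
    (h0 : s 21 (s 10 0 0) (s 11 0 0) = 0) (h : CirculationStore s) :
    CirculationStore (insertEdge.exec s) ∧ insertEdge.exec s 21
      = cellUpdate (s 21) (s 10 0 0) (s 11 0 0) (s 20 (s 10 0 0) (s 11 0 0)) := by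
  have hW' : IsGraph (s 8 0 0) (s 21) := by
    intro x y hxy
    obtain ⟨hx, hy, h1⟩ := hW x y (hsub x y hxy ▸ hxy)
    refine ⟨hx, hy, ?_⟩
    by_contra hyx
    exact hyx (hsub y x hyx ▸ h1)
  obtain ⟨hu, hv, hvu⟩ := hW _ _ hw
  have huv : s 10 0 0 ≠ s 11 0 0 := by
    intro huv
    rw [huv] at hw hvu
    exact hw hvu
  have hS := search_spec hW' hu hv huv h.slack
  simp only [insertEdge, exec_seq, exec_ite, exec_skip]
  set s₁ := search.exec s with hs₁
  have e₁ : ∀ b, b ∉ [12, 13, 14, 23, 24, 25, 26, 27, 28, 29] → s₁ b = s b := by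
    intro b hb
    rw [hs₁, exec_frame]
    simp [search, searchRound, recordCandidate, raiseAll, scan, examine, offer, writes, setScalar, setVec] at hb ⊢
    tauto
  set u := s 10 0 0 with hu'
  set v := s 11 0 0 with hv'
  set w := s 20 u v with hw'
  set V := s 8 0 0 with hV
  have hset : LoopProgram.exec (.set 21 (scalar 10) (scalar 11) (.get 20 (scalar 10) (scalar 11))) s₁
      = s₁.write 21 u v w := by
    simp (disch := decide) only [exec, Expr.eval, scalar, e₁]
    rfl
  rw [hset]
  set s₂ := s₁.write 21 u v w with hs₂
  have e₂ : ∀ b, b ≠ 21 → s₂ b = s₁ b := fun b hb => write_of_ne _ _ _ _ hb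
  have e₂' : ∀ b, b ∉ [12, 13, 14, 21, 23, 24, 25, 26, 27, 28, 29] → s₂ b = s b := by
    intro b hb
    rw [e₂, e₁]
    all_goals
      simp at hb ⊢
      tauto
  have h21 : s₂ 21 = cellUpdate (s 21) u v w := by
    rw [hs₂, write_self, e₁ 21 (by decide)]
  have hW₂ : IsGraph V (cellUpdate (s 21) u v w) := by
    have key : ∀ x y, cellUpdate (s 21) u v w x y ≠ 0 → cellUpdate (s 21) u v w x y = s 20 x y := by
      intro x y hxy
      by_cases hc : x = u ∧ y = v
      · rw [hc.1, hc.2, cellUpdate_self]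
      · rw [cellUpdate_of_ne _ _ (by tauto)] at hxy ⊢
        exact hsub x y hxy
    intro x y hxy
    obtain ⟨hx, hy, h1⟩ := hW x y (key x y hxy ▸ hxy)
    refine ⟨hx, hy, ?_⟩
    by_contra hyx
    exact hyx (key y x hyx ▸ h1)
  unfold SearchStore at hS
  simp (disch := decide) only [e₁] at hS
  simp only [eval_scalar, e₂ 26 (by decide)]
  unfold branch
  split_ifs with hg
  · rw [hg] at hS
    have hA := hS.augment h.balanced hu hv hw h0
    set s₃ := (setScalar 30 (scalar 11)).exec
      ((LoopProgram.set 22 (scalar 10) (scalar 11) (.lit 1)).exec s₂)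
      with hs₃
    have hs₃' : s₃ = (s₂.write 22 u v 1).write 30 0 0 v := by
      simp (disch := decide) only [hs₃, exec_setScalar, exec_set, eval_scalar, Expr.eval, write_of_ne,
        e₂']
      rfl
    have hA₃ : AugmentStore 0 s₃ := by
      unfold AugmentStore
      rw [hs₃']
      simp (disch := decide) only [write_of_ne, e₂', write_self, h21, cellUpdate_self]
      simp (disch := decide) only [e₂]
      exact hA
    have e₃ : ∀ b, b ∉ [22, 30] → s₃ b = s₂ b := by
      intro b hb
      simp at hb
      rw [hs₃', write_of_ne _ _ _ _ hb.2, write_of_ne _ _ _ _ hb.1]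
    have e₈ : s₃ 8 0 0 = V := by rw [e₃ 8 (by decide), e₂' 8 (by decide)]
    have hfin := exec_for (a := 12) (P := augmentStep) (s := s₃) (fun k s' => AugmentStore k s')
      (fun k s s' hs h => by simpa (disch := decide) only [AugmentStore, hs] using h) hA₃ (by
        intro k s₄ hk hs₄ hk₄ hI
        refine augmentStep_spec ?_ hI
        rw [hs₄ 8 (by decide), hs₄ 21 (by decide), e₈, e₃ 21 (by decide), h21]
        exact hW₂)
    rw [e₈] at hfin
    set s₅ := (for_ 12 augmentStep).exec s₃ with hs₅
    have e₅ : ∀ b, b ∉ [12, 22, 30] → s₅ b = s₃ b := by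
      intro b hb
      rw [hs₅, exec_frame]
      simp [augmentStep, writes, setScalar] at hb ⊢
      tauto
    refine ⟨⟨hfin.slack, ?_⟩, ?_⟩
    · have h8 : s₅ 8 0 0 = V := by rw [e₅ 8 (by decide), e₈]
      have hfin' := hfin
      unfold AugmentStore at hfin'
      rw [h8] at hfin'
      change ∀ c, outSum (s₅ 8 0 0) (s₅ 22) c = inSum (s₅ 8 0 0) (s₅ 22) c
      rw [h8]
      exact hfin'.finish
    · rw [e₅ 21 (by decide), e₃ 21 (by decide), h21]
  · refine ⟨⟨?_, ?_⟩, h21⟩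
    · rw [h21, e₂' 22 (by decide), e₂ 23 (by decide)]
      exact hS.reject hg h0
    · rw [e₂' 22 (by decide), e₂' 8 (by decide)]
      exact h.balanced

/-- Compute a circulation of maximum weight by inserting all edges. -/
def maxCirculation : LoopProgram :=
  .for_ 10 (.for_ 11 (.ite (.get 20 (scalar 10) (scalar 11)) insertEdge .skip))

/-- For the empty graph any potentials certify the zero circulation; then the insertions preserve
the certificate. -/
theorem maxCirculation_spec {s : Store} (hW : IsGraph (s 8 0 0) (s 20))
    (h21 : s 21 = fun _ _ => 0) (h22 : s 22 = fun _ _ => 0) :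
    Slack (s 20) (maxCirculation.exec s 22) (fun a => maxCirculation.exec s 23 a 0) ∧
      ∀ c, outSum (s 8 0 0) (maxCirculation.exec s 22) c
        = inSum (s 8 0 0) (maxCirculation.exec s 22) c := by
  have hfr : ∀ b, b ∈ [8, 20] → b ∉ maxCirculation.writes := by decide
  have main := exec_for (a := 10) (P := .for_ 11 (.ite (.get 20 (scalar 10) (scalar 11))
      insertEdge .skip)) (s := s)
    (fun k s' => CirculationStore s' ∧ ∀ x y, s' 21 x y = if x < k then s 20 x y else 0)
    (fun k s s' hs h => ⟨⟨by simpa (disch := decide) only [hs] using h.1.slack,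
      by simpa (disch := decide) only [hs] using h.1.balanced⟩,
      by simpa (disch := decide) only [hs] using h.2⟩)
    ⟨⟨⟨by simp [h22], by simp [h21]⟩, by simp [h22, outSum, inSum]⟩, by simp [h21]⟩ (by
    intro u s₁ hu hs₁ hk₁ hI
    have e₁ : ∀ b, b ∈ [8, 20] → s₁ b = s b := fun b hb => hs₁ b (hfr b hb)
    have inner := exec_for (a := 11) (P := .ite (.get 20 (scalar 10) (scalar 11))
        insertEdge .skip) (s := s₁)
      (fun k s' => CirculationStore s' ∧
        ∀ x y, s' 21 x y = if x < u ∨ (x = u ∧ y < k) then s 20 x y else 0)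
      (fun k s s' hs h => ⟨⟨by simpa (disch := decide) only [hs] using h.1.slack,
        by simpa (disch := decide) only [hs] using h.1.balanced⟩,
        by simpa (disch := decide) only [hs] using h.2⟩)
      ⟨hI.1, by simpa using hI.2⟩ (by
      intro v s₂ hv hs₂ hk₂ hI₂
      have e₂ : ∀ b, b ∈ [8, 10, 20] → s₂ b = s₁ b := by
        intro b hb
        refine hs₂ b ?_
        revert b
        decide
      have e20 : s₂ 20 = s 20 := (e₂ 20 (by decide)).trans (e₁ 20 (by decide))
      have e8 : s₂ 8 = s 8 := (e₂ 8 (by decide)).trans (e₁ 8 (by decide))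
      have e10 : s₂ 10 0 0 = u := by rw [e₂ 10 (by decide), hk₁]
      rw [exec]
      simp only [Expr.eval, scalar, e20, e10, hk₂]
      unfold branch
      -- Pairs are inserted in lexicographic order, and those of weight `0` change nothing.
      have hnew : ∀ x y, (if x < u ∨ (x = u ∧ y < v + 1) then s 20 x y else 0)
          = cellUpdate (s₂ 21) u v (s 20 u v) x y := by
        intro x y
        by_cases hc : x = u ∧ y = v
        · rw [hc.1, hc.2, cellUpdate_self, if_pos (by omega)]
        · rw [cellUpdate_of_ne _ _ (by tauto), hI₂.2]
          have : (x < u ∨ (x = u ∧ y < v + 1)) ↔ (x < u ∨ (x = u ∧ y < v)) := by omega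
          simp only [this]
      have h21uv : s₂ 21 u v = 0 := by
        rw [hI₂.2, if_neg (by omega)]
      split_ifs with h0
      · refine ⟨hI₂.1, fun x y => ?_⟩
        rw [hnew, h0]
        by_cases hc : x = u ∧ y = v
        · rw [hc.1, hc.2, cellUpdate_self]
          exact h21uv
        · rw [cellUpdate_of_ne _ _ (by tauto)]
          rfl
      · have := insertEdge_spec (s := s₂) (by rwa [e8, e20]) (by
          intro x y hxy
          rw [e20]
          rw [hI₂.2] at hxy ⊢
          split_ifs at hxy ⊢
          · rfl
          · exact absurd rfl hxy) (by rwa [e20, e10, hk₂]) (by rwa [e10, hk₂]) hI₂.1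
        refine ⟨this.1, fun x y => ?_⟩
        rw [hnew, this.2, e10, hk₂, e20])
    refine ⟨inner.1, fun x y => ?_⟩
    rw [inner.2, e₁ 8 (by decide)]
    by_cases h0 : s 20 x y = 0
    · simp [h0]
    · have := (hW x y h0).2.1
      have : (x < u ∨ (x = u ∧ y < s 8 0 0)) ↔ x < u + 1 := by omega
      simp only [this])
  obtain ⟨m1, m2⟩ := main
  have h20 : maxCirculation.exec s 21 = s 20 := by
    funext x y
    refine (m2 x y).trans ?_
    by_cases h0 : s 20 x y = 0
    · simp [h0]
    · rw [if_pos (hW x y h0).1]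
  have h8 : maxCirculation.exec s 8 = s 8 := exec_frame _ _ (hfr 8 (by decide))
  have hs := m1.slack
  have hb := m1.balanced
  change Slack (maxCirculation.exec s 21) _ _ at hs
  change ∀ c, outSum (maxCirculation.exec s 8 0 0) (maxCirculation.exec s 22) c
    = inSum (maxCirculation.exec s 8 0 0) (maxCirculation.exec s 22) c at hb
  rw [h20] at hs
  rw [h8] at hb
  exact ⟨hs, hb⟩

end DurableGoods

namespace DurableGoods

/-! ## Decomposition of a circulation into cycles -/

section Decomposition

variable {n m : ℕ}

/-- The number of a vertex: the items are counted after the agents. -/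
def vertexCode : Fin n ⊕ Fin m → ℕ
  | Sum.inl i => i
  | Sum.inr j => n + j

theorem vertexCode_lt (v : Fin n ⊕ Fin m) : vertexCode v < n + m := by
  rcases v with i | j
  · exact i.2.trans_le (Nat.le_add_right n m)
  · exact Nat.add_lt_add_left j.2 n

theorem vertexCode_injective : Function.Injective (vertexCode : Fin n ⊕ Fin m → ℕ) := by
  rintro (i | j) (i' | j') h <;> simp only [vertexCode] at h
  · rw [Fin.ext h]
  · have := i.2; omega
  · have := i'.2; omega
  · rw [Fin.ext (Nat.add_left_cancel h)]

theorem edge_ext {N M : Type*} {e e' : Edge N M} (h1 : e.src = e'.src) (h2 : e.tgt = e'.tgt) :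
    e = e' := by
  cases e <;> cases e' <;> simp_all [Edge.src, Edge.tgt]

/-- `F` is the matrix of the balanced set of edges `R`. -/
structure FlowMatrix (F : ℕ → ℕ → ℕ) (R : Finset (Edge (Fin n) (Fin m))) : Prop where
  one : ∀ x y, F x y ≠ 0 → F x y = 1
  mem : ∀ e, e ∈ R ↔ F (vertexCode e.src) (vertexCode e.tgt) ≠ 0
  exists_edge : ∀ x y, F x y ≠ 0 → ∃ e : Edge (Fin n) (Fin m),
    x = vertexCode e.src ∧ y = vertexCode e.tgt
  balanced : ∀ c, outSum (n + m) F c = inSum (n + m) F c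

theorem FlowMatrix.exists_out {F : ℕ → ℕ → ℕ} {R : Finset (Edge (Fin n) (Fin m))}
    (h : FlowMatrix F R) {x y : ℕ} (hxy : F x y ≠ 0) : ∃ z, F y z ≠ 0 := by
  by_contra hcon
  push Not at hcon
  have h1 : inSum (n + m) F y = 0 := by
    rw [← h.balanced]
    exact Finset.sum_eq_zero fun z _ => hcon z
  obtain ⟨e, hx, -⟩ := h.exists_edge x y hxy
  have := Finset.sum_eq_zero_iff.1 h1 x (Finset.mem_range.2 (hx ▸ vertexCode_lt _))
  exact hxy this

theorem FlowMatrix.bipartite {F : ℕ → ℕ → ℕ} {R : Finset (Edge (Fin n) (Fin m))}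
    (h : FlowMatrix F R) {x y : ℕ} (hxy : F x y ≠ 0) :
    (x < n ∧ n ≤ y ∧ y < n + m) ∨ (n ≤ x ∧ x < n + m ∧ y < n) := by
  obtain ⟨e, rfl, rfl⟩ := h.exists_edge x y hxy
  cases e with
  | dem i j =>
    have := i.2
    have := j.2
    simp only [Edge.src, Edge.tgt, vertexCode]
    omega
  | sup j i =>
    have := i.2
    have := j.2
    simp only [Edge.src, Edge.tgt, vertexCode]
    omega

/-- Bounds the number of rounds needed by the decomposition, as each extracted cycle removes an
edge. -/
theorem FlowMatrix.card_le {F : ℕ → ℕ → ℕ} {R : Finset (Edge (Fin n) (Fin m))}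
    (_h : FlowMatrix F R) : R.card ≤ (n + m) * (n + m) := by
  have := Finset.card_le_card_of_injOn (s := R) (t := Finset.range (n + m) ×ˢ Finset.range (n + m))
    (fun e => (vertexCode e.src, vertexCode e.tgt))
    (fun e _ => by simp [vertexCode_lt]) (fun e _ e' _ h => by
      simp only [Prod.mk.injEq] at h
      exact edge_ext (vertexCode_injective h.1) (vertexCode_injective h.2))
  simpa using this

/-- The agents `z 0, …, z P = z 0` of a cycle in `F`, where `q` maps each vertex of the cycle to the
next one. -/
structure CyclePath (n m : ℕ) (F : ℕ → ℕ → ℕ) (q z : ℕ → ℕ) (P : ℕ) : Prop where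
  pos : 0 < P
  le : P ≤ n + m
  agent : ∀ s, z s < n
  item : ∀ s, n ≤ q (z s) ∧ q (z s) < n + m
  dem : ∀ s, F (z s) (q (z s)) = 1
  sup : ∀ s, F (q (z s)) (z (s + 1)) = 1
  succ : ∀ s, z (s + 1) = q (q (z s))
  inj : ∀ a b, a < b → b ≤ P → z a = z b → a = 0 ∧ b = P
  closed : z P = z 0

/-- Two pointers lead from an agent to an agent. After `n + m` such double steps the walk has passed
any initial tail and runs on a cycle, whose length is the minimal period. -/
theorem FlowMatrix.cyclePath {F : ℕ → ℕ → ℕ} {R : Finset (Edge (Fin n) (Fin m))}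
    (h : FlowMatrix F R) {q : ℕ → ℕ} (hq : ∀ x y, F x y ≠ 0 → F x (q x) ≠ 0) {a : ℕ} (ha : a < n)
    (ha' : F a (q a) ≠ 0) :
    ∃ P, CyclePath n m F q (fun s => (fun x => q (q x))^[s] ((fun x => q (q x))^[n + m] a)) P := by
  set f : ℕ → ℕ := fun x => q (q x) with hf
  have step : ∀ x, x < n → F x (q x) ≠ 0 → f x < n ∧ F (f x) (q (f x)) ≠ 0 ∧
      F (q x) (f x) ≠ 0 ∧ n ≤ q x ∧ q x < n + m := by
    intro x hx hFx
    have h1 : n ≤ q x ∧ q x < n + m := by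
      rcases h.bipartite hFx with h | h <;> omega
    obtain ⟨y, hy⟩ := h.exists_out hFx
    have h2 : F (q x) (f x) ≠ 0 := hq _ _ hy
    obtain ⟨z, hz⟩ := h.exists_out h2
    have h3 : f x < n := by
      rcases h.bipartite h2 with h | h <;> omega
    exact ⟨h3, hq _ _ hz, h2, h1⟩
  have orbit : ∀ k, f^[k] a < n ∧ F (f^[k] a) (q (f^[k] a)) ≠ 0 := by
    intro k
    induction k with
    | zero => exact ⟨ha, ha'⟩
    | succ k ih =>
      rw [Function.iterate_succ_apply']
      exact ⟨(step _ ih.1 ih.2).1, (step _ ih.1 ih.2).2.1⟩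
  set z := fun s => f^[s] (f^[n + m] a) with hz
  have zorbit : ∀ s, z s = f^[s + (n + m)] a := fun s => (Function.iterate_add_apply f _ _ _).symm
  have zsucc : ∀ s, z (s + 1) = f (z s) := fun s => Function.iterate_succ_apply' f _ _
  have hper : z 0 ∈ Function.periodicPts f := by
    -- Among the first `n + 1` agents of the walk two coincide, so the later ones are periodic.
    obtain ⟨i, hi, j, hj, hij, heq⟩ := Finset.exists_ne_map_eq_of_card_lt_of_maps_to
      (s := Finset.range (n + 1)) (t := Finset.range n) (by simp) (f := fun k => f^[k] a)
      (fun k _ => by simpa using (orbit k).1)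
    have key : ∀ i j, i < j → j ≤ n → f^[i] a = f^[j] a → z 0 ∈ Function.periodicPts f := by
      intro i j hij hj heq
      refine ⟨j - i, by omega, ?_⟩
      change f^[j - i] (f^[n + m] a) = f^[n + m] a
      rw [← Function.iterate_add_apply]
      have e1 : j - i + (n + m) = (n + m - i) + j := by omega
      have e2 : n + m = (n + m - i) + i := by omega
      rw [e1, Function.iterate_add_apply, ← heq, ← Function.iterate_add_apply, ← e2]
    simp only [Finset.mem_range] at hi hj
    rcases Nat.lt_or_gt_of_ne hij with hlt | hlt
    · exact key i j hlt (by omega) heq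
    · exact key j i hlt (by omega) heq.symm
  have hzs : ∀ s, z s = f^[s] (z 0) := fun s => rfl
  have hclosed : z (Function.minimalPeriod f (z 0)) = z 0 :=
    Function.iterate_minimalPeriod
  have hpos := Function.minimalPeriod_pos_of_mem_periodicPts hper
  set P := Function.minimalPeriod f (z 0) with hP
  have hinj : ∀ a b, a < b → b ≤ P → z a = z b → a = 0 ∧ b = P := by
    intro a b hab hb heq
    -- A coincidence `z a = z b`, continued by `P - b` steps, is a return to the start after `P - b
    -- + a < P` steps, which minimality allows only for `0` steps.
    have h1 : z (P - b + a) = z 0 := by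
      have : z (P - b + b) = z 0 := by rw [Nat.sub_add_cancel hb, hclosed]
      rw [← this, hzs (P - b + a), hzs (P - b + b), Function.iterate_add_apply,
        Function.iterate_add_apply, ← hzs, ← hzs, heq]
    by_contra hcon
    have hlt : P - b + a < P := by omega
    exact Function.not_isPeriodicPt_of_pos_of_lt_minimalPeriod (by omega : P - b + a ≠ 0) hlt h1
  have hz1 : ∀ s, z s < n ∧ F (z s) (q (z s)) ≠ 0 := fun s => by rw [zorbit]; exact orbit _
  refine ⟨P, hpos, ?_, fun s => (hz1 s).1, fun s => (step _ (hz1 s).1 (hz1 s).2).2.2.2,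
    fun s => h.one _ _ (hz1 s).2, fun s => ?_, zsucc, hinj, hclosed⟩
  · have := Finset.card_le_card_of_injOn (s := Finset.range P) (t := Finset.range n) z
      (fun s _ => by simpa using (hz1 s).1) (by
        intro a ha b hb hab
        simp only [Finset.coe_range, Set.mem_Iio] at ha hb
        rcases Nat.lt_trichotomy a b with hlt | heq | hlt
        · have := hinj a b hlt hb.le hab
          omega
        · exact heq
        · have := hinj b a hlt ha.le hab.symm
          omega)
    simp only [Finset.card_range] at this
    omega
  · rw [zsucc]
    exact h.one _ _ (step _ (hz1 s).1 (hz1 s).2).2.2.1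

/-- `(x, y)` is one of the first `2 * t` edges of the cycle. -/
def OnPath (q z : ℕ → ℕ) (t x y : ℕ) : Prop :=
  ∃ s < t, (x = z s ∧ y = q (z s)) ∨ (x = q (z s) ∧ y = z (s + 1))

theorem onPath_succ {q z : ℕ → ℕ} {t x y : ℕ} : OnPath q z (t + 1) x y ↔
    OnPath q z t x y ∨ (x = z t ∧ y = q (z t)) ∨ (x = q (z t) ∧ y = z (t + 1)) := by
  constructor
  · rintro ⟨s, hs, h⟩
    rcases Nat.lt_succ_iff_lt_or_eq.1 hs with hs | rfl
    · exact Or.inl ⟨s, hs, h⟩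
    · exact Or.inr h
  · rintro (⟨s, hs, h⟩ | h)
    · exact ⟨s, by omega, h⟩
    · exact ⟨t, by omega, h⟩

open Classical in
/-- What is left of `F` when the first `2 * t` edges of the cycle are removed. -/
noncomputable def peel (F : ℕ → ℕ → ℕ) (q z : ℕ → ℕ) (t : ℕ) : ℕ → ℕ → ℕ :=
  fun x y => if OnPath q z t x y then 0 else F x y

theorem peel_zero (F : ℕ → ℕ → ℕ) (q z : ℕ → ℕ) : peel F q z 0 = F := by
  funext x y
  simp [peel, OnPath]

theorem peel_succ (F : ℕ → ℕ → ℕ) (q z : ℕ → ℕ) (t : ℕ) : peel F q z (t + 1) =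
    cellUpdate (cellUpdate (peel F q z t) (z t) (q (z t)) 0) (q (z t)) (z (t + 1)) 0 := by
  classical
  funext x y
  simp only [peel, cellUpdate, onPath_succ]
  by_cases h1 : OnPath q z t x y <;> by_cases h2 : x = z t ∧ y = q (z t) <;>
    by_cases h3 : x = q (z t) ∧ y = z (t + 1) <;> simp [h1, h2, h3]

variable {F : ℕ → ℕ → ℕ} {q z : ℕ → ℕ} {P : ℕ}

theorem CyclePath.peel_dem (h : CyclePath n m F q z P) {t : ℕ} (ht : t < P) :
    peel F q z t (z t) (q (z t)) = 1 := by
  rw [peel, if_neg, h.dem]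
  rintro ⟨s, hs, ⟨h1, -⟩ | ⟨h1, -⟩⟩
  · have := h.inj s t hs ht.le h1.symm
    omega
  · have := h.agent t
    have := (h.item s).1
    omega

theorem CyclePath.peel_sup (h : CyclePath n m F q z P) {t : ℕ} (ht : t < P) :
    peel F q z t (q (z t)) (z (t + 1)) = 1 := by
  rw [peel, if_neg, h.sup]
  rintro ⟨s, hs, ⟨h1, -⟩ | ⟨h1, -⟩⟩
  · have := h.agent s
    have := (h.item t).1
    omega
  · have h2 : z (s + 1) = z (t + 1) := by rw [h.succ, h.succ, h1]
    have := h.inj (s + 1) (t + 1) (by omega) ht h2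
    omega

/-- Here the head of the missing edge advances while its tail stays fixed, as needed when a cycle is
removed from its start onward. -/
theorem OpenBalanced.remove_left {V : ℕ} {F : ℕ → ℕ → ℕ} {z u y : ℕ} (h : OpenBalanced V F z u)
    (hu : u < V) (hy : y < V) (hF : F u y = 1) : OpenBalanced V (cellUpdate F u y 0) z y := by
  intro c
  have h1 := outSum_cellUpdate (x := u) F hy 0 c
  have h2 := inSum_cellUpdate (y := y) F hu 0 c
  have h3 := h c
  simp only [hF, ite_self, add_zero] at h1 h2
  omega

/-- The removed path from `z 0` to `z t` acts like one missing edge between its ends, and disappears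
when the cycle closes. -/
theorem CyclePath.peel_balanced (h : CyclePath n m F q z P)
    (hF : ∀ c, outSum (n + m) F c = inSum (n + m) F c) {t : ℕ} (ht : t ≤ P) :
    OpenBalanced (n + m) (peel F q z t) (z 0) (z t) := by
  induction t with
  | zero =>
    rw [peel_zero]
    exact OpenBalanced.iff_of_eq.2 hF
  | succ t ih =>
    have h1 := h.agent t
    have h2 := h.agent (t + 1)
    rw [peel_succ]
    refine ((ih (by omega)).remove_left (by omega) (h.item t).2 (h.peel_dem ht)).remove_left
      (h.item t).2 (by omega) ?_
    rw [cellUpdate_of_ne, h.peel_sup ht]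
    have := (h.item t).1
    omega

/-- The exchanges of the cycle. -/
def CyclePath.cycle (h : CyclePath n m F q z P) : Cycle (Fin n) (Fin m) :=
  List.ofFn fun s : Fin P => (⟨z s, h.agent s⟩, ⟨q (z s) - n, by have := h.item s; omega⟩)

theorem CyclePath.length_cycle (h : CyclePath n m F q z P) : h.cycle.length = P := by
  simp [CyclePath.cycle]

theorem CyclePath.getElem_cycle (h : CyclePath n m F q z P) {s : ℕ} (hs : s < h.cycle.length) :
    h.cycle[s] = (⟨z s, h.agent s⟩, ⟨q (z s) - n, by have := h.item s; omega⟩) := by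
  simp [CyclePath.cycle]

theorem CyclePath.mem_cycle (h : CyclePath n m F q z P) {i : Fin n} {j : Fin m} :
    (i, j) ∈ h.cycle ↔ ∃ s < P, (i : ℕ) = z s ∧ n + (j : ℕ) = q (z s) := by
  rw [List.mem_iff_getElem]
  constructor
  · rintro ⟨s, hs, heq⟩
    rw [h.getElem_cycle, Prod.mk.injEq] at heq
    obtain ⟨rfl, rfl⟩ := heq
    have := (h.item s).1
    exact ⟨s, h.length_cycle ▸ hs, rfl, by simp only; omega⟩
  · rintro ⟨s, hs, hi, hj⟩
    refine ⟨s, h.length_cycle.symm ▸ hs, ?_⟩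
    rw [h.getElem_cycle]
    refine Prod.ext (Fin.ext hi.symm) (Fin.ext ?_)
    simp only
    omega

theorem CyclePath.sup_mem (h : CyclePath n m F q z P) {i : Fin n} {j : Fin m} :
    Edge.sup j i ∈ supplyEdges h.cycle ↔
      ∃ s < P, n + (j : ℕ) = q (z s) ∧ (i : ℕ) = z (s + 1) := by
  have hlen : (supplyEdges h.cycle).length = P := by
    simp [supplyEdges, h.length_cycle]
  have hget : ∀ s (hs : s < (supplyEdges h.cycle).length), (supplyEdges h.cycle)[s] = Edge.sup
      ⟨q (z s) - n, by have := h.item s; omega⟩ ⟨z (s + 1), h.agent _⟩ := by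
    intro s hs
    have hs' : s < P := hlen ▸ hs
    simp only [supplyEdges, List.getElem_zipWith, List.getElem_rotate, h.getElem_cycle,
      h.length_cycle]
    -- The rotation wraps around at the last index, where the successor agent is `z P = z 0`.
    congr 2
    rcases Nat.lt_or_ge (s + 1) P with hlt | hge
    · rw [Nat.mod_eq_of_lt hlt]
    · have : s + 1 = P := by omega
      rw [this, Nat.mod_self, h.closed]
  rw [List.mem_iff_getElem]
  constructor
  · rintro ⟨s, hs, heq⟩
    rw [hget, Edge.sup.injEq] at heq
    obtain ⟨rfl, rfl⟩ := heq
    have := (h.item s).1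
    exact ⟨s, hlen ▸ hs, by simp only; omega, rfl⟩
  · rintro ⟨s, hs, hj, hi⟩
    refine ⟨s, hlen.symm ▸ hs, ?_⟩
    rw [hget, Edge.sup.injEq]
    refine ⟨Fin.ext ?_, Fin.ext hi.symm⟩
    simp only
    omega

theorem CyclePath.mem_cycleEdges (h : CyclePath n m F q z P) (e : Edge (Fin n) (Fin m)) :
    e ∈ cycleEdges h.cycle ↔ OnPath q z P (vertexCode e.src) (vertexCode e.tgt) := by
  cases e with
  | dem i j =>
    rw [dem_mem_cycleEdges, h.mem_cycle]
    simp only [Edge.src, Edge.tgt, vertexCode, OnPath]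
    refine exists_congr fun s => and_congr_right fun _ => ?_
    constructor
    · exact Or.inl
    · rintro (h1 | ⟨h1, -⟩)
      · exact h1
      · have := (h.item s).1
        have := i.2
        omega
  | sup j i =>
    rw [sup_mem_cycleEdges, h.sup_mem]
    simp only [Edge.src, Edge.tgt, vertexCode, OnPath]
    refine exists_congr fun s => and_congr_right fun _ => ?_
    constructor
    · exact Or.inr
    · rintro (⟨h1, -⟩ | h1)
      · have := h.agent s
        omega
      · exact h1

theorem CyclePath.isCycle (h : CyclePath n m F q z P) {R : Finset (Edge (Fin n) (Fin m))}
    (hR : FlowMatrix F R) : IsCycle R h.cycle := by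
  have hinj : ∀ a b, a < P → b < P → z a = z b → a = b := by
    intro a b ha hb hab
    rcases Nat.lt_trichotomy a b with hlt | heq | hlt
    · have := h.inj a b hlt hb.le hab
      omega
    · exact heq
    · have := h.inj b a hlt ha.le hab.symm
      omega
  have hinj' : ∀ a b, a < P → b < P → q (z a) = q (z b) → a = b := by
    intro a b ha hb hab
    have h2 : z (a + 1) = z (b + 1) := by rw [h.succ, h.succ, hab]
    rcases Nat.lt_trichotomy a b with hlt | heq | hlt
    · have := h.inj (a + 1) (b + 1) (by omega) hb h2
      omega
    · exact heq
    · have := h.inj (b + 1) (a + 1) (by omega) ha h2.symm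
      omega
  refine ⟨?_, ?_, ?_, ?_⟩
  · intro hnil
    have := h.length_cycle
    rw [hnil] at this
    have := h.pos
    simp_all
  · rw [List.nodup_iff_injective_get]
    rintro ⟨a, ha⟩ ⟨b, hb⟩ hab
    simp only [List.get_eq_getElem, List.getElem_map, h.getElem_cycle, Fin.mk.injEq] at hab
    rw [List.length_map, h.length_cycle] at ha hb
    exact Fin.ext (hinj a b ha hb hab)
  · rw [List.nodup_iff_injective_get]
    rintro ⟨a, ha⟩ ⟨b, hb⟩ hab
    simp only [List.get_eq_getElem, List.getElem_map, h.getElem_cycle, Fin.mk.injEq] at hab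
    rw [List.length_map, h.length_cycle] at ha hb
    have h1 := (h.item a).1
    have h2 := (h.item b).1
    exact Fin.ext (hinj' a b ha hb (by omega))
  · intro e he
    rw [h.mem_cycleEdges] at he
    rw [hR.mem]
    obtain ⟨s, -, ⟨h1, h2⟩ | ⟨h1, h2⟩⟩ := he
    · rw [h1, h2, h.dem]
      exact one_ne_zero
    · rw [h1, h2, h.sup]
      exact one_ne_zero

theorem IsCycle.nodup_cycleEdges {N M : Type*} [DecidableEq N] [DecidableEq M]
    {E : Finset (Edge N M)} {C : Cycle N M} (h : IsCycle E C) : (cycleEdges C).Nodup := by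
  refine List.nodup_append.2 ⟨?_, h.nodup_supplyEdges, ?_⟩
  · refine List.Nodup.of_map Edge.src ?_
    rw [List.map_map]
    have : (Edge.src ∘ fun p : N × M => Edge.dem p.1 p.2) = Sum.inl ∘ Prod.fst := rfl
    rw [this, ← List.map_map]
    exact h.2.1.map Sum.inl_injective
  · rintro e he e' he' rfl
    obtain ⟨p, -, rfl⟩ := List.mem_map.1 he
    exact dem_notMem_supplyEdges he'

theorem CyclePath.flowMatrix (h : CyclePath n m F q z P) {R : Finset (Edge (Fin n) (Fin m))}
    (hR : FlowMatrix F R) :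
    FlowMatrix (peel F q z P) (R \ (cycleEdges h.cycle).toFinset) := by
  have hne : ∀ x y, peel F q z P x y ≠ 0 ↔ F x y ≠ 0 ∧ ¬ OnPath q z P x y := by
    intro x y
    unfold peel
    split_ifs with h1
    · simp [h1]
    · simp [h1]
  refine ⟨fun x y hxy => ?_, fun e => ?_, fun x y hxy => hR.exists_edge x y ((hne x y).1 hxy).1, ?_⟩
  · rw [peel, if_neg ((hne x y).1 hxy).2]
    exact hR.one x y ((hne x y).1 hxy).1
  · rw [hne, Finset.mem_sdiff, hR.mem, List.mem_toFinset, h.mem_cycleEdges]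
  · have := h.peel_balanced hR.balanced le_rfl
    rw [h.closed] at this
    exact OpenBalanced.iff_of_eq.1 this

end Decomposition

end DurableGoods

namespace DurableGoods

open LoopProgram

/-! ### Loops over pairs of counters -/

/-- The invariant rule for a loop over all pairs of counters; `D` is the set of pairs done. -/
theorem exec_for_pairs {a a' : ℕ} {P : LoopProgram} {s : Store}
    (Inv : (ℕ → ℕ → Prop) → Store → Prop) (ha8 : 8 ∉ a :: a' :: P.writes)
    (ha : a ∉ a' :: P.writes)
    (hInv : ∀ D s s', (∀ b, b ≠ a → b ≠ a' → s' b = s b) → Inv D s → Inv D s')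
    (h0 : Inv (fun _ _ => False) s)
    (hstep : ∀ D s', (∀ b, b ∉ a :: a' :: P.writes → s' b = s b) → s' a 0 0 < s 8 0 0 →
      s' a' 0 0 < s 8 0 0 → Inv D s' →
      Inv (fun x y => D x y ∨ (x = s' a 0 0 ∧ y = s' a' 0 0)) (P.exec s')) :
    Inv (fun x y => x < s 8 0 0 ∧ y < s 8 0 0) ((for_ a (for_ a' P)).exec s) := by
  refine exec_for (fun k s' => Inv (fun x y => x < k ∧ y < s 8 0 0) s')
    (fun k s₁ s₂ h => hInv _ _ _ fun b hb _ => h b hb) (by simpa using h0) ?_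
  intro k s₁ hk hs₁ hk₁ hI
  have h8 : s₁ 8 = s 8 := hs₁ 8 ha8
  have := exec_for (a := a') (P := P) (s := s₁)
    (fun k' s' => Inv (fun x y => (x < k ∧ y < s 8 0 0) ∨ (x = k ∧ y < k')) s')
    (fun k s₁ s₂ h => hInv _ _ _ fun b _ hb => h b hb) (by simpa using hI) (by
      intro k' s₂ hk' hs₂ hk₂ hI'
      rw [h8] at hk'
      have hka : s₂ a 0 0 = k := by rw [hs₂ a ha, hk₁]
      have := hstep _ s₂ (fun b hb => by
        rw [hs₂ b (fun h => hb (List.mem_cons_of_mem _ h)), hs₁ b hb]) (hka ▸ hk) (hk₂ ▸ hk') hI'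
      rw [hka, hk₂] at this
      convert this using 3 with x y
      constructor
      · rintro (h | ⟨h1, h2⟩)
        · exact Or.inl (Or.inl h)
        · rcases Nat.lt_succ_iff_lt_or_eq.1 h2 with h2 | h2
          · exact Or.inl (Or.inr ⟨h1, h2⟩)
          · exact Or.inr ⟨h1, h2⟩
      · rintro ((h | ⟨h1, h2⟩) | ⟨h1, h2⟩)
        · exact Or.inl h
        · exact Or.inr ⟨h1, by omega⟩
        · exact Or.inr ⟨h1, by omega⟩)
  rw [h8] at this
  convert this using 3 with x y
  constructor
  · rintro ⟨h1, h2⟩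
    rcases Nat.lt_succ_iff_lt_or_eq.1 h1 with h1 | h1
    · exact Or.inl ⟨h1, h2⟩
    · exact Or.inr ⟨h1, h2⟩
  · rintro (⟨h1, h2⟩ | ⟨h1, h2⟩)
    · exact ⟨by omega, h2⟩
    · exact ⟨by omega, h2⟩

/-! ## The program for the decomposition into cycles

Arrays: `22` the remaining edges, `40` pointers along them, `41` an agent on a remaining edge, `42`
whether there is one, `43` the current agent, `44` the number of exchanges of the current cycle,
`45` the number of cycles, `46` whether the current cycle is complete. -/

/-- Let the pointers follow the edge from counter `13` to counter `14` if it remains. -/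
def followEdge : LoopProgram :=
  .ite (.get 22 (scalar 13) (scalar 14))
    (.seq (setVec 40 (scalar 13) (scalar 14))
      -- The difference is nonzero exactly when the vertex is one of the `n` agents.
      (.ite (.sub (scalar 0) (scalar 13))
        (.seq (setScalar 41 (scalar 13)) (setScalar 42 (.lit 1))) .skip)) .skip

/-- Find pointers along the remaining edges and an agent with such an edge. -/
def findPointers : LoopProgram :=
  .seq (setScalar 42 (.lit 0)) (.for_ 13 (.for_ 14 followEdge))

/-- A pointer is only ever overwritten by another remaining edge out of the same vertex, so the last
writer does not matter. -/
theorem findPointers_spec {s : Store} (hF : ∀ x y, s 22 x y ≠ 0 → x < s 8 0 0 ∧ y < s 8 0 0) :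
    (∀ x y, s 22 x y ≠ 0 → s 22 x (findPointers.exec s 40 x 0) ≠ 0) ∧
    (findPointers.exec s 42 0 0 ≠ 0 → findPointers.exec s 41 0 0 < s 0 0 0 ∧
      ∃ y, s 22 (findPointers.exec s 41 0 0) y ≠ 0) ∧
    (findPointers.exec s 42 0 0 = 0 → ∀ x y, s 22 x y ≠ 0 → s 0 0 0 ≤ x) := by
  rw [findPointers, exec_seq]
  set s₀ := (setScalar 42 (.lit 0)).exec s with hs₀
  have e₀ : ∀ b, b ≠ 42 → s₀ b = s b := by
    intro b hb
    rw [hs₀, exec_setScalar, write_of_ne _ _ _ _ hb]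
  have g₀ : s₀ 42 0 0 = 0 := by
    rw [hs₀, exec_setScalar, write_self, cellUpdate_self]
    rfl
  have := exec_for_pairs (a := 13) (a' := 14) (P := followEdge) (s := s₀)
    (fun D s' => (∀ x y, D x y → s 22 x y ≠ 0 → s 22 x (s' 40 x 0) ≠ 0) ∧
      (s' 42 0 0 ≠ 0 → s' 41 0 0 < s 0 0 0 ∧ ∃ y, s 22 (s' 41 0 0) y ≠ 0) ∧
      (s' 42 0 0 = 0 → ∀ x y, D x y → s 22 x y ≠ 0 → s 0 0 0 ≤ x)) (by decide) (by decide)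
    (fun D s s' hs h => by simpa (disch := decide) only [hs] using h)
    ⟨fun _ _ h => h.elim, fun h => absurd g₀ h, fun _ _ _ h => h.elim⟩ (by
    intro D s' hs' _ _ hI
    have e22 : s' 22 = s 22 := (hs' 22 (by decide)).trans (e₀ 22 (by decide))
    have e0 : s' 0 = s 0 := (hs' 0 (by decide)).trans (e₀ 0 (by decide))
    simp only [followEdge, exec_ite, exec_skip, eval_get, eval_scalar, e22]
    set a := s' 13 0 0 with ha
    set b := s' 14 0 0 with hb
    obtain ⟨i1, i2, i3⟩ := hI
    by_cases h1 : s 22 a b = 0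
    · rw [branch_of_eq h1]
      refine ⟨?_, i2, ?_⟩
      · rintro x y (h | ⟨rfl, rfl⟩) hxy
        · exact i1 x y h hxy
        · exact absurd h1 hxy
      · rintro h0 x y (h | ⟨rfl, rfl⟩) hxy
        · exact i3 h0 x y h hxy
        · exact absurd h1 hxy
    rw [branch_of_ne h1, exec_seq]
    set s₁ := (setVec 40 (scalar 13) (scalar 14)).exec s' with hs₁
    have hs₁' : s₁ = s'.write 40 a 0 b := rfl
    have e₁ : ∀ b, b ≠ 40 → s₁ b = s' b := fun b hb => by rw [hs₁', write_of_ne _ _ _ _ hb]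
    have h40 : ∀ x, s₁ 40 x 0 = if x = a then b else s' 40 x 0 := by
      intro x
      rw [hs₁', write_self]
      simp [cellUpdate]
    have j1 : ∀ x y, (D x y ∨ (x = a ∧ y = b)) → s 22 x y ≠ 0 → s 22 x (s₁ 40 x 0) ≠ 0 := by
      intro x y hD hxy
      rw [h40]
      split_ifs with hxa
      · rw [hxa]
        exact h1
      · exact i1 x y (hD.resolve_right fun h => hxa h.1) hxy
    simp only [exec_ite, exec_skip, Expr.eval, eval_scalar, e₁ 0 (by decide), e₁ 13 (by decide), e0]
    by_cases h2 : s 0 0 0 - a = 0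
    · rw [branch_of_eq (by rw [← ha]; exact h2)]
      refine ⟨j1, ?_, ?_⟩
      · rw [e₁ 42 (by decide), e₁ 41 (by decide)]
        exact i2
      · rw [e₁ 42 (by decide)]
        rintro h0 x y (h | ⟨rfl, rfl⟩) hxy
        · exact i3 h0 x y h hxy
        · omega
    · rw [branch_of_ne (by rw [← ha]; exact h2)]
      simp (disch := decide) only [exec_seq, exec_setScalar, eval_scalar, write_of_ne, write_self,
        cellUpdate_self, e₁, Expr.eval]
      refine ⟨j1, fun _ => ⟨by omega, b, h1⟩, fun h => absurd h one_ne_zero⟩)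
  obtain ⟨h1, h2, h3⟩ := this
  rw [e₀ 8 (by decide)] at h1 h3
  exact ⟨fun x y hxy => h1 x y (hF x y hxy) hxy, h2, fun h0 x y hxy => h3 h0 x y (hF x y hxy) hxy⟩

/-- Emit the next exchange of the current cycle. -/
def emitStep : LoopProgram :=
  .ite (scalar 46) .skip
    (.seq (.set 6 (scalar 45) (scalar 44) (scalar 43))
    (.seq (.set 7 (scalar 45) (scalar 44) (.sub (vec 40 (scalar 43)) (scalar 0)))
    (.seq (.set 22 (scalar 43) (vec 40 (scalar 43)) (.lit 0))
    (.seq (.set 22 (vec 40 (scalar 43)) (vec 40 (vec 40 (scalar 43))) (.lit 0))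
    (.seq (setScalar 43 (vec 40 (vec 40 (scalar 43))))
    (.seq (setScalar 44 (.add (scalar 44) (.lit 1)))
    (.ite (.add (.sub (scalar 43) (scalar 41)) (.sub (scalar 41) (scalar 43))) .skip
      (setScalar 46 (.lit 1)))))))))

/-- The state after `k` steps of the emission of a cycle. -/
structure EmitStore (n : ℕ) (F : ℕ → ℕ → ℕ) (q z : ℕ → ℕ) (P c k : ℕ) (s₀ s : Store) : Prop where
  agent : s 43 0 0 = z (s 44 0 0)
  le : s 44 0 0 ≤ P
  rest : s 22 = peel F q z (s 44 0 0)
  running : s 46 0 0 = 0 → s 44 0 0 = k ∧ k < P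
  stopped : s 46 0 0 ≠ 0 → s 44 0 0 = P
  agents : ∀ t < s 44 0 0, s 6 c t = z t
  items : ∀ t < s 44 0 0, s 7 c t = q (z t) - n
  others : ∀ c', c' ≠ c → s 6 c' = s₀ 6 c' ∧ s 7 c' = s₀ 7 c'

/-- The emission stops at the first return to the starting agent, which by `CyclePath.inj` happens
after exactly `P` steps; later rounds are idle. -/
theorem emitStep_spec {n m : ℕ} {F : ℕ → ℕ → ℕ} {q z : ℕ → ℕ} {P c k : ℕ} {s₀ s : Store}
    (hz : CyclePath n m F q z P) (hn : s 0 0 0 = n) (hc : s 45 0 0 = c)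
    (hq : (fun a => s 40 a 0) = q) (h41 : s 41 0 0 = z 0) (h : EmitStore n F q z P c k s₀ s) :
    EmitStore n F q z P c (k + 1) s₀ (emitStep.exec s) := by
  rw [emitStep, exec_ite, exec_skip, eval_scalar]
  by_cases h1 : s 46 0 0 = 0
  swap
  · rw [branch_of_ne h1]
    exact { h with running := fun h0 => absurd h0 h1 }
  rw [branch_of_eq h1]
  obtain ⟨ht, hk⟩ := h.running h1
  have hq' : ∀ a, s 40 a 0 = q a := fun a => congrFun hq a
  have h43 := h.agent
  rw [ht] at h43
  simp only [exec_seq]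
  set s₁ := ((((((s.write 6 c k (z k)).write 7 c k (q (z k) - n)).write 22 (z k) (q (z k)) 0).write 22
    (q (z k)) (z (k + 1)) 0).write 43 0 0 (z (k + 1))).write 44 0 0 (k + 1)) with hs₁
  have hexec : (setScalar 44 (.add (scalar 44) (.lit 1))).exec
      ((setScalar 43 (vec 40 (vec 40 (scalar 43)))).exec
      ((LoopProgram.set 22 (vec 40 (scalar 43)) (vec 40 (vec 40 (scalar 43))) (.lit 0)).exec
      ((LoopProgram.set 22 (scalar 43) (vec 40 (scalar 43)) (.lit 0)).exec
      ((LoopProgram.set 7 (scalar 45) (scalar 44) (.sub (vec 40 (scalar 43)) (scalar 0))).exec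
      ((LoopProgram.set 6 (scalar 45) (scalar 44) (scalar 43)).exec s))))) = s₁ := by
    simp (disch := decide) only [exec_setScalar, exec_set, eval_scalar, eval_vec, Expr.eval,
      write_of_ne, hn, hc, hq', h43, ht, hs₁, hz.succ]
  rw [hexec, exec_ite]
  have e₁ : ∀ b, b ∉ [6, 7, 22, 43, 44] → s₁ b = s b := by
    intro b hb
    simp only [List.mem_cons, List.not_mem_nil, or_false, not_or] at hb
    obtain ⟨b1, b2, b3, b4, b5⟩ := hb
    rw [hs₁, write_of_ne _ _ _ _ b5, write_of_ne _ _ _ _ b4, write_of_ne _ _ _ _ b3,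
      write_of_ne _ _ _ _ b3, write_of_ne _ _ _ _ b2, write_of_ne _ _ _ _ b1]
  have g43 : s₁ 43 0 0 = z (k + 1) := by
    simp (disch := decide) only [hs₁, write_of_ne, write_self, cellUpdate_self]
  have g44 : s₁ 44 0 0 = k + 1 := by
    simp (disch := decide) only [hs₁, write_self, cellUpdate_self]
  have g22 : s₁ 22 = peel F q z (k + 1) := by
    simp (disch := decide) only [hs₁, write_of_ne, write_self]
    rw [peel_succ, h.rest, ht]
  have g6 : s₁ 6 = cellUpdate (s 6) c k (z k) := by
    simp (disch := decide) only [hs₁, write_of_ne, write_self]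
  have g7 : s₁ 7 = cellUpdate (s 7) c k (q (z k) - n) := by
    simp (disch := decide) only [hs₁, write_of_ne, write_self]
  simp only [Expr.eval, eval_scalar, g43, e₁ 41 (by decide), h41]
  have common : ∀ s₂ : Store, (∀ b, b ≠ 46 → s₂ b = s₁ b) →
      (s₂ 46 0 0 = 0 → k + 1 < P) → (s₂ 46 0 0 ≠ 0 → k + 1 = P) →
      EmitStore n F q z P c (k + 1) s₀ s₂ := by
    intro s₂ hs₂ hrun hHalt
    have e44 : s₂ 44 0 0 = k + 1 := by rw [hs₂ 44 (by decide), g44]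
    constructor
    · rw [e44, hs₂ 43 (by decide), g43]
    · omega
    · rw [e44, hs₂ 22 (by decide), g22]
    · exact fun h0 => ⟨e44, hrun h0⟩
    · exact fun h0 => e44.trans (hHalt h0)
    · intro t ht'
      rw [hs₂ 6 (by decide), g6]
      by_cases htk : t = k
      · rw [htk, cellUpdate_self]
      · rw [cellUpdate_of_ne _ _ (fun _ => htk)]
        exact h.agents t (by omega)
    · intro t ht'
      rw [hs₂ 7 (by decide), g7]
      by_cases htk : t = k
      · rw [htk, cellUpdate_self]
      · rw [cellUpdate_of_ne _ _ (fun _ => htk)]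
        exact h.items t (by omega)
    · intro c' hc'
      rw [hs₂ 6 (by decide), hs₂ 7 (by decide), g6, g7, ← (h.others c' hc').1,
        ← (h.others c' hc').2]
      constructor
      · funext t
        exact cellUpdate_of_ne _ _ fun h => absurd h hc'
      · funext t
        exact cellUpdate_of_ne _ _ fun h => absurd h hc'
  by_cases h2 : z (k + 1) = z 0
  · have hP : k + 1 = P := (hz.inj 0 (k + 1) (by omega) (by omega) h2.symm).2
    rw [branch_of_eq (by omega)]
    refine common _ (fun b hb => ?_) (fun h0 => ?_) fun _ => hP
    · rw [exec_setScalar, write_of_ne _ _ _ _ hb]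
    · rw [exec_setScalar, write_self, cellUpdate_self] at h0
      exact absurd h0 one_ne_zero
  · rw [branch_of_ne (by omega)]
    refine common _ (fun b hb => rfl) (fun _ => ?_) fun h0 => ?_
    · refine lt_of_le_of_ne hk fun hP => h2 ?_
      rw [← hz.closed, ← hP]
    · rw [exec_skip, e₁ 46 (by decide)] at h0
      exact absurd h1 h0

/-- Extract one cycle. -/
def extractCycle : LoopProgram :=
  .seq findPointers
    (.ite (scalar 42)
      -- The double steps that lead from the agent found onto a cycle.
      (.seq (.for_ 12 (setScalar 41 (vec 40 (vec 40 (scalar 41)))))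
      (.seq (setScalar 43 (scalar 41))
      (.seq (setScalar 44 (.lit 0))
      (.seq (setScalar 46 (.lit 0))
      (.seq (.for_ 12 emitStep)
      (.seq (.set 5 (.add (scalar 45) (.lit 1)) (.lit 0) (scalar 44))
        (setScalar 45 (.add (scalar 45) (.lit 1))))))))) .skip)

/-- Either nothing remains and the output is untouched, or one cycle is moved from the remaining
edges to a new place in the output. -/
theorem extractCycle_spec {n m : ℕ} {s : Store} {R : Finset (Edge (Fin n) (Fin m))}
    (hn : s 0 0 0 = n) (h8 : s 8 0 0 = n + m) (hR : FlowMatrix (s 22) R) :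
    (R = ∅ ∧ ∀ b, b ∈ [5, 6, 7, 22, 45] → extractCycle.exec s b = s b) ∨
    ∃ C : Cycle (Fin n) (Fin m), IsCycle R C ∧
      FlowMatrix (extractCycle.exec s 22) (R \ (cycleEdges C).toFinset) ∧
      extractCycle.exec s 45 0 0 = s 45 0 0 + 1 ∧
      extractCycle.exec s 5 (s 45 0 0 + 1) 0 = C.length ∧
      (∀ (t : ℕ) (ht : t < C.length), extractCycle.exec s 6 (s 45 0 0) t = (C[t].1 : ℕ) ∧
        extractCycle.exec s 7 (s 45 0 0) t = (C[t].2 : ℕ)) ∧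
      ∀ c, c ≠ s 45 0 0 → extractCycle.exec s 5 (c + 1) = s 5 (c + 1) ∧
        extractCycle.exec s 6 c = s 6 c ∧ extractCycle.exec s 7 c = s 7 c := by
  have hlt : ∀ x y, s 22 x y ≠ 0 → x < s 8 0 0 ∧ y < s 8 0 0 := by
    intro x y hxy
    rw [h8]
    obtain ⟨e, rfl, rfl⟩ := hR.exists_edge x y hxy
    exact ⟨vertexCode_lt _, vertexCode_lt _⟩
  obtain ⟨p1, p2, p3⟩ := findPointers_spec hlt
  rw [extractCycle, exec_seq]
  set s₁ := findPointers.exec s with hs₁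
  have e₁ : ∀ b, b ∉ [13, 14, 40, 41, 42] → s₁ b = s b := by
    intro b hb
    rw [hs₁, exec_frame]
    simp [findPointers, followEdge, writes, setScalar, setVec] at hb ⊢
    tauto
  rw [exec_ite, exec_skip, eval_scalar]
  by_cases h0 : s₁ 42 0 0 = 0
  · left
    rw [branch_of_eq h0]
    refine ⟨?_, fun b hb => e₁ b ?_⟩
    · rw [Finset.eq_empty_iff_forall_notMem]
      intro e he
      have hF := (hR.mem e).1 he
      have hx := p3 h0 _ _ hF
      -- An edge arriving at an agent continues from there, so if no agent has an outgoing edge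
      -- there is no edge at all.
      obtain ⟨y, hy⟩ := hR.exists_out hF
      have hx' := p3 h0 _ _ hy
      rcases hR.bipartite hF with h | h <;> omega
    · revert b
      decide
  right
  rw [branch_of_ne h0]
  obtain ⟨ha, y, hy⟩ := p2 h0
  set q : ℕ → ℕ := fun x => s₁ 40 x 0 with hq
  set a := s₁ 41 0 0 with ha'
  rw [hn] at ha
  obtain ⟨P, hP⟩ := hR.cyclePath (q := q) p1 ha (p1 _ _ hy)
  set f : ℕ → ℕ := fun x => q (q x) with hf
  set z : ℕ → ℕ := fun s => f^[s] (f^[n + m] a) with hz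
  simp only [exec_seq]
  set s₂ := (for_ 12 (setScalar 41 (vec 40 (vec 40 (scalar 41))))).exec s₁ with hs₂
  have e₂ : ∀ b, b ∉ [12, 41] → s₂ b = s₁ b := by
    intro b hb
    rw [hs₂, exec_frame]
    simp [writes, setScalar] at hb ⊢
    tauto
  have h41 : s₂ 41 0 0 = z 0 := by
    have := exec_for (a := 12) (P := setScalar 41 (vec 40 (vec 40 (scalar 41)))) (s := s₁)
      (fun k s' => s' 41 0 0 = f^[k] a)
      (fun k s s' hs h => by simpa (disch := decide) only [hs] using h) rfl (by
        intro k s' _ hs' _ hI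
        have e40 : s' 40 = s₁ 40 := hs' 40 (by decide)
        rw [exec_setScalar, write_self, cellUpdate_self, Function.iterate_succ_apply', ← hI]
        simp only [eval_vec, eval_scalar, e40, hf, hq])
    rw [e₁ 8 (by decide), h8] at this
    exact this
  set s₃ := (setScalar 46 (.lit 0)).exec ((setScalar 44 (.lit 0)).exec
    ((setScalar 43 (scalar 41)).exec s₂)) with hs₃
  have hs₃' : s₃ = ((s₂.write 43 0 0 (z 0)).write 44 0 0 0).write 46 0 0 0 := by
    rw [← h41]
    rfl
  have e₃ : ∀ b, b ∉ [43, 44, 46] → s₃ b = s₂ b := by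
    intro b hb
    simp only [List.mem_cons, List.not_mem_nil, or_false, not_or] at hb
    rw [hs₃', write_of_ne _ _ _ _ hb.2.2, write_of_ne _ _ _ _ hb.2.1, write_of_ne _ _ _ _ hb.1]
  have E₃ : ∀ b, b ∉ [12, 13, 14, 40, 41, 42, 43, 44, 46] → s₃ b = s b := by
    intro b hb
    rw [e₃, e₂, e₁]
    all_goals
      simp at hb ⊢
      tauto
  have g43 : s₃ 43 0 0 = z 0 := by
    simp (disch := decide) only [hs₃', write_of_ne, write_self, cellUpdate_self]
  have g44 : s₃ 44 0 0 = 0 := by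
    simp (disch := decide) only [hs₃', write_of_ne, write_self, cellUpdate_self]
  have g46 : s₃ 46 0 0 = 0 := by
    simp (disch := decide) only [hs₃', write_self, cellUpdate_self]
  set c := s 45 0 0 with hc
  have hE : EmitStore n (s 22) q z P c (n + m) s ((for_ 12 emitStep).exec s₃) := by
    have := exec_for (a := 12) (P := emitStep) (s := s₃)
      (fun k s' => EmitStore n (s 22) q z P c k s s')
      (fun k s₁ s₂ hs h => by
        obtain ⟨i1, i2, i3, i4, i5, i6, i7, i8⟩ := h
        constructor <;> simpa (disch := decide) only [hs])
      (by
        refine ⟨?_, ?_, ?_, fun _ => ⟨g44, hP.pos⟩, fun h => absurd g46 h, ?_, ?_, ?_⟩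
        · rw [g43, g44]
        · omega
        · rw [g44, peel_zero, E₃ 22 (by decide)]
        · intro t ht
          omega
        · intro t ht
          omega
        · intro c' _
          rw [E₃ 6 (by decide), E₃ 7 (by decide)]
          exact ⟨rfl, rfl⟩) (by
        intro k s' _ hs' _ hI
        refine emitStep_spec hP ?_ ?_ ?_ ?_ hI
        · rw [hs' 0 (by decide), E₃ 0 (by decide), hn]
        · rw [hs' 45 (by decide), E₃ 45 (by decide)]
        · rw [hs' 40 (by decide), e₃ 40 (by decide), e₂ 40 (by decide)]
        · rw [hs' 41 (by decide), e₃ 41 (by decide), h41])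
    rw [E₃ 8 (by decide), h8] at this
    exact this
  set s₄ := (for_ 12 emitStep).exec s₃ with hs₄
  have e₄ : ∀ b, b ∈ [5, 45] → s₄ b = s b := by
    intro b hb
    rw [hs₄, exec_frame, E₃]
    · revert b
      decide
    · revert b
      decide
  -- The loop has `n + m ≥ P` rounds, so the cycle is complete.
  have ht : s₄ 44 0 0 = P := by
    refine hE.stopped fun hrun => ?_
    have := (hE.running hrun).2
    have := hP.le
    omega
  set s₅ := (setScalar 45 (.add (scalar 45) (.lit 1))).exec
    ((LoopProgram.set 5 (.add (scalar 45) (.lit 1)) (.lit 0) (scalar 44)).exec s₄) with hs₅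
  have hs₅' : s₅ = (s₄.write 5 (c + 1) 0 P).write 45 0 0 (c + 1) := by
    simp (disch := decide) only [hs₅, exec_setScalar, exec_set, Expr.eval, eval_scalar,
      write_of_ne, e₄, ht, hc]
  have e₅ : ∀ b, b ≠ 5 → b ≠ 45 → s₅ b = s₄ b := by
    intro b h1 h2
    rw [hs₅', write_of_ne _ _ _ _ h2, write_of_ne _ _ _ _ h1]
  have h5 : s₅ 5 = cellUpdate (s 5) (c + 1) 0 P := by
    rw [hs₅', write_of_ne _ _ _ _ (by decide), write_self, e₄ 5 (by decide)]
  refine ⟨hP.cycle, hP.isCycle hR, ?_, ?_, ?_, ?_, ?_⟩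
  · rw [e₅ 22 (by decide) (by decide), hE.rest, ht]
    exact hP.flowMatrix hR
  · rw [hs₅', write_self, cellUpdate_self]
  · rw [h5, cellUpdate_self, hP.length_cycle]
  · intro t ht'
    rw [hP.getElem_cycle, e₅ 6 (by decide) (by decide), e₅ 7 (by decide) (by decide)]
    rw [hP.length_cycle] at ht'
    exact ⟨hE.agents t (by omega), hE.items t (by omega)⟩
  · intro c' hc'
    rw [h5, e₅ 6 (by decide) (by decide), e₅ 7 (by decide) (by decide)]
    refine ⟨?_, hE.others c' hc'⟩
    funext t
    exact cellUpdate_of_ne _ _ fun h => by omega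

/-- Decompose the circulation into cycles. -/
def decompose : LoopProgram :=
  .seq (setScalar 45 (.lit 0))
  (.seq (.for_ 10 (.for_ 11 extractCycle)) (.set 5 (.lit 0) (.lit 0) (scalar 45)))

/-- The state of the decomposition of `R₀` after `k` rounds. -/
def DecomposeStore {n m : ℕ} (R₀ : Finset (Edge (Fin n) (Fin m))) (k : ℕ) (s : Store) : Prop :=
  ∃ (r : Execution (Fin n) (Fin m)) (R : Finset (Edge (Fin n) (Fin m))), FlowMatrix (s 22) R ∧
    s 45 0 0 = r.length ∧
    (∀ (k : ℕ) (hk : k < r.length), s 5 (k + 1) 0 = (r[k]).length ∧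
      ∀ (t : ℕ) (ht : t < (r[k]).length),
        s 6 k t = ((r[k])[t].1 : ℕ) ∧ s 7 k t = ((r[k])[t].2 : ℕ)) ∧
    (∀ C ∈ r, IsCycle R₀ C) ∧ (r.flatMap cycleEdges).Nodup ∧
    (∀ e, e ∈ R₀ ↔ e ∈ R ∨ e ∈ r.flatMap cycleEdges) ∧ (∀ e ∈ R, e ∉ r.flatMap cycleEdges) ∧
    R.card + r.length ≤ R₀.card ∧ (R ≠ ∅ → k ≤ r.length)

theorem extractCycle_step {n m : ℕ} {s : Store} {R₀ : Finset (Edge (Fin n) (Fin m))} {k : ℕ}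
    (hn : s 0 0 0 = n) (h8 : s 8 0 0 = n + m) (h : DecomposeStore R₀ k s) :
    DecomposeStore R₀ (k + 1) (extractCycle.exec s) := by
  obtain ⟨r, R, hR, h45, hout, hcyc, hnd, hmem, hdisj, hcard, hk⟩ := h
  rcases extractCycle_spec hn h8 hR with ⟨hemp, hsame⟩ | ⟨C, hC, hR', c45, c5, c67, coth⟩
  · refine ⟨r, R, ?_, ?_, ?_, hcyc, hnd, hmem, hdisj, hcard, fun h => absurd hemp h⟩
    · rwa [hsame 22 (by decide)]
    · rwa [hsame 45 (by decide)]
    · rwa [hsame 5 (by decide), hsame 6 (by decide), hsame 7 (by decide)]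
  · have hCR : ∀ e ∈ cycleEdges C, e ∈ R := hC.2.2.2
    have hRR₀ : ∀ e ∈ R, e ∈ R₀ := fun e he => (hmem e).2 (Or.inl he)
    refine ⟨r ++ [C], R \ (cycleEdges C).toFinset, hR', ?_, ?_, ?_, ?_, ?_, ?_, ?_, ?_⟩
    · rw [c45, h45, List.length_append, List.length_singleton]
    · intro k hk
      rw [List.length_append, List.length_singleton] at hk
      by_cases hkr : k = r.length
      · subst hkr
        rw [h45] at c5 c67
        simp only [List.getElem_concat_length]
        exact ⟨c5, c67⟩
      · have hk' : k < r.length := by omega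
        obtain ⟨d1, d2, d3⟩ := coth k (by omega)
        rw [List.getElem_append_left hk', d1, d2, d3]
        exact hout k hk'
    · intro C' hC'
      rcases List.mem_append.1 hC' with hC' | hC'
      · exact hcyc C' hC'
      · rw [List.mem_singleton.1 hC']
        exact ⟨hC.1, hC.2.1, hC.2.2.1, fun e he => hRR₀ e (hCR e he)⟩
    · rw [List.flatMap_append, List.flatMap_singleton, List.nodup_append]
      refine ⟨hnd, hC.nodup_cycleEdges, ?_⟩
      rintro e he e' he' rfl
      exact hdisj e (hCR e he') he
    · intro e
      rw [hmem, List.flatMap_append, List.flatMap_singleton, List.mem_append, Finset.mem_sdiff,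
        List.mem_toFinset]
      have := hCR e
      tauto
    · intro e he
      rw [Finset.mem_sdiff, List.mem_toFinset] at he
      rw [List.flatMap_append, List.flatMap_singleton, List.mem_append, not_or]
      exact ⟨hdisj e he.1, he.2⟩
    · have hsub : (cycleEdges C).toFinset ⊆ R := fun e he => hCR e (List.mem_toFinset.1 he)
      have hpos : 0 < ((cycleEdges C).toFinset).card := by
        obtain ⟨p, l, hp⟩ := List.exists_cons_of_ne_nil hC.1
        refine Finset.card_pos.2 ⟨Edge.dem p.1 p.2, ?_⟩
        rw [List.mem_toFinset, dem_mem_cycleEdges, hp]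
        exact List.mem_cons_self
      have := Finset.card_sdiff_add_card_eq_card hsub
      rw [List.length_append, List.length_singleton]
      omega
    · intro hne
      have : R ≠ ∅ := by
        rintro rfl
        simp at hne
      have := hk this
      rw [List.length_append, List.length_singleton]
      omega

theorem decompose_spec {n m : ℕ} {s : Store} {R : Finset (Edge (Fin n) (Fin m))}
    (hn : s 0 0 0 = n) (h8 : s 8 0 0 = n + m) (hR : FlowMatrix (s 22) R) :
    ∃ r : Execution (Fin n) (Fin m), Outputs (decompose.exec s) r ∧ (∀ C ∈ r, IsCycle R C) ∧
      (r.flatMap cycleEdges).Nodup ∧ ∀ e ∈ R, e ∈ r.flatMap cycleEdges := by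
  rw [decompose, exec_seq, exec_seq]
  set s₁ := (setScalar 45 (.lit 0)).exec s with hs₁
  have e₁ : ∀ b, b ≠ 45 → s₁ b = s b := by
    intro b hb
    rw [hs₁, exec_setScalar, write_of_ne _ _ _ _ hb]
  have g45 : s₁ 45 0 0 = 0 := by
    rw [hs₁, exec_setScalar, write_self, cellUpdate_self]
    rfl
  have main := exec_for_for (a := 10) (a' := 11) (P := extractCycle) (s := s₁)
    (fun k s' => DecomposeStore R k s') (by decide)
    (fun k s₁ s₂ hs h => by simpa (disch := decide) only [DecomposeStore, hs] using h)
    ⟨[], R, by rwa [e₁ 22 (by decide)], g45, by simp, by simp, by simp, by simp, by simp, by simp,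
      by simp⟩ (by
      intro k s' _ hs' hI
      refine extractCycle_step ?_ ?_ hI
      · rw [hs' 0 (by decide), e₁ 0 (by decide), hn]
      · rw [hs' 8 (by decide), e₁ 8 (by decide), h8])
  set s₂ := (for_ 10 (for_ 11 extractCycle)).exec s₁ with hs₂
  obtain ⟨r, R', hR', h45, hout, hcyc, hnd, hmem, -, hcard, hk⟩ := main
  rw [e₁ 8 (by decide), h8] at hk
  -- If edges remained, each of the `(n + m) * (n + m)` rounds would have extracted a cycle and used
  -- up an edge, more than there are.
  have hemp : R' = ∅ := by
    by_contra hne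
    have h1 := hk hne
    have h2 := hR.card_le
    have h3 := Finset.card_pos.2 (Finset.nonempty_iff_ne_empty.2 hne)
    omega
  subst hemp
  refine ⟨r, ⟨?_, ?_⟩, hcyc, hnd, fun e he => ((hmem e).1 he).resolve_left (by simp)⟩
  · rw [exec_set, write_self]
    exact (cellUpdate_self _ _ _ _).trans h45
  · intro k hk
    rw [exec_set, write_self, write_of_ne _ _ _ _ (by decide), write_of_ne _ _ _ _ (by decide)]
    refine ⟨?_, (hout k hk).2⟩
    rw [cellUpdate_of_ne _ _ (fun h => ?_), (hout k hk).1]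
    simp [Expr.eval] at h

end DurableGoods

namespace DurableGoods

open LoopProgram

/-! ## The program for the weights

Arrays: `32` a power of `2`, `33` the square of the number of vertices, `35` an exponent, `36` the
largest power of `2`. -/

/-- Compute the power of `2` whose exponent is in array `35`. -/
def powerOfTwo : LoopProgram :=
  .seq (setScalar 32 (.lit 1))
    (.for_ 13 (.for_ 14 (.ite (scalar 35)
      (.seq (setScalar 32 (.add (scalar 32) (scalar 32)))
        (setScalar 35 (.sub (scalar 35) (.lit 1)))) .skip)))

/-- The double loop offers as many doublings as the square of the loop length, and this is why the
exponent is bounded by it. -/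
theorem powerOfTwo_spec {s : Store} (h : s 35 0 0 ≤ s 8 0 0 * s 8 0 0) :
    powerOfTwo.exec s 32 0 0 = 2 ^ s 35 0 0 := by
  rw [powerOfTwo, exec_seq]
  set s₁ := (setScalar 32 (.lit 1)).exec s with hs₁
  have e₁ : ∀ b, b ≠ 32 → s₁ b = s b := by
    intro b hb
    rw [hs₁, exec_setScalar, write_of_ne _ _ _ _ hb]
  have := exec_for_for (a := 13) (a' := 14) (P := .ite (scalar 35)
      (.seq (setScalar 32 (.add (scalar 32) (scalar 32)))
        (setScalar 35 (.sub (scalar 35) (.lit 1)))) .skip) (s := s₁)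
    (fun k s' => s' 35 0 0 = s 35 0 0 - k ∧ s' 32 0 0 = 2 ^ min k (s 35 0 0)) (by decide)
    (fun k s s' hs h => by simpa (disch := decide) only [hs] using h) (by
      refine ⟨?_, ?_⟩
      · rw [e₁ 35 (by decide), Nat.sub_zero]
      · rw [hs₁, exec_setScalar, write_self, cellUpdate_self]
        simp [Expr.eval]) (by
      intro k s' _ _ hI
      obtain ⟨h1, h2⟩ := hI
      rw [exec_ite, eval_scalar]
      by_cases h0 : s' 35 0 0 = 0
      · rw [branch_of_eq h0, exec_skip]
        refine ⟨by omega, ?_⟩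
        rw [h2]
        congr 1
        omega
      · rw [branch_of_ne h0]
        simp (disch := decide) only [exec_seq, exec_setScalar, Expr.eval, eval_scalar, write_of_ne,
          write_self, cellUpdate_self]
        refine ⟨by omega, ?_⟩
        rw [h2, ← two_mul, ← pow_succ']
        congr 1
        omega)
  rw [this.2, e₁ 8 (by decide)]
  congr 1
  omega

/-- Compute the weights of the edges that join agent `i` in counter `10` and item `j` in
counter `11`. -/
def setWeights : LoopProgram :=
  .seq (setScalar 35 (.sub (scalar 33) (.get 4 (scalar 10) (scalar 11))))
  (.seq powerOfTwo
  (.seq (.ite (.get 2 (scalar 10) (scalar 11))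
      (.set 20 (scalar 10) (.add (scalar 0) (scalar 11)) (.add (scalar 36) (scalar 32))) .skip)
    (.ite (.get 3 (scalar 10) (scalar 11))
      (.set 20 (.add (scalar 0) (scalar 11)) (scalar 10) (.add (scalar 36) (scalar 32))) .skip)))

/-- Compute all weights. -/
def computeWeights : LoopProgram :=
  .seq (setScalar 33 (.lit 0))
  -- The machine cannot multiply, so the square of the number of vertices is counted.
  (.seq (.for_ 13 (.for_ 14 (setScalar 33 (.add (scalar 33) (.lit 1)))))
  (.seq (setScalar 35 (scalar 33))
  (.seq powerOfTwo
  (.seq (setScalar 36 (scalar 32)) (.for_ 10 (.for_ 11 setWeights))))))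

/-- The weights of the edges, where `d`, `e` and `k` are the matrices of demands, supplies and
ranks. -/
def weightMatrix (n B : ℕ) (d e k : ℕ → ℕ → ℕ) (x y : ℕ) : ℕ :=
  if n ≤ y ∧ d x (y - n) ≠ 0 then 2 ^ B + 2 ^ (B - k x (y - n))
  else if n ≤ x ∧ e y (x - n) ≠ 0 then 2 ^ B + 2 ^ (B - k y (x - n)) else 0

/-- While the weights are filled in, every entry is `0` or final, so no write ever spoils an earlier
one. -/
theorem cellUpdate_toward {W G : ℕ → ℕ → ℕ} (h : ∀ x y, G x y = 0 ∨ G x y = W x y) (a b : ℕ) :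
    (∀ x y, cellUpdate G a b (W a b) x y = 0 ∨ cellUpdate G a b (W a b) x y = W x y) ∧
      ∀ x y, G x y = W x y → cellUpdate G a b (W a b) x y = W x y := by
  constructor <;> intro x y <;> by_cases hc : x = a ∧ y = b
  · rw [hc.1, hc.2, cellUpdate_self]
    exact Or.inr rfl
  · rw [cellUpdate_of_ne _ _ (by tauto)]
    exact h x y
  · rw [hc.1, hc.2, cellUpdate_self]
    exact fun _ => rfl
  · rw [cellUpdate_of_ne _ _ (by tauto)]
    exact id

theorem setWeights_spec {n : ℕ} {s : Store} (hn : s 0 0 0 = n)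
    (h3 : ∀ i j, s 3 i j ≠ 0 → i < n) (hB : s 33 0 0 = s 8 0 0 * s 8 0 0)
    (h36 : s 36 0 0 = 2 ^ s 33 0 0)
    (h : ∀ x y, s 20 x y = 0 ∨ s 20 x y = weightMatrix n (s 33 0 0) (s 2) (s 3) (s 4) x y) :
    (∀ x y, setWeights.exec s 20 x y = 0 ∨
      setWeights.exec s 20 x y = weightMatrix n (s 33 0 0) (s 2) (s 3) (s 4) x y) ∧
    (∀ x y, s 20 x y = weightMatrix n (s 33 0 0) (s 2) (s 3) (s 4) x y →
      setWeights.exec s 20 x y = weightMatrix n (s 33 0 0) (s 2) (s 3) (s 4) x y) ∧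
    (s 10 0 0 < n → setWeights.exec s 20 (s 10 0 0) (n + s 11 0 0)
        = weightMatrix n (s 33 0 0) (s 2) (s 3) (s 4) (s 10 0 0) (n + s 11 0 0) ∧
      setWeights.exec s 20 (n + s 11 0 0) (s 10 0 0)
        = weightMatrix n (s 33 0 0) (s 2) (s 3) (s 4) (n + s 11 0 0) (s 10 0 0)) := by
  set i := s 10 0 0 with hi
  set j := s 11 0 0 with hj
  set B := s 33 0 0 with hB'
  set W := weightMatrix n B (s 2) (s 3) (s 4) with hW
  rw [setWeights, exec_seq, exec_seq, exec_seq]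
  set s₁ := powerOfTwo.exec ((setScalar 35 (.sub (scalar 33)
    (.get 4 (scalar 10) (scalar 11)))).exec s) with hs₁
  have e₁ : ∀ b, b ∉ [13, 14, 32, 35] → s₁ b = s b := by
    intro b hb
    rw [hs₁, exec_frame, exec_frame]
    all_goals
      simp [powerOfTwo, writes, setScalar] at hb ⊢
      tauto
  have h32 : s₁ 32 0 0 = 2 ^ (B - s 4 i j) := by
    have h35 : (setScalar 35 (.sub (scalar 33) (.get 4 (scalar 10) (scalar 11)))).exec s 35 0 0
        = B - s 4 i j := by
      simp only [exec_setScalar, write_self, cellUpdate_self, Expr.eval, eval_scalar, ← hi, ← hj,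
        ← hB']
    have := powerOfTwo_spec (s := (setScalar 35 (.sub (scalar 33)
      (.get 4 (scalar 10) (scalar 11)))).exec s) (by
        rw [h35, exec_frame _ _ (by decide)]
        omega)
    rw [h35] at this
    exact this
  set s₂ := (LoopProgram.ite (.get 2 (scalar 10) (scalar 11)) (.set 20 (scalar 10)
    (.add (scalar 0) (scalar 11)) (.add (scalar 36) (scalar 32))) .skip).exec s₁ with hs₂
  have e₂ : ∀ b, b ≠ 20 → s₂ b = s₁ b := by
    intro b hb
    rw [hs₂, exec_frame]
    simpa [writes] using hb
  have t₂ : (∀ x y, s₂ 20 x y = 0 ∨ s₂ 20 x y = W x y) ∧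
      (∀ x y, s 20 x y = W x y → s₂ 20 x y = W x y) ∧
      (i < n → s₂ 20 i (n + j) = W i (n + j)) := by
    simp (disch := decide) only [hs₂, exec_ite, exec_skip, eval_get, eval_scalar, e₁]
    rw [← hi, ← hj]
    by_cases h0 : s 2 i j = 0
    · rw [branch_of_eq h0, e₁ 20 (by decide)]
      refine ⟨h, fun _ _ => id, fun hin => ?_⟩
      have : W i (n + j) = 0 := by
        simp only [hW, weightMatrix, Nat.add_sub_cancel_left, h0]
        rw [if_neg (by simp), if_neg (by omega)]
      rw [this]
      exact (h i (n + j)).elim id fun h => h.trans this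
    · rw [branch_of_ne h0]
      have hw : W i (n + j) = 2 ^ B + 2 ^ (B - s 4 i j) := by
        simp only [hW, weightMatrix, Nat.add_sub_cancel_left]
        rw [if_pos ⟨Nat.le_add_right _ _, h0⟩]
      simp (disch := decide) only [exec_set, write_self, Expr.eval, eval_scalar, e₁, h32, h36, hn,
        ← hi, ← hj]
      rw [← hw]
      obtain ⟨c1, c2⟩ := cellUpdate_toward h i (n + j)
      exact ⟨c1, c2, fun _ => cellUpdate_self _ _ _ _⟩
  obtain ⟨t1, t2, t3⟩ := t₂
  simp (disch := decide) only [exec_ite, exec_skip, eval_get, eval_scalar, e₂, e₁]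
  rw [← hi, ← hj]
  by_cases h0 : s 3 i j = 0
  · rw [branch_of_eq h0]
    refine ⟨t1, t2, fun hin => ⟨t3 hin, ?_⟩⟩
    have : W (n + j) i = 0 := by
      simp only [hW, weightMatrix, Nat.add_sub_cancel_left, h0]
      rw [if_neg (by omega), if_neg (by simp)]
    rw [this]
    exact (t1 (n + j) i).elim id fun h => h.trans this
  · rw [branch_of_ne h0]
    have hw : W (n + j) i = 2 ^ B + 2 ^ (B - s 4 i j) := by
      simp only [hW, weightMatrix, Nat.add_sub_cancel_left]
      have := h3 i j h0
      rw [if_neg (by omega), if_pos ⟨Nat.le_add_right _ _, h0⟩]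
    simp (disch := decide) only [exec_set, write_self, Expr.eval, eval_scalar, e₂, e₁, h32, h36, hn,
      ← hi, ← hj]
    rw [← hw]
    obtain ⟨c1, c2⟩ := cellUpdate_toward t1 (n + j) i
    exact ⟨c1, fun x y hxy => c2 x y (t2 x y hxy),
      fun hin => ⟨c2 _ _ (t3 hin), cellUpdate_self _ _ _ _⟩⟩

theorem computeWeights_spec {n m : ℕ} {s : Store} (hn : s 0 0 0 = n) (h8 : s 8 0 0 = n + m)
    (h2 : ∀ i j, s 2 i j ≠ 0 → i < n ∧ j < m) (h3 : ∀ i j, s 3 i j ≠ 0 → i < n ∧ j < m)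
    (h20 : s 20 = fun _ _ => 0) :
    computeWeights.exec s 20
      = weightMatrix n ((n + m) * (n + m)) (s 2) (s 3) (s 4) := by
  rw [computeWeights, exec_seq, exec_seq, exec_seq, exec_seq, exec_seq]
  set s₁ := (setScalar 33 (.lit 0)).exec s with hs₁
  have e₁ : ∀ b, b ≠ 33 → s₁ b = s b := by
    intro b hb
    rw [hs₁, exec_setScalar, write_of_ne _ _ _ _ hb]
  set s₂ := (for_ 13 (for_ 14 (setScalar 33 (.add (scalar 33) (.lit 1))))).exec s₁ with hs₂
  have e₂ : ∀ b, b ∉ [13, 14, 33] → s₂ b = s b := by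
    intro b hb
    rw [hs₂, exec_frame, e₁]
    all_goals
      simp [writes, setScalar] at hb ⊢
      tauto
  have g33 : s₂ 33 0 0 = (n + m) * (n + m) := by
    have := exec_for_for (a := 13) (a' := 14) (P := setScalar 33 (.add (scalar 33) (.lit 1)))
      (s := s₁) (fun k s' => s' 33 0 0 = k) (by decide)
      (fun k s s' hs h => by simpa (disch := decide) only [hs] using h)
      (by rw [hs₁, exec_setScalar, write_self, cellUpdate_self]; rfl) (by
      intro k s' _ _ hI
      rw [exec_setScalar, write_self, cellUpdate_self, Expr.eval, eval_scalar, hI]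
      rfl)
    rw [e₁ 8 (by decide), h8] at this
    exact this
  set s₃ := powerOfTwo.exec ((setScalar 35 (scalar 33)).exec s₂) with hs₃
  have e₃ : ∀ b, b ∉ [13, 14, 32, 35] → s₃ b = s₂ b := by
    intro b hb
    rw [hs₃, exec_frame, exec_frame]
    all_goals
      simp [powerOfTwo, writes, setScalar] at hb ⊢
      tauto
  have g32 : s₃ 32 0 0 = 2 ^ ((n + m) * (n + m)) := by
    have h35 : (setScalar 35 (scalar 33)).exec s₂ 35 0 0 = (n + m) * (n + m) := by
      rw [exec_setScalar, write_self, cellUpdate_self, eval_scalar, g33]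
    have := powerOfTwo_spec (s := (setScalar 35 (scalar 33)).exec s₂) (by
      rw [h35, exec_frame _ _ (by decide), e₂ 8 (by decide), h8])
    rw [h35] at this
    exact this
  set s₄ := (setScalar 36 (scalar 32)).exec s₃ with hs₄
  have e₄ : ∀ b, b ≠ 36 → s₄ b = s₃ b := by
    intro b hb
    rw [hs₄, exec_setScalar, write_of_ne _ _ _ _ hb]
  have g36 : s₄ 36 0 0 = 2 ^ ((n + m) * (n + m)) := by
    rw [hs₄, exec_setScalar, write_self, cellUpdate_self, eval_scalar, g32]
  have E₄ : ∀ b, b ∉ [13, 14, 32, 33, 35, 36] → s₄ b = s b := by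
    intro b hb
    rw [e₄, e₃, e₂]
    all_goals
      simp at hb ⊢
      tauto
  have g33' : s₄ 33 0 0 = (n + m) * (n + m) := by
    rw [e₄ 33 (by decide), e₃ 33 (by decide), g33]
  set W := weightMatrix n ((n + m) * (n + m)) (s 2) (s 3) (s 4) with hW
  have main := exec_for_pairs (a := 10) (a' := 11) (P := setWeights) (s := s₄)
    (fun D s' => (∀ x y, s' 20 x y = 0 ∨ s' 20 x y = W x y) ∧ ∀ i j, D i j → i < n →
      s' 20 i (n + j) = W i (n + j) ∧ s' 20 (n + j) i = W (n + j) i) (by decide) (by decide)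
    (fun D s s' hs h => by simpa (disch := decide) only [hs] using h)
    ⟨fun x y => Or.inl (by rw [E₄ 20 (by decide), h20]), fun _ _ h => h.elim⟩ (by
    intro D s' hs' _ _ hI
    have e : ∀ b, b ∈ [0, 2, 3, 4, 8, 33, 36] → s' b = s₄ b := by
      intro b hb
      refine hs' b ?_
      revert b
      decide
    have hspec := setWeights_spec (n := n) (s := s')
    simp (disch := decide) only [e] at hspec
    simp (disch := decide) only [E₄, g33', g36] at hspec
    obtain ⟨r1, r2, r3⟩ := hspec hn (fun i j h => (h3 i j h).1) (by rw [h8]) trivial hI.1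
    refine ⟨r1, ?_⟩
    rintro i j (hD | ⟨rfl, rfl⟩) hin
    · obtain ⟨i1, i2⟩ := hI.2 i j hD hin
      exact ⟨r2 _ _ i1, r2 _ _ i2⟩
    · exact r3 hin)
  obtain ⟨m1, m2⟩ := main
  rw [E₄ 8 (by decide), h8] at m2
  funext x y
  by_cases h0 : W x y = 0
  · rw [h0]
    exact (m1 x y).elim id fun h => h.trans h0
  · have h0' := h0
    simp only [hW, weightMatrix] at h0'
    split_ifs at h0' with c1 c2
    · obtain ⟨hx, hy⟩ := h2 _ _ c1.2
      have := (m2 x (y - n) ⟨by omega, by omega⟩ hx).1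
      rwa [Nat.add_sub_cancel' c1.1] at this
    · obtain ⟨hy, hx⟩ := h3 _ _ c2.2
      have := (m2 y (x - n) ⟨by omega, by omega⟩ hy).2
      rwa [Nat.add_sub_cancel' c2.1] at this
    · exact absurd rfl h0'

/-! ## Optimality of the computed circulation -/

/-- Balance says that sources and targets form the same multiset, so potential differences cancel
over a balanced set. -/
theorem Balanced.sum_potential {ε V : Type*} [DecidableEq ε] [DecidableEq V] {s t : ε → V}
    {R : Finset ε} (h : Balanced s t R) (p : V → ℕ) :
    ∑ e ∈ R, p (s e) = ∑ e ∈ R, p (t e) := by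
  have hmap : R.val.map s = R.val.map t := by
    ext v
    have := h v
    rw [Multiset.count_map, Multiset.count_map]
    simpa [Finset.card, Finset.filter, eq_comm] using this
  have key : ∀ g : ε → V, ∑ e ∈ R, p (g e) = ((R.val.map g).map p).sum := by
    intro g
    rw [Multiset.map_map]
    rfl
  rw [key, key, hmap]

/-- Complementary slackness implies optimality. -/
theorem sum_le_of_slack {ε V : Type*} [DecidableEq ε] [DecidableEq V] {s t : ε → V}
    {E F G : Finset ε} {w : ε → ℕ} {p : V → ℕ} (hF : Balanced s t F) (hG : Balanced s t G)
    (hGE : G ⊆ E) (used : ∀ e ∈ F, p (t e) ≤ w e + p (s e))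
    (unused : ∀ e ∈ E, e ∉ F → w e + p (s e) ≤ p (t e)) : ∑ e ∈ G, w e ≤ ∑ e ∈ F, w e := by
  have hF' := hF.sum_potential p
  have hG' := hG.sum_potential p
  have h1 := Finset.sum_inter_add_sum_sdiff G F w
  have h2 := Finset.sum_inter_add_sum_sdiff G F fun e => p (s e)
  have h3 := Finset.sum_inter_add_sum_sdiff G F fun e => p (t e)
  have h4 := Finset.sum_inter_add_sum_sdiff F G w
  have h5 := Finset.sum_inter_add_sum_sdiff F G fun e => p (s e)
  have h6 := Finset.sum_inter_add_sum_sdiff F G fun e => p (t e)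
  -- Linear programming duality: the reduced weight `w e + p (s e) - p (t e)` is nonpositive on `G \
  -- F` and nonnegative on `F \ G`, and over balanced sets it sums to the weight.
  have h7 : ∑ e ∈ G \ F, w e + ∑ e ∈ G \ F, p (s e) ≤ ∑ e ∈ G \ F, p (t e) := by
    rw [← Finset.sum_add_distrib]
    refine Finset.sum_le_sum fun e he => ?_
    rw [Finset.mem_sdiff] at he
    exact unused e (hGE he.1) he.2
  have h8 : ∑ e ∈ F \ G, p (t e) ≤ ∑ e ∈ F \ G, w e + ∑ e ∈ F \ G, p (s e) := by
    rw [← Finset.sum_add_distrib]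
    exact Finset.sum_le_sum fun e he => used e (Finset.mem_sdiff.1 he).1
  rw [Finset.inter_comm] at h4 h5 h6
  omega

theorem FlowMatrix.finset_balanced {n m : ℕ} {F : ℕ → ℕ → ℕ} {R : Finset (Edge (Fin n) (Fin m))}
    (h : FlowMatrix F R) : Balanced Edge.src Edge.tgt R := by
  have hsum : ∀ g : ℕ → ℕ, (∀ y, g y ≠ 0 → g y = 1) → ∑ y ∈ Finset.range (n + m), g y
      = ((Finset.range (n + m)).filter fun y => g y ≠ 0).card := by
    intro g hg
    rw [Finset.card_filter]
    refine Finset.sum_congr rfl fun y _ => ?_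
    by_cases hy : g y = 0
    · simp [hy]
    · rw [hg y hy, if_pos one_ne_zero]
  intro v
  have h1 : (R.filter fun e => e.src = v).card = outSum (n + m) F (vertexCode v) := by
    rw [outSum, hsum _ fun y => h.one _ y]
    refine Finset.card_bij (fun e _ => vertexCode e.tgt) ?_ ?_ ?_
    · intro e he
      obtain ⟨heR, rfl⟩ := Finset.mem_filter.1 he
      exact Finset.mem_filter.2 ⟨Finset.mem_range.2 (vertexCode_lt _), (h.mem e).1 heR⟩
    · intro a ha b hb hab
      exact edge_ext ((Finset.mem_filter.1 ha).2.trans (Finset.mem_filter.1 hb).2.symm)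
        (vertexCode_injective hab)
    · intro y hy
      obtain ⟨-, hy⟩ := Finset.mem_filter.1 hy
      obtain ⟨e, h1, rfl⟩ := h.exists_edge _ _ hy
      have hv := vertexCode_injective h1
      subst hv
      exact ⟨e, Finset.mem_filter.2 ⟨(h.mem e).2 hy, rfl⟩, rfl⟩
  have h2 : (R.filter fun e => e.tgt = v).card = inSum (n + m) F (vertexCode v) := by
    rw [inSum, hsum _ fun y => h.one y _]
    refine Finset.card_bij (fun e _ => vertexCode e.src) ?_ ?_ ?_
    · intro e he
      obtain ⟨heR, rfl⟩ := Finset.mem_filter.1 he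
      exact Finset.mem_filter.2 ⟨Finset.mem_range.2 (vertexCode_lt _), (h.mem e).1 heR⟩
    · intro a ha b hb hab
      exact edge_ext (vertexCode_injective hab)
        ((Finset.mem_filter.1 ha).2.trans (Finset.mem_filter.1 hb).2.symm)
    · intro y hy
      obtain ⟨-, hy⟩ := Finset.mem_filter.1 hy
      obtain ⟨e, rfl, h1⟩ := h.exists_edge _ _ hy
      have hv := vertexCode_injective h1
      subst hv
      exact ⟨e, Finset.mem_filter.2 ⟨(h.mem e).2 hy, rfl⟩, rfl⟩
  rw [h1, h2, h.balanced]

/-- The matrix of a set of agent-item pairs. -/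
theorem matrixArray_mem {n m : ℕ} (S : Fin n → Finset (Fin m)) (u v : ℕ) :
    matrixArray (fun i j => if j ∈ S i then 1 else 0) u v ≠ 0 ↔
      ∃ i j, j ∈ S i ∧ u = i ∧ v = j := by
  unfold matrixArray
  constructor
  · intro h
    by_cases h1 : u < n ∧ v < m
    · by_cases h2 : (⟨v, h1.2⟩ : Fin m) ∈ S ⟨u, h1.1⟩
      · exact ⟨⟨u, h1.1⟩, ⟨v, h1.2⟩, h2, rfl, rfl⟩
      · simp [h1, h2] at h
    · simp [h1] at h
  · rintro ⟨i, j, h, rfl, rfl⟩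
    simp [h]

/-! ### Correctness of the whole program -/

/-- The algorithm on an input with an order of the agent-item pairs. -/
def mechanismProgram : LoopProgram :=
  .seq computeWeights (.seq maxCirculation decompose)

theorem mechanismProgram_spec {n m : ℕ} (π : EdgeOrder (Fin n) (Fin m))
    (x : Profile (Fin n) (Fin m)) {s : Store} (hn : s 0 0 0 = n) (h8 : s 8 0 0 = n + m)
    (h2 : s 2 = matrixArray fun i j => if j ∈ (x i).demand then 1 else 0)
    (h3 : s 3 = matrixArray fun i j => if j ∈ (x i).supply then 1 else 0)
    (h4 : ∀ (i : Fin n) (j : Fin m), s 4 i j = π.rank (i, j))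
    (h20 : s 20 = fun _ _ => 0) (h21 : s 21 = fun _ _ => 0) (h22 : s 22 = fun _ _ => 0) :
    ∃ r : Execution (Fin n) (Fin m), Outputs (mechanismProgram.exec s) r ∧
      ∃ μ, IsMaxWeightPerfectMatching π (tradingGraph x) μ ∧ Corresponds μ r := by
  set B := (n + m) * (n + m) with hB
  have hBnm : n * m ≤ B := Nat.mul_le_mul (Nat.le_add_right _ _) (Nat.le_add_left _ _)
  have hd : ∀ u v, s 2 u v ≠ 0 ↔ ∃ (i : Fin n) (j : Fin m), j ∈ (x i).demand ∧ u = i ∧ v = j := by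
    intro u v
    rw [h2]
    exact matrixArray_mem (fun i => (x i).demand) u v
  have hs : ∀ u v, s 3 u v ≠ 0 ↔ ∃ (i : Fin n) (j : Fin m), j ∈ (x i).supply ∧ u = i ∧ v = j := by
    intro u v
    rw [h3]
    exact matrixArray_mem (fun i => (x i).supply) u v
  have hW := computeWeights_spec hn h8
    (fun i j h => by obtain ⟨i, j, -, rfl, rfl⟩ := (hd _ _).1 h; exact ⟨i.2, j.2⟩)
    (fun i j h => by obtain ⟨i, j, -, rfl, rfl⟩ := (hs _ _).1 h; exact ⟨i.2, j.2⟩) h20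
  rw [mechanismProgram, exec_seq, exec_seq]
  set s₁ := computeWeights.exec s with hs₁
  have e₁ : ∀ b, b ∉ computeWeights.writes → s₁ b = s b := fun b hb => exec_frame _ _ hb
  set W := weightMatrix n B (s 2) (s 3) (s 4) with hW'
  have hedge : ∀ e ∈ tradingGraph x, W (vertexCode e.src) (vertexCode e.tgt)
      = 2 ^ B + 2 ^ (B - π.rank e.pair) := by
    rintro (⟨i, j⟩ | ⟨j, i⟩) he
    · have h0 : s 2 i j ≠ 0 := (hd _ _).2 ⟨i, j, mem_tradingGraph_dem.1 he, rfl, rfl⟩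
      simp only [hW', weightMatrix, Edge.src, Edge.tgt, Edge.pair, vertexCode,
        Nat.add_sub_cancel_left]
      rw [if_pos ⟨Nat.le_add_right _ _, h0⟩, h4]
    · have h0 : s 3 i j ≠ 0 := (hs _ _).2 ⟨i, j, mem_tradingGraph_sup.1 he, rfl, rfl⟩
      simp only [hW', weightMatrix, Edge.src, Edge.tgt, Edge.pair, vertexCode,
        Nat.add_sub_cancel_left]
      have := i.2
      rw [if_neg (by omega), if_pos ⟨Nat.le_add_right _ _, h0⟩, h4]
  -- Conversely to `hedge`, nonzero entries come from edges, so the matrix describes the trading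
  -- graph and nothing else.
  have hex : ∀ a b, W a b ≠ 0 → ∃ e ∈ tradingGraph x,
      a = vertexCode e.src ∧ b = vertexCode e.tgt := by
    intro a b hab
    simp only [hW', weightMatrix] at hab
    split_ifs at hab with c1 c2
    · obtain ⟨i, j, hij, rfl, hb⟩ := (hd _ _).1 c1.2
      refine ⟨Edge.dem i j, mem_tradingGraph_dem.2 hij, rfl, ?_⟩
      simp only [Edge.tgt, vertexCode]
      omega
    · obtain ⟨i, j, hij, rfl, hb⟩ := (hs _ _).1 c2.2
      refine ⟨Edge.sup j i, mem_tradingGraph_sup.2 hij, ?_, rfl⟩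
      simp only [Edge.src, vertexCode]
      omega
    · exact absurd rfl hab
  have hgraph : IsGraph (n + m) W := by
    intro a b hab
    obtain ⟨e, he, rfl, rfl⟩ := hex a b hab
    refine ⟨vertexCode_lt _, vertexCode_lt _, ?_⟩
    by_contra hba
    obtain ⟨e', he', c1, c2⟩ := hex _ _ hba
    have g1 := vertexCode_injective c1
    have g2 := vertexCode_injective c2
    cases e with
    | dem i j =>
      cases e' with
      | dem i' j' => simp [Edge.src, Edge.tgt] at g1
      | sup j' i' =>
        simp only [Edge.src, Edge.tgt, Sum.inr.injEq, Sum.inl.injEq] at g1 g2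
        subst g1 g2
        exact noOwnDemand_tradingGraph x _ _ he he'
    | sup j i =>
      cases e' with
      | sup j' i' => simp [Edge.src, Edge.tgt] at g1
      | dem i' j' =>
        simp only [Edge.src, Edge.tgt, Sum.inr.injEq, Sum.inl.injEq] at g1 g2
        subst g1 g2
        exact noOwnDemand_tradingGraph x _ _ he' he
  have hcirc := maxCirculation_spec (s := s₁) (by rwa [e₁ 8 (by decide), h8, hW])
    (by rw [e₁ 21 (by decide), h21]) (by rw [e₁ 22 (by decide), h22])
  set s₂ := maxCirculation.exec s₁ with hs₂
  have e₂ : ∀ b, b ∉ maxCirculation.writes → s₂ b = s₁ b := fun b hb => exec_frame _ _ hb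
  rw [e₁ 8 (by decide), h8, hW] at hcirc
  obtain ⟨slack, hbal⟩ := hcirc
  set R := (tradingGraph x).filter fun e => s₂ 22 (vertexCode e.src) (vertexCode e.tgt) ≠ 0 with hR
  have hflow : FlowMatrix (s₂ 22) R := by
    refine ⟨fun a b hab => (slack.used a b hab).1, fun e => ?_, fun a b hab => ?_, hbal⟩
    · rw [hR, Finset.mem_filter]
      refine ⟨fun h => h.2, fun h => ⟨?_, h⟩⟩
      obtain ⟨e', he', h1, h2⟩ := hex _ _ (slack.used _ _ h).2.1
      rwa [edge_ext (vertexCode_injective h1) (vertexCode_injective h2)]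
    · obtain ⟨e, -, h⟩ := hex _ _ (slack.used _ _ hab).2.1
      exact ⟨e, h⟩
  have hmax : IsMaxBalanced π (tradingGraph x) R := by
    refine ⟨Finset.filter_subset _ _, hflow.finset_balanced, fun G hG hGbal => ?_⟩
    have hle : ∑ e ∈ G, W (vertexCode e.src) (vertexCode e.tgt)
        ≤ ∑ e ∈ R, W (vertexCode e.src) (vertexCode e.tgt) := by
      refine sum_le_of_slack (p := fun v => s₂ 23 (vertexCode v) 0) hflow.finset_balanced hGbal hG
        (fun e he => (slack.used _ _ ((hflow.mem e).1 he)).2.2) fun e he he' => ?_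
      refine slack.unused _ _ ?_ ?_
      · by_contra h
        exact he' ((hflow.mem e).2 h)
      · rw [hedge e he]
        positivity
    -- The program uses the exponent `(n + m) * (n + m)`, which is at least `nm`; this only
    -- multiplies all weights by a common power of two.
    have hscale : ∀ A ⊆ tradingGraph x, ∑ e ∈ A, W (vertexCode e.src) (vertexCode e.tgt)
        = 2 ^ (B - n * m) * ∑ e ∈ A, edgeWeight π e := by
      intro A hA
      rw [Finset.mul_sum]
      refine Finset.sum_congr rfl fun e he => ?_
      have hr := π.le_card e.pair
      rw [Fintype.card_fin, Fintype.card_fin] at hr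
      rw [hedge e (hA he), edgeWeight, Fintype.card_fin, Fintype.card_fin, mul_add, ← pow_add,
        ← pow_add]
      congr 2 <;> omega
    rw [hscale G hG, hscale R (Finset.filter_subset _ _)] at hle
    exact Nat.le_of_mul_le_mul_left hle (by positivity)
  obtain ⟨μ, hμ, hμR⟩ := hmax.exists_matching
  obtain ⟨r, hout, hcyc, hnd, hall⟩ := decompose_spec (s := s₂)
    (by rw [e₂ 0 (by decide), e₁ 0 (by decide), hn])
    (by rw [e₂ 8 (by decide), e₁ 8 (by decide), h8]) hflow
  refine ⟨r, hout, μ, hμ, ?_⟩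
  unfold Corresponds
  rw [hμR]
  exact ⟨hcyc, hnd, hall⟩

end DurableGoods

namespace DurableGoods

open LoopProgram

/-! ## The standard order -/

/-- The lexicographic order of the agent-item pairs. -/
def lexOrder (n m : ℕ) : EdgeOrder (Fin n) (Fin m) where
  rank p := p.1 * m + p.2 + 1
  injective := by
    rintro ⟨i, j⟩ ⟨i', j'⟩ h
    refine (finProdFinEquiv (m := n) (n := m)).injective (Fin.ext ?_)
    simp only [finProdFinEquiv_apply_val] at h ⊢
    rw [mul_comm m, mul_comm m]
    omega
  one_le _ := Nat.le_add_left _ _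
  le_card p := by
    rw [Fintype.card_fin, Fintype.card_fin]
    calc p.1 * m + p.2 + 1 ≤ (p.1 + 1) * m := by
          have := p.2.2
          rw [add_mul, one_mul]
          omega
      _ ≤ n * m := Nat.mul_le_mul_right _ p.1.2

/-- Compute in array `37` the rank of the pair in arrays `10` and `11`. -/
def pairRank : LoopProgram :=
  .seq (setScalar 37 (.add (scalar 11) (.lit 1)))
    (.for_ 12 (.ite (.sub (scalar 10) (scalar 12))
      (setScalar 37 (.add (scalar 37) (scalar 1))) .skip))

/-- Fill array `4` with the ranks of the pairs in the lexicographic order. -/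
def computeRanks : LoopProgram :=
  .for_ 10 (.for_ 11 (.seq pairRank (.set 4 (scalar 10) (scalar 11) (scalar 37))))

/-- The product is a repeated addition: `m` is added in those rounds whose counter is below the
agent's number. -/
theorem pairRank_spec {s : Store} (h : s 10 0 0 < s 8 0 0) :
    pairRank.exec s 37 0 0 = s 10 0 0 * s 1 0 0 + s 11 0 0 + 1 := by
  rw [pairRank, exec_seq]
  set s₀ := (setScalar 37 (.add (scalar 11) (.lit 1))).exec s with hs₀
  have e₀ : ∀ b, b ≠ 37 → s₀ b = s b := fun b hb => exec_frame _ _ (by simpa [writes, setScalar])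
  have g₀ : s₀ 37 0 0 = s 11 0 0 + 1 := by
    rw [hs₀, exec_setScalar, write_self, cellUpdate_self]
    rfl
  have main := exec_for (a := 12) (P := .ite (.sub (scalar 10) (scalar 12))
      (setScalar 37 (.add (scalar 37) (scalar 1))) .skip) (s := s₀)
    (fun k s' => s' 37 0 0 = min (s 10 0 0) k * s 1 0 0 + s 11 0 0 + 1)
    (fun k s s' hs h => by simpa (disch := decide) only [hs] using h)
    (by rw [g₀]; simp) (by
    intro k s' hk hs' hk' hI
    have e10 : s' 10 = s 10 := (hs' 10 (by decide)).trans (e₀ 10 (by decide))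
    have e1 : s' 1 = s 1 := (hs' 1 (by decide)).trans (e₀ 1 (by decide))
    simp only [exec_ite, exec_skip, Expr.eval, eval_scalar, exec_setScalar, e10, e1, hk']
    by_cases hlt : k < s 10 0 0
    · rw [branch_of_ne (by omega), write_self, cellUpdate_self, hI, min_eq_right hlt.le,
        min_eq_right hlt]
      ring
    · rw [branch_of_eq (by omega), hI, min_eq_left (by omega), min_eq_left (by omega)])
  rw [main, e₀ 8 (by decide), min_eq_left h.le]

theorem computeRanks_spec (s : Store) {i j : ℕ} (hi : i < s 8 0 0) (hj : j < s 8 0 0) :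
    computeRanks.exec s 4 i j = i * s 1 0 0 + j + 1 := by
  refine exec_for_pairs (a := 10) (a' := 11)
    (P := .seq pairRank (.set 4 (scalar 10) (scalar 11) (scalar 37))) (s := s)
    (fun D s' => ∀ i j, D i j → s' 4 i j = i * s 1 0 0 + j + 1) (by decide) (by decide)
    (fun D s s' hs h => by simpa (disch := decide) only [hs] using h)
    (fun _ _ h => h.elim) ?_ i j ⟨hi, hj⟩
  intro D s' hs' h10 _ hI i j hD
  have e1 : s' 1 = s 1 := hs' 1 (by decide)
  have e8 : s' 8 = s 8 := hs' 8 (by decide)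
  have hr := pairRank_spec (s := s') (by rwa [e8])
  have e : ∀ b, b ∉ pairRank.writes → pairRank.exec s' b = s' b :=
    fun b hb => exec_frame _ _ hb
  simp (disch := decide) only [exec_seq, exec_set, write_self, eval_scalar, e, hr, e1]
  by_cases h : i = s' 10 0 0 ∧ j = s' 11 0 0
  · obtain ⟨rfl, rfl⟩ := h
    rw [cellUpdate_self]
  · rw [cellUpdate, if_neg h]
    exact hI i j (hD.resolve_right h)

/-! ## Polynomial time -/

/-- Store the number of vertices as the length of all loops, and run `P`. -/
def withLoopLength (P : LoopProgram) : Program :=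
  .seq (.set 8 (.lit 0) (.lit 0) (.add (scalar 0) (scalar 1))) P.toProgram

theorem runs_withLoopLength (P : LoopProgram) (hP : P.Ok = true) (h8 : 8 ∉ P.writes) {n m : ℕ}
    (x : Profile (Fin n) (Fin m)) (f : Fin n → Fin m → ℕ) :
    ∃ t, Runs (withLoopLength P) (inputStore x f)
        (P.exec ((inputStore x f).write 8 0 0 (n + m))) t ∧
      t ≤ (Polynomial.C 10 + P.costBound).eval (n + m) := by
  obtain ⟨t, h1, h2⟩ := P.runs_exec hP h8 ((inputStore x f).write 8 0 0 (n + m))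
  refine ⟨_, Runs.seq (Runs.set _ _ _ _ _) h1, ?_⟩
  rw [write_self, cellUpdate_self] at h2
  rw [Polynomial.eval_add, Polynomial.eval_C]
  -- The constant `10` is the exact cost of the assignment that stores `n + m`.
  exact Nat.add_le_add (by decide) h2

theorem exists_run_mechanismProgram {n m : ℕ} (π : EdgeOrder (Fin n) (Fin m))
    (x : Profile (Fin n) (Fin m)) :
    ∃ r s t, (Runs (withLoopLength mechanismProgram) (inputStore x fun i j => π.rank (i, j)) s t ∧
        t ≤ (Polynomial.C 10 + mechanismProgram.costBound).eval (n + m) ∧ Outputs s r) ∧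
      ∃ μ, IsMaxWeightPerfectMatching π (tradingGraph x) μ ∧ Corresponds μ r := by
  obtain ⟨t, h1, h2⟩ := runs_withLoopLength mechanismProgram (by decide) (by decide) x
    fun i j => π.rank (i, j)
  obtain ⟨r, hr, hμ⟩ := mechanismProgram_spec π x
    (s := (inputStore x fun i j => π.rank (i, j)).write 8 0 0 (n + m))
    (by rw [write_of_ne _ _ _ _ (by decide)]; rfl) (by rw [write_self, cellUpdate_self])
    (write_of_ne _ _ _ _ (by decide)) (write_of_ne _ _ _ _ (by decide))
    (fun i j => by
      rw [write_of_ne _ _ _ _ (by decide)]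
      exact dif_pos ⟨i.2, j.2⟩)
    (write_of_ne _ _ _ _ (by decide)) (write_of_ne _ _ _ _ (by decide))
    (write_of_ne _ _ _ _ (by decide))
  exact ⟨r, _, t, ⟨h1, h2, hr⟩, hμ⟩

theorem exists_run_lexOrder {n m : ℕ} (x : Profile (Fin n) (Fin m)) :
    ∃ r s t, (Runs (withLoopLength (.seq computeRanks mechanismProgram))
          (inputStore x fun _ _ => 0) s t ∧
        t ≤ (Polynomial.C 10 + (LoopProgram.seq computeRanks mechanismProgram).costBound).eval
          (n + m) ∧ Outputs s r) ∧
      ∃ μ, IsMaxWeightPerfectMatching (lexOrder n m) (tradingGraph x) μ ∧ Corresponds μ r := by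
  obtain ⟨t, h1, h2⟩ := runs_withLoopLength (.seq computeRanks mechanismProgram) (by decide)
    (by decide) x fun _ _ => 0
  rw [exec_seq] at h1
  set s₀ := (inputStore x fun _ _ => 0).write 8 0 0 (n + m) with hs₀
  have e₀ : ∀ b, b ∉ 8 :: computeRanks.writes →
      computeRanks.exec s₀ b = inputStore x (fun _ _ => 0) b := by
    intro b hb
    rw [List.mem_cons, not_or] at hb
    rw [exec_frame _ _ hb.2, hs₀, write_of_ne _ _ _ _ hb.1]
  have h8 : s₀ 8 0 0 = n + m := by rw [hs₀, write_self, cellUpdate_self]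
  have h1' : s₀ 1 0 0 = m := by
    rw [hs₀, write_of_ne _ _ _ _ (by decide)]
    rfl
  obtain ⟨r, hr, hμ⟩ := mechanismProgram_spec (lexOrder n m) x (s := computeRanks.exec s₀)
    (by rw [e₀ 0 (by decide)]; rfl) (by rw [exec_frame _ _ (by decide), h8])
    (e₀ 2 (by decide)) (e₀ 3 (by decide))
    (fun i j => by
      have := i.2
      have := j.2
      rw [computeRanks_spec _ (by omega) (by omega), h1']
      rfl)
    (e₀ 20 (by decide)) (e₀ 21 (by decide)) (e₀ 22 (by decide))
  exact ⟨r, _, t, ⟨h1, h2, hr⟩, hμ⟩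

theorem exists_isAs_isPolyTimeWithOrder :
    ∃ A : ∀ n m : ℕ, EdgeOrder (Fin n) (Fin m) → Mechanism (Fin n) (Fin m),
      (∀ n m π, IsAs π (A n m π)) ∧ IsPolyTimeWithOrder A := by
  choose A s t h hμ using @exists_run_mechanismProgram
  exact ⟨fun n m π => A π, fun n m π => hμ π, _, _, fun n m π x => ⟨s π x, t π x, h π x⟩⟩

/-- Since the order itself can be computed, it need not be part of the input. -/
theorem exists_isAs_isPolyTime :
    ∃ A : ∀ n m : ℕ, Mechanism (Fin n) (Fin m),
      (∀ n m, IsAs (lexOrder n m) (A n m)) ∧ IsPolyTime A := by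
  choose A s t h hμ using @exists_run_lexOrder
  exact ⟨fun n m => A, fun n m => hμ, _, _, fun n m x => ⟨s x, t x, h x⟩⟩

end DurableGoods

theorem mainTheorem1 :
    -- every version of the mechanism, with any tie-breaking order, has the claimed properties
    (∀ (n m : ℕ) (π : DurableGoods.EdgeOrder (Fin n) (Fin m))
      (A : DurableGoods.Mechanism (Fin n) (Fin m)), DurableGoods.IsAs π A →
        DurableGoods.Strategyproof A ∧
        (∀ x, DurableGoods.IsExecution (DurableGoods.tradingGraph x) (A x)) ∧
        (∀ x, DurableGoods.SuppliesDisjoint x →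
          DurableGoods.IsOptimalStatic x (A x) ∧ DurableGoods.IsLApproximation x (A x))) ∧
    -- the mechanism can be computed in polynomial time, for all orders by the same program
    (∃ A : ∀ n m : ℕ, DurableGoods.EdgeOrder (Fin n) (Fin m) →
          DurableGoods.Mechanism (Fin n) (Fin m),
        (∀ n m π, DurableGoods.IsAs π (A n m π)) ∧ DurableGoods.IsPolyTimeWithOrder A) ∧
    -- there is a polynomial-time strategyproof mechanism that computes an optimal static execution
    -- and gives an `l`-approximation to the optimal execution
    (∃ A : ∀ n m : ℕ, DurableGoods.Mechanism (Fin n) (Fin m),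
        DurableGoods.IsPolyTime A ∧
        ∀ n m : ℕ,
          (∃ π, DurableGoods.IsAs π (A n m)) ∧
          DurableGoods.Strategyproof (A n m) ∧
          (∀ x, DurableGoods.IsExecution (DurableGoods.tradingGraph x) (A n m x)) ∧
          (∀ x, DurableGoods.SuppliesDisjoint x →
            DurableGoods.IsOptimalStatic x (A n m x) ∧
              DurableGoods.IsLApproximation x (A n m x))) := by
  refine ⟨fun n m π A hA => ⟨hA.strategyproof, hA.isExecution,
    fun x hx => ⟨hA.isOptimalStatic hx, hA.isLApproximation x⟩⟩,
    DurableGoods.exists_isAs_isPolyTimeWithOrder, ?_⟩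
  obtain ⟨A, hA, hpoly⟩ := DurableGoods.exists_isAs_isPolyTime
  exact ⟨A, hpoly, fun n m => ⟨⟨_, hA n m⟩, (hA n m).strategyproof, (hA n m).isExecution,
    fun x hx => ⟨(hA n m).isOptimalStatic hx, (hA n m).isLApproximation x⟩⟩⟩
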